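/- For positive integers $n,t$ let $\mathcal{BEC}^d(n,t)$ be the graph on $[n]^d\times[t]$ in which two distinct vertices $(x,i)$ and $(y,j)$ are adjacent iff $x=y$ or $x,y$ are at Euclidean distance $1$; the sets $\{x\}\times[t]$ are its \emph{cells}. A \emph{double subdivision} of an edge $uv$ of a graph replaces $uv$ by a path $u,w,w',v$ with two new vertices $w,w'$; an \emph{even subdivision} of $G$ is a graph obtained from $G$ by a finite (possibly empty) sequence of double subdivisions. \textbf{Theorem.} Let $d\ge 3$ be an integer. There is a constant $K$ depending only on $d$ such that the following holds for every real $L\ge 16$ for which $t=(L/8)^{d-1}$ is an integer. There are a word-RAM program and a constant $c$, both depending only on $d$ and $L$, such that for every integer $s\ge 1$ and every (not necessarily induced) subgraph $G$ of $\mathcal C=\mathcal{BEC}^d(s,t)$ with maximum degree at most three in which the neighbors of each vertex lie in pairwise distinct cells: (a) some even subdivision $G'$ of $G$ is (isomorphic to) the intersection graph of a finite set of closed axis-parallel boxes in $\mathbb R^d$, each having side length $L$ along one coordinate axis and side length $1$ along all the others; (b) $|V(G')|\le K\,|V(G)|$; (c) given $s$ and the adjacency lists of $G$ (stored in an array indexed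 by the vertices of $\mathcal C$, with the neighbors of each vertex in any order), the program outputs the boxes of such a representation of a $G'$ satisfying (a) and (b), each by its long axis and the rational coordinates of its lexicographically smallest corner, in at most $c\,|V(\mathcal C)|$ steps, on words of $O(\log(|V(\mathcal C)|+1))$ bits (with implied constant $c$). -/

import Mathlib

/-! ### The blown-up Euclidean grid -/

/-- The `d`-dimensional Euclidean grid graph on `[n]^d`: two points are adjacent when their (squared)
Euclidean distance is `1`. The side `[n]` is represented by `Fin n`. -/
def gridGraph (d n : ℕ) : SimpleGraph (Fin d → Fin n) where
  Adj x y := ∑ i, (((x i : ℕ) : ℤ) - ((y i : ℕ) : ℤ)) ^ 2 = 1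
  symm := by
    refine ⟨fun x y h => ?_⟩
    rw [← h]
    exact Finset.sum_congr rfl fun i _ => by ring
  loopless := by
    refine ⟨fun x h => ?_⟩
    simp at h

/-- Vertices `(x, i)` of the blow-up: `x` names the cell, `i` the position inside the cell. -/
abbrev BlowupVertex (d n t : ℕ) : Type := (Fin d → Fin n) × Fin t

/-- The `t`-fold blow-up of the grid: cells are cliques, neighbouring cells are completely joined. -/
def blownUpCube (d n t : ℕ) : SimpleGraph (BlowupVertex d n t) where
  Adj p q := p ≠ q ∧ (p.1 = q.1 ∨ (gridGraph d n).Adj p.1 q.1)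
  symm := ⟨fun _ _ h => ⟨h.1.symm, h.2.imp Eq.symm fun a => a.symm⟩⟩
  loopless := ⟨fun _ h => h.1 rfl⟩

/-! ### Even subdivisions -/

/-- The graph obtained from `G` by replacing the edge `uv` by the path `u, w, w', v`, where the new
vertices are `w = inr false` and `w' = inr true`. -/
def doubleSubdivision {V : Type} (G : SimpleGraph V) (u v : V) : SimpleGraph (V ⊕ Bool) where
  Adj
    | .inl a, .inl b => G.Adj a b ∧ s(a, b) ≠ s(u, v)
    | .inl a, .inr false => a = u
    | .inl a, .inr true => a = v
    | .inr false, .inl a => a = u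
    | .inr true, .inl a => a = v
    | .inr x, .inr y => x ≠ y
  symm := by
    refine ⟨?_⟩
    rintro (a | (_ | _)) (b | (_ | _)) h <;> first
      | exact ⟨h.1.symm, by rw [Sym2.eq_swap]; exact h.2⟩
      | exact h
      | exact Ne.symm h
  loopless := by
    refine ⟨?_⟩
    rintro (a | (_ | _)) h
    · exact G.loopless.irrefl a h.1
    · exact h rfl
    · exact h rfl

/-- `IsEvenSubdivision G H`: up to isomorphism, `H` arises from `G` by a finite (possibly empty)
sequence of double subdivisions of edges. -/
inductive IsEvenSubdivision {W : Type} (H : SimpleGraph W) : {V : Type} → SimpleGraph V → Prop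
  | iso {V : Type} {G : SimpleGraph V} (e : G ≃g H) : IsEvenSubdivision H G
  | step {V : Type} {G : SimpleGraph V} {u v : V} (huv : G.Adj u v)
      (h : IsEvenSubdivision H (doubleSubdivision G u v)) : IsEvenSubdivision H G

/-! ### Boxes and intersection graphs -/

/-- The closed axis-parallel box in `ℝ^d` with lexicographically smallest corner `p`, with side length
`L` along the coordinate axis `axis` and side length `1` along all other axes. -/
def canonicalBox {d : ℕ} (L : ℝ) (axis : Fin d) (p : Fin d → ℝ) : Set (Fin d → ℝ) :=
  {x | ∀ i, p i ≤ x i ∧ x i ≤ p i + if i = axis then L else 1}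

/-- The intersection graph of an indexed family of sets. -/
def intersectionGraph {ι α : Type} (B : ι → Set α) : SimpleGraph ι where
  Adj i j := i ≠ j ∧ (B i ∩ B j).Nonempty
  symm := ⟨fun i j h => ⟨h.1.symm, by rw [Set.inter_comm]; exact h.2⟩⟩
  loopless := ⟨fun _ h => h.1 rfl⟩

/-- A finite description of a box: its long axis and the integer numerators of the coordinates of its
corner (the common denominator is stored once for a whole list of boxes). -/
structure BoxCode (d : ℕ) where
  axis : Fin d
  num : Fin d → ℕ

/-- The family of boxes described by a list of codes with common denominator `D`. -/
noncomputable def boxFamily {d : ℕ} (L : ℝ) (D : ℕ) (bs : List (BoxCode d)) :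
    Fin bs.length → Set (Fin d → ℝ) :=
  fun k => canonicalBox L (bs.get k).axis fun i => ((bs.get k).num i : ℝ) / (D : ℝ)

/-- The words that describe a list of boxes: the common denominator, and then for each box its axis
and its `d` numerators. -/
def outputWords {d : ℕ} (D : ℕ) (bs : List (BoxCode d)) : List ℕ :=
  D :: bs.flatMap fun b => (b.axis : ℕ) :: List.ofFn fun i => b.num i

/-! ### Word RAM

A program is a fixed finite text working on finitely many registers and a random access memory with
indirect addressing. It appends its output, word by word, to an output list. Every elementary
instruction and every evaluation of a test costs one step; all words have `w` bits, and a program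
that tries to produce a longer word is stuck. -/

structure RamState where
  reg : ℕ → ℕ
  mem : ℕ → ℕ
  out : List ℕ

inductive Operand
  | const (n : ℕ)
  | reg (r : ℕ)

def Operand.val (σ : RamState) : Operand → ℕ
  | .const n => n
  | .reg r => σ.reg r

inductive ArithOp
  | add | sub | mul | div | mod

/-- Subtraction is truncated at `0`; `div` and `mod` are Euclidean division. -/
def ArithOp.eval : ArithOp → ℕ → ℕ → ℕ
  | .add, a, b => a + b
  | .sub, a, b => a - b
  | .mul, a, b => a * b
  | .div, a, b => a / b
  | .mod, a, b => a % b

inductive RamTest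
  | lt (a b : Operand)
  | eq (a b : Operand)

def RamTest.Holds (σ : RamState) : RamTest → Prop
  | .lt a b => a.val σ < b.val σ
  | .eq a b => a.val σ = b.val σ

inductive RamProgram
  | skip
  | arith (r : ℕ) (f : ArithOp) (a b : Operand)
  | load (r : ℕ) (a : Operand)
  | store (a b : Operand)
  | emit (a : Operand)
  | seq (p q : RamProgram)
  | branch (c : RamTest) (p q : RamProgram)
  | loop (c : RamTest) (p : RamProgram)

/-- `RamExec w p σ k σ'`: on words of `w` bits, `p` started in `σ` halts in `σ'` after `k` steps.
The instructions are `r := a f b`, `r := mem[a]`, `mem[a] := b`, and output of `a`; `loop c p` is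
"while `c` do `p`". -/
inductive RamExec (w : ℕ) : RamProgram → RamState → ℕ → RamState → Prop
  | skip (σ : RamState) : RamExec w .skip σ 1 σ
  | arith (σ : RamState) (r : ℕ) (f : ArithOp) (a b : Operand)
      (h : f.eval (a.val σ) (b.val σ) < 2 ^ w) :
      RamExec w (.arith r f a b) σ 1
        { σ with reg := Function.update σ.reg r (f.eval (a.val σ) (b.val σ)) }
  | load (σ : RamState) (r : ℕ) (a : Operand)
      (ha : a.val σ < 2 ^ w) (h : σ.mem (a.val σ) < 2 ^ w) :
      RamExec w (.load r a) σ 1 { σ with reg := Function.update σ.reg r (σ.mem (a.val σ)) }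
  | store (σ : RamState) (a b : Operand) (ha : a.val σ < 2 ^ w) (hb : b.val σ < 2 ^ w) :
      RamExec w (.store a b) σ 1 { σ with mem := Function.update σ.mem (a.val σ) (b.val σ) }
  | emit (σ : RamState) (a : Operand) (h : a.val σ < 2 ^ w) :
      RamExec w (.emit a) σ 1 { σ with out := σ.out ++ [a.val σ] }
  | seq {p q : RamProgram} {σ σ' σ'' : RamState} {k l : ℕ}
      (hp : RamExec w p σ k σ') (hq : RamExec w q σ' l σ'') :
      RamExec w (.seq p q) σ (k + l) σ''
  | branchTrue {c : RamTest} {p q : RamProgram} {σ σ' : RamState} {k : ℕ}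
      (hc : c.Holds σ) (hp : RamExec w p σ k σ') :
      RamExec w (.branch c p q) σ (k + 1) σ'
  | branchFalse {c : RamTest} {p q : RamProgram} {σ σ' : RamState} {k : ℕ}
      (hc : ¬ c.Holds σ) (hq : RamExec w q σ k σ') :
      RamExec w (.branch c p q) σ (k + 1) σ'
  | loopTrue {c : RamTest} {p : RamProgram} {σ σ' σ'' : RamState} {k l : ℕ}
      (hc : c.Holds σ) (hp : RamExec w p σ k σ') (hl : RamExec w (.loop c p) σ' l σ'') :
      RamExec w (.loop c p) σ (k + l + 1) σ''
  | loopFalse {c : RamTest} {p : RamProgram} {σ : RamState} (hc : ¬ c.Holds σ) :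
      RamExec w (.loop c p) σ 1 σ

/-- Started on the memory contents `input` (and zero registers), `p` halts within `T` steps on words
of `w` bits, with output `output`. -/
def RamComputes (w : ℕ) (p : RamProgram) (input : ℕ → ℕ) (T : ℕ) (output : List ℕ) : Prop :=
  ∃ k ≤ T, ∃ σ' : RamState, RamExec w p ⟨fun _ => 0, input, []⟩ k σ' ∧ σ'.out = output

/-! ### Adjacency lists as input -/

/-- The number of a vertex: `(x, i)` has number `i + t * ∑ j, x j * n ^ j`. -/
def vertexNumber {d n t : ℕ} : BlowupVertex d n t ≃ Fin (n ^ d * t) :=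
  (finFunctionFinEquiv.prodCongr (Equiv.refl (Fin t))).trans finProdFinEquiv

/-- `nb v` lists the neighbours of `v` in `G`, each once and in any order. -/
def IsAdjacencyLists {d n t : ℕ} (G : (blownUpCube d n t).Subgraph)
    (nb : BlowupVertex d n t → List (BlowupVertex d n t)) : Prop :=
  ∀ v, (nb v).Nodup ∧ ∀ u, u ∈ nb v ↔ G.Adj v u

open Classical in
/-- The memory image of a subgraph `G` of maximum degree three given by adjacency lists: word `0` is
the side length `n` of the cube, and the vertex number `q` owns the words `4q + 1, …, 4q + 4`. The
first of them is `0` if the vertex is not in `G` and its degree plus one otherwise, the others are the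
numbers of its neighbours, padded with `0`. -/
noncomputable def inputMemory {d n t : ℕ} (G : (blownUpCube d n t).Subgraph)
    (nb : BlowupVertex d n t → List (BlowupVertex d n t)) : ℕ → ℕ := fun a =>
  if a = 0 then n
  else if h : (a - 1) / 4 < n ^ d * t then
    let v : BlowupVertex d n t := vertexNumber.symm ⟨(a - 1) / 4, h⟩
    if (a - 1) % 4 = 0 then (if v ∈ G.verts then (nb v).length + 1 else 0)
    else ((nb v).map fun u => (vertexNumber u : ℕ)).getD ((a - 1) % 4 - 1) 0
  else 0

/-!
The boxes are placed near the lines of a lattice whose step is `16` units. The blocks of lattice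
points reserved for the cells are spaced by a constant multiple of `L`, and the vertices of a cell
occupy different points of a `(d - 1)`-dimensional grid of side `⌊L⌋`: there are at most
`(L / 8) ^ (d - 1)` of them. An edge is drawn as a chain of boxes, starting at each of its two ends
with a route that changes the coordinates one after the other until it reaches an intermediate
position of the edge, half-way between the two blocks; from there the two routes run towards each
other along axis `0` and meet. Routes in different directions use different ranges of intermediate
positions. The edges of `G` with the same direction between two given cells form a matching, as the
neighbours of a vertex lie in distinct cells, so their intermediate positions can be chosen greedily
in such a way that no two of their routes share a line in any phase
(`exists_separated_positions`): a position is forbidden by an earlier edge only if it agrees with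
the position of that edge in `k` leading coordinates while ends of the two edges agree in all but
`k` of theirs, or if it agrees with that position in all coordinates except `0`; this excludes fewer
than all positions.

Routes may still cross, and two phases of one route have to touch at the turn without the boxes of
another route that turns nearby on the same line doing so. Every box is therefore displaced by a few
tenths of a unit from its lattice line, so that only consecutive phases touch, and in addition it is
tilted by an amount that decreases the further away the route turns; a box that reaches over the
turn of another route is then displaced to the side where it misses it (`Strand.Valid.turn`,
`Strand.Meet.routes`). Near a vertex its at most three routes leave on three lanes. Altogether, two
boxes intersect exactly if they are consecutive (`meet_dart_iff`, `meet_boxName_iff`). Since both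
halves of an edge consist of the same number of boxes, which depends on `d` only, every edge is
replaced by a path with an even number of interior vertices, and the intersection graph is an even
subdivision with a linear number of vertices (`isEvenSubdivision_halfEdgeSubdivision`).

The boxes of a cell depend, up to a translation, only on the presence and the half-edges of its `t`
vertices, where a half-edge is given by the direction of its other end and the position of that end
in its cell. For fixed `d` and `L` there are finitely many such views, so the program holds a table
with the boxes of each of them (`boxTable`). For each cell it computes the number of the view from
the `4 t` input words of the cell, looks it up, and prints the boxes with the offset of the cell
added (`CellProgram.ramComputes_main`, `decodeView_horner`, `exists_program`). This takes constant
time per cell.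
-/

/-! ### Graphs presented by disjoint even paths -/

/-- A presentation of `H` as a subdivision of `G`: branch vertices `f a`, and for each dart `ab` of
`G` the list `path a b` of interior vertices of the path that replaces the edge, read from `a` to
`b`. All these lists have even length. -/
structure EvenPathModel {V W : Type} (G : SimpleGraph V) (H : SimpleGraph W) where
  f : V → W
  path : V → V → List W
  f_inj : Function.Injective f
  nodup : ∀ {a b}, G.Adj a b → (path a b).Nodup
  even : ∀ {a b}, G.Adj a b → Even (path a b).length
  rev : ∀ {a b}, G.Adj a b → path b a = (path a b).reverse
  notMem : ∀ {a b} (c), G.Adj a b → f c ∉ path a b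
  uniq : ∀ {a b a' b' w}, G.Adj a b → G.Adj a' b' → w ∈ path a b → w ∈ path a' b' →
    s(a, b) = s(a', b')
  cover : ∀ w, (∃ c, f c = w) ∨ ∃ a b, G.Adj a b ∧ w ∈ path a b
  adj : ∀ w w', H.Adj w w' ↔ ∃ a b, G.Adj a b ∧ [w, w'] <:+: (f a :: (path a b ++ [f b]))

theorem pair_infix_cons_cons {α : Type*} {x y a b : α} {l : List α} :
    [x, y] <:+: a :: b :: l ↔ (x = a ∧ y = b) ∨ [x, y] <:+: b :: l := by
  rw [List.infix_cons_iff]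
  simp [List.cons_prefix_cons]

theorem not_pair_infix_singleton {α : Type*} {x y a : α} : ¬ [x, y] <:+: [a] := fun h => by
  simpa using h.length_le

theorem pair_infix_reverse {α : Type*} {x y : α} {l : List α} :
    [x, y] <:+: l.reverse ↔ [y, x] <:+: l := by
  rw [← List.reverse_infix]
  simp

namespace EvenPathModel

variable {V W : Type} {G : SimpleGraph V} {H : SimpleGraph W}

/-- A presentation with empty paths is an isomorphism. -/
theorem isEvenSubdivision_of_nil (P : EvenPathModel G H)
    (h : ∀ a b, G.Adj a b → P.path a b = []) : IsEvenSubdivision H G := by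
  have hs : Function.Surjective P.f := fun w => by
    rcases P.cover w with hw | ⟨a, b, hab, hw⟩
    · exact hw
    · simp [h a b hab] at hw
  refine .iso ⟨Equiv.ofBijective P.f ⟨P.f_inj, hs⟩, fun {a b} => ?_⟩
  change H.Adj (P.f a) (P.f b) ↔ _
  rw [P.adj]
  constructor
  · rintro ⟨a', b', hab, hi⟩
    rw [h a' b' hab, List.nil_append, pair_infix_cons_cons] at hi
    rcases hi with ⟨h1, h2⟩ | hi
    · rwa [P.f_inj h1, P.f_inj h2]
    · exact absurd hi not_pair_infix_singleton
  · intro hab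
    exact ⟨a, b, hab, by rw [h a b hab]; exact List.infix_rfl⟩

/-- Peeling the first two interior vertices off the path of the dart `uv` leaves a presentation of
the same graph as a subdivision of the double subdivision of `uv`. -/
def peel (P : EvenPathModel G H) {u v : V} (huv : G.Adj u v) {w₁ w₂ : W} {rest : List W}
    (hp : P.path u v = w₁ :: w₂ :: rest) : EvenPathModel (doubleSubdivision G u v) H where
  f := Sum.elim P.f fun x => if x then w₂ else w₁
  path
    | .inl a, .inl b => P.path a b
    | .inl _, .inr true => rest.reverse
    | .inr true, .inl _ => rest
    | _, _ => []
  f_inj := by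
    have hn := P.nodup huv
    have hf := fun c => P.notMem c huv
    rw [hp] at hn
    simp only [hp, List.mem_cons, not_or] at hf
    simp only [List.nodup_cons, List.mem_cons, not_or] at hn
    rintro (a | (_ | _)) (b | (_ | _)) h <;> simp at h ⊢
    · exact P.f_inj h
    · exact (hf a).1 h
    · exact (hf a).2.1 h
    · exact (hf b).1 h.symm
    · exact hn.1.1 h
    · exact (hf b).2.1 h.symm
    · exact hn.1.1 h.symm
  nodup := by
    have hn := P.nodup huv
    rw [hp] at hn
    simp only [List.nodup_cons] at hn
    rintro (a | (_ | _)) (b | (_ | _)) h <;> simp [doubleSubdivision] at h ⊢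
    · exact P.nodup h.1
    · exact hn.2.2
    · exact hn.2.2
  even := by
    have hn := P.even huv
    have hr : Even rest.length := by
      rw [hp] at hn
      simp only [List.length_cons, Nat.even_iff] at hn ⊢
      omega
    rintro (a | (_ | _)) (b | (_ | _)) h <;> simp [doubleSubdivision] at h ⊢
    · exact P.even h.1
    · exact hr
    · exact hr
  rev := by
    rintro (a | (_ | _)) (b | (_ | _)) h <;> simp [doubleSubdivision] at h ⊢
    exact P.rev h.1
  notMem := by
    have hn := P.nodup huv
    have hf := fun c => P.notMem c huv
    rw [hp] at hn
    simp only [hp, List.mem_cons, not_or] at hf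
    simp only [List.nodup_cons, List.mem_cons, not_or] at hn
    have h1 : w₁ ∈ P.path u v := by simp [hp]
    have h2 : w₂ ∈ P.path u v := by simp [hp]
    rintro (a | (_ | _)) (b | (_ | _)) (c | (_ | _)) h <;>
      simp [doubleSubdivision, -Sym2.eq, -Sym2.rel_iff'] at h ⊢
    · exact P.notMem c h.1
    · exact fun hm => h.2 (by simpa using P.uniq h.1 huv hm h1)
    · exact fun hm => h.2 (by simpa using P.uniq h.1 huv hm h2)
    · exact (hf c).2.2
    · exact hn.1.2
    · exact hn.2.1
    · exact (hf c).2.2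
    · exact hn.1.2
    · exact hn.2.1
  uniq := by
    have hr : ∀ w ∈ rest, w ∈ P.path u v := fun w hw => by simp [hp, hw]
    rintro (a | (_ | _)) (b | (_ | _)) (a' | (_ | _)) (b' | (_ | _)) w h h' hw hw' <;>
      simp [doubleSubdivision, -Sym2.eq, -Sym2.rel_iff'] at h h' hw hw' <;> simp
    · simpa using P.uniq h.1 h'.1 hw hw'
    · exact h.2 (by simpa using P.uniq h.1 huv hw (hr w hw'))
    · exact h.2 (by simpa using P.uniq h.1 huv hw (hr w hw'))
    · exact h'.2 (by simpa using P.uniq h'.1 huv hw' (hr w hw))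
    · rw [h, h']
    · rw [h, h']
    · exact h'.2 (by simpa using P.uniq h'.1 huv hw' (hr w hw))
    · rw [h, h']
    · rw [h, h']
  cover := by
    intro w
    rcases P.cover w with ⟨c, hc⟩ | ⟨a, b, hab, hw⟩
    · exact Or.inl ⟨.inl c, hc⟩
    · by_cases he : s(a, b) = s(u, v)
      · have hw' : w ∈ P.path u v := by
          rw [Sym2.eq_iff] at he
          rcases he with ⟨rfl, rfl⟩ | ⟨rfl, rfl⟩
          · exact hw
          · rw [P.rev huv] at hw
            simpa using hw
        rw [hp] at hw'
        simp only [List.mem_cons] at hw'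
        rcases hw' with rfl | rfl | hw'
        · exact Or.inl ⟨.inr false, rfl⟩
        · exact Or.inl ⟨.inr true, rfl⟩
        · exact Or.inr ⟨.inr true, .inl v, rfl, hw'⟩
      · exact Or.inr ⟨.inl a, .inl b, ⟨hab, he⟩, hw⟩
  adj := by
    intro w w'
    rw [P.adj]
    have huvL : P.f u :: (P.path u v ++ [P.f v]) = P.f u :: w₁ :: w₂ :: (rest ++ [P.f v]) := by
      simp [hp]
    have hvuL : P.f v :: (P.path v u ++ [P.f u]) =
        (P.f u :: w₁ :: w₂ :: (rest ++ [P.f v])).reverse := by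
      simp [P.rev huv, hp]
    have hmid : w₂ :: (rest ++ [P.f v]) = (P.f v :: (rest.reverse ++ [w₂])).reverse := by simp
    constructor
    · rintro ⟨a, b, hab, hi⟩
      by_cases he : s(a, b) = s(u, v)
      · rw [Sym2.eq_iff] at he
        rcases he with ⟨rfl, rfl⟩ | ⟨rfl, rfl⟩
        · rw [huvL, pair_infix_cons_cons, pair_infix_cons_cons] at hi
          rcases hi with ⟨rfl, rfl⟩ | ⟨rfl, rfl⟩ | hi
          · exact ⟨.inl a, .inr false, rfl, List.infix_rfl⟩
          · exact ⟨.inr false, .inr true, by simp [doubleSubdivision], List.infix_rfl⟩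
          · exact ⟨.inr true, .inl b, rfl, hi⟩
        · rw [hvuL, pair_infix_reverse, pair_infix_cons_cons, pair_infix_cons_cons] at hi
          rcases hi with ⟨rfl, rfl⟩ | ⟨rfl, rfl⟩ | hi
          · exact ⟨.inr false, .inl b, rfl, List.infix_rfl⟩
          · exact ⟨.inr true, .inr false, by simp [doubleSubdivision], List.infix_rfl⟩
          · rw [hmid, pair_infix_reverse] at hi
            exact ⟨.inl a, .inr true, rfl, hi⟩
      · exact ⟨.inl a, .inl b, ⟨hab, he⟩, hi⟩
    · rintro ⟨a | (_ | _), b | (_ | _), h, hi⟩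
      · exact ⟨a, b, h.1, hi⟩
      · obtain rfl : a = u := h
        refine ⟨a, v, huv, ?_⟩
        rw [huvL, pair_infix_cons_cons]
        have hi' : [w, w'] <:+: [P.f a, w₁] := hi
        rw [pair_infix_cons_cons] at hi'
        exact Or.inl (hi'.resolve_right not_pair_infix_singleton)
      · obtain rfl : a = v := h
        refine ⟨a, u, huv.symm, ?_⟩
        rw [hvuL, pair_infix_reverse, pair_infix_cons_cons, pair_infix_cons_cons, hmid,
          pair_infix_reverse]
        exact Or.inr (Or.inr hi)
      · obtain rfl : b = u := h
        refine ⟨v, b, huv.symm, ?_⟩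
        rw [hvuL, pair_infix_reverse, pair_infix_cons_cons]
        have hi' : [w, w'] <:+: [w₁, P.f b] := hi
        rw [pair_infix_cons_cons] at hi'
        exact Or.inl (hi'.resolve_right not_pair_infix_singleton).symm
      · exact absurd rfl h
      · refine ⟨u, v, huv, ?_⟩
        rw [huvL, pair_infix_cons_cons, pair_infix_cons_cons]
        have hi' : [w, w'] <:+: [w₁, w₂] := hi
        rw [pair_infix_cons_cons] at hi'
        exact Or.inr (Or.inl (hi'.resolve_right not_pair_infix_singleton))
      · obtain rfl : b = v := h
        refine ⟨u, b, huv, ?_⟩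
        rw [huvL, pair_infix_cons_cons, pair_infix_cons_cons]
        exact Or.inr (Or.inr hi)
      · refine ⟨v, u, huv.symm, ?_⟩
        rw [hvuL, pair_infix_reverse, pair_infix_cons_cons, pair_infix_cons_cons]
        have hi' : [w, w'] <:+: [w₂, w₁] := hi
        rw [pair_infix_cons_cons] at hi'
        exact Or.inr (Or.inl (hi'.resolve_right not_pair_infix_singleton).symm)
      · exact absurd rfl h

theorem isEvenSubdivision_of_ncard_le [Finite W] (n : ℕ) : ∀ {V : Type} {G : SimpleGraph V}
    (P : EvenPathModel G H), (Set.range P.f)ᶜ.ncard ≤ n → IsEvenSubdivision H G := by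
  induction n with
  | zero =>
    intro V G P hn
    refine P.isEvenSubdivision_of_nil fun a b hab => List.eq_nil_iff_forall_not_mem.2 fun w hw => ?_
    rw [Nat.le_zero, Set.ncard_eq_zero, Set.compl_empty_iff] at hn
    obtain ⟨c, rfl⟩ : w ∈ Set.range P.f := hn ▸ Set.mem_univ w
    exact P.notMem c hab hw
  | succ n ih =>
    intro V G P hn
    by_cases h : ∀ a b, G.Adj a b → P.path a b = []
    · exact P.isEvenSubdivision_of_nil h
    push Not at h
    obtain ⟨u, v, huv, hne⟩ := h
    obtain ⟨w₁, l, hl⟩ := List.exists_cons_of_ne_nil hne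
    obtain ⟨w₂, rest, rfl⟩ : ∃ w₂ rest, l = w₂ :: rest := by
      rcases l with _ | ⟨w₂, rest⟩
      · have := P.even huv
        simp [hl] at this
      · exact ⟨w₂, rest, rfl⟩
    refine .step huv (ih (P.peel huv hl) ?_)
    have hlt : (Set.range (P.peel huv hl).f)ᶜ.ncard < (Set.range P.f)ᶜ.ncard := by
      refine Set.ncard_lt_ncard ⟨Set.compl_subset_compl.2 ?_, ?_⟩ (Set.toFinite _)
      · rintro _ ⟨a, rfl⟩
        exact ⟨.inl a, rfl⟩
      · intro hsub
        have hw : w₁ ∈ (Set.range P.f)ᶜ := by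
          rintro ⟨c, hc⟩
          exact P.notMem c huv (by simp [hl, hc])
        exact hsub hw ⟨.inr false, rfl⟩
    omega

/-- Peeling shortens the paths, so finitely many double subdivisions lead from `G` to `H`. -/
theorem isEvenSubdivision [Finite W] (P : EvenPathModel G H) : IsEvenSubdivision H G :=
  isEvenSubdivision_of_ncard_le _ P le_rfl

end EvenPathModel

/-! ### Verification of loop-free word-RAM programs -/

/-- An upper bound for the number of steps of a loop-free program. -/
def RamProgram.time : RamProgram → ℕ
  | .seq p q => p.time + q.time
  | .branch _ p q => max p.time q.time + 1
  | _ => 1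

/-- On words of `w` bits, `p` started in `σ` halts within `p.time` steps in a state satisfying `Q`.
-/
def RunsTo (w : ℕ) (p : RamProgram) (Q : RamState → Prop) (σ : RamState) : Prop :=
  ∃ k ≤ p.time, ∃ σ', RamExec w p σ k σ' ∧ Q σ'

/-- The state after the assignment of `v` to register `r`. -/
def RamState.setReg (σ : RamState) (r v : ℕ) : RamState :=
  { σ with reg := Function.update σ.reg r v }

@[simp] theorem RamState.setReg_mem (σ : RamState) (r v : ℕ) : (σ.setReg r v).mem = σ.mem := rfl

@[simp] theorem RamState.setReg_out (σ : RamState) (r v : ℕ) : (σ.setReg r v).out = σ.out := rfl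

@[simp] theorem RamState.setReg_reg (σ : RamState) (r v q : ℕ) :
    (σ.setReg r v).reg q = if q = r then v else σ.reg q := by
  simp [RamState.setReg, Function.update_apply]

namespace RunsTo

variable {w : ℕ} {p q : RamProgram} {Q : RamState → Prop} {σ : RamState}

theorem skip (h : Q σ) : RunsTo w .skip Q σ := ⟨1, le_rfl, σ, .skip σ, h⟩

theorem seq (h : RunsTo w p (RunsTo w q Q) σ) : RunsTo w (.seq p q) Q σ := by
  obtain ⟨k, hk, σ', hp, l, hl, σ'', hq, hQ⟩ := h
  exact ⟨k + l, Nat.add_le_add hk hl, σ'', .seq hp hq, hQ⟩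

theorem arith {r : ℕ} {f : ArithOp} {a b : Operand} (v : ℕ)
    (hv : f.eval (a.val σ) (b.val σ) = v) (h : v < 2 ^ w) (hQ : Q (σ.setReg r v)) :
    RunsTo w (.arith r f a b) Q σ := by
  subst hv
  exact ⟨1, le_rfl, _, .arith σ r f a b h, hQ⟩

theorem load {r : ℕ} {a : Operand} (ha : a.val σ < 2 ^ w) (h : σ.mem (a.val σ) < 2 ^ w)
    (hQ : Q (σ.setReg r (σ.mem (a.val σ)))) : RunsTo w (.load r a) Q σ :=
  ⟨1, le_rfl, _, .load σ r a ha h, hQ⟩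

theorem emit {a : Operand} (v : ℕ) (hv : a.val σ = v) (h : v < 2 ^ w)
    (hQ : Q { σ with out := σ.out ++ [v] }) : RunsTo w (.emit a) Q σ := by
  subst hv
  exact ⟨1, le_rfl, _, .emit σ a h, hQ⟩

theorem branch {c : RamTest} (hp : c.Holds σ → RunsTo w p Q σ)
    (hq : ¬ c.Holds σ → RunsTo w q Q σ) : RunsTo w (.branch c p q) Q σ := by
  by_cases hc : c.Holds σ
  · obtain ⟨k, hk, σ', he, hQ⟩ := hp hc
    exact ⟨k + 1, Nat.succ_le_succ (le_max_of_le_left hk), σ', .branchTrue hc he, hQ⟩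
  · obtain ⟨k, hk, σ', he, hQ⟩ := hq hc
    exact ⟨k + 1, Nat.succ_le_succ (le_max_of_le_right hk), σ', .branchFalse hc he, hQ⟩

theorem mono {Q' : RamState → Prop} (h : RunsTo w p Q σ) (hQ : ∀ σ', Q σ' → Q' σ') :
    RunsTo w p Q' σ := by
  obtain ⟨k, hk, σ', he, hq⟩ := h
  exact ⟨k, hk, σ', he, hQ σ' hq⟩

end RunsTo

/-- A counting loop: if the loop body carries the invariant `I z` to `I (z + 1)` as long as the test
holds, that is for `z < n`, then the loop carries `I z` to `I n`. -/
theorem RamExec.counting_loop {w : ℕ} {c : RamTest} {p : RamProgram} {I : ℕ → RamState → Prop}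
    {n : ℕ} (ht : ∀ z σ, I z σ → (c.Holds σ ↔ z < n))
    (hp : ∀ z σ, z < n → I z σ → RunsTo w p (I (z + 1)) σ) (m : ℕ) :
    ∀ z σ, z + m = n → I z σ →
      ∃ k ≤ m * (p.time + 1) + 1, ∃ σ', RamExec w (.loop c p) σ k σ' ∧ I n σ' := by
  induction m with
  | zero =>
    intro z σ hz hI
    obtain rfl : z = n := by omega
    exact ⟨1, by omega, σ, .loopFalse fun h => absurd ((ht _ _ hI).1 h) (lt_irrefl _), hI⟩
  | succ m ih =>
    intro z σ hz hI
    obtain ⟨k, hk, σ', he, hI'⟩ := hp z σ (by omega) hI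
    obtain ⟨l, hl, σ'', he', hI''⟩ := ih (z + 1) σ' (by omega) hI'
    refine ⟨k + l + 1, ?_, σ'', .loopTrue ((ht _ _ hI).2 (by omega)) he he', hI''⟩
    rw [Nat.succ_mul]
    omega

/-! ### Reading a cell and printing its boxes -/

/-- The base-`B` number with digits `f (n - 1), …, f 0`, preceded by the digits of `a`. -/
def horner (f : ℕ → ℕ) (B : ℕ) : ℕ → ℕ → ℕ
  | 0, a => a
  | n + 1, a => horner f B n (a * B + f n)

theorem horner_lt {f : ℕ → ℕ} {B : ℕ} (n : ℕ) (hf : ∀ k < n, f k < B) :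
    ∀ a, horner f B n a < (a + 1) * B ^ n := by
  induction n with
  | zero => intro a; simp [horner]
  | succ n ih =>
    intro a
    have h := ih (fun k hk => hf k (by omega)) (a * B + f n)
    have h2 : (a * B + f n + 1) * B ^ n ≤ (a + 1) * B * B ^ n :=
      Nat.mul_le_mul_right _ (by have := hf n (by omega); nlinarith)
    calc horner f B (n + 1) a < (a * B + f n + 1) * B ^ n := h
      _ ≤ (a + 1) * B ^ (n + 1) := by rw [pow_succ']; linarith

theorem horner_div {f : ℕ → ℕ} {B : ℕ} (n : ℕ) (hf : ∀ k < n, f k < B) :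
    ∀ a, horner f B n a / B ^ n = a := by
  induction n with
  | zero => intro a; simp [horner]
  | succ n ih =>
    intro a
    have hB := hf n (by omega)
    rw [horner, pow_succ, ← Nat.div_div_eq_div_mul, ih (fun k hk => hf k (by omega)),
      Nat.add_div_of_dvd_right (Dvd.intro_left _ rfl), Nat.mul_div_cancel _ (by omega),
      Nat.div_eq_of_lt hB, add_zero]

theorem horner_digit {f : ℕ → ℕ} {B : ℕ} (n : ℕ) (hf : ∀ k < n, f k < B) :
    ∀ a, ∀ k < n, horner f B n a / B ^ k % B = f k := by
  induction n with
  | zero => intro a k hk; omega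
  | succ n ih =>
    intro a k hk
    rcases Nat.lt_succ_iff_lt_or_eq.1 hk with hk | rfl
    · exact ih (fun k hk => hf k (by omega)) _ k hk
    · rw [horner, horner_div k fun l hl => hf l (by omega), Nat.mul_add_mod',
        Nat.mod_eq_of_lt (hf k (by omega))]

/-- The type of a neighbour in cell number `c`, seen from cell number `z`, when only the first `j`
coordinate directions are taken into account: `2 l` for the next cell in direction `l`, and `2 l +
1` for the previous one. -/
def directionCode (s z c : ℕ) : ℕ → ℕ
  | 0 => 0
  | j + 1 => if c = z + s ^ j then 2 * j else if c + s ^ j = z then 2 * j + 1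
      else directionCode s z c j

/-- The type of the neighbour at position `r` of cell number `c`, seen from position `i` of cell
number `z`. The types `2 d` and `2 d + 1` belong to neighbours in the same cell. -/
def typeCode (d s z i c r : ℕ) : ℕ :=
  if c = z then (if i < r then 2 * d else 2 * d + 1) else directionCode s z c d

/-- What the program keeps of the `k`-th word of cell number `z`: presence and degree if `4 ∣ k`,
and otherwise the type of a neighbour together with its position in its cell. -/
def viewDigit (d s t : ℕ) (mem : ℕ → ℕ) (z k : ℕ) : ℕ :=
  if k % 4 = 0 then mem (4 * t * z + k + 1)
  else typeCode d s z (k / 4) (mem (4 * t * z + k + 1) / t) (mem (4 * t * z + k + 1) % t) * t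
    + mem (4 * t * z + k + 1) % t

theorem directionCode_lt (s z c j : ℕ) : directionCode s z c j < 2 * j + 1 := by
  induction j with
  | zero => simp [directionCode]
  | succ j ih =>
    rw [directionCode]
    split_ifs <;> omega

theorem typeCode_lt (d s z i c r : ℕ) : typeCode d s z i c r < 2 * d + 2 := by
  have := directionCode_lt s z c d
  rw [typeCode]
  split_ifs <;> omega

theorem viewDigit_lt {d s t : ℕ} {mem : ℕ → ℕ} {z k : ℕ} (ht : 0 < t)
    (h : k % 4 = 0 → mem (4 * t * z + k + 1) < 5) :
    viewDigit d s t mem z k < (2 * d + 2) * t + 5 := by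
  rw [viewDigit]
  split_ifs with hk
  · have := h hk; omega
  · have h1 := typeCode_lt d s z (k / 4) (mem (4 * t * z + k + 1) / t)
      (mem (4 * t * z + k + 1) % t)
    have h2 := Nat.mod_lt (mem (4 * t * z + k + 1)) ht
    generalize typeCode d s z (k / 4) (mem (4 * t * z + k + 1) / t)
      (mem (4 * t * z + k + 1) % t) = a at *
    nlinarith

namespace CellProgram

open RamProgram Operand

/-- Assign a constant to a register. -/
def setConst (r v : ℕ) : RamProgram := .arith r .add (const v) (const 0)

/-- `r4 := directionCode`, for the cell number in register `5`. -/
def direction : ℕ → RamProgram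
  | 0 => setConst 4 0
  | j + 1 => .seq (.arith 7 .add (reg 0) (reg (10 + j)))
      (.branch (.eq (reg 5) (reg 7)) (setConst 4 (2 * j))
        (.seq (.arith 7 .add (reg 5) (reg (10 + j)))
          (.branch (.eq (reg 7) (reg 0)) (setConst 4 (2 * j + 1)) (direction j))))

/-- Replace the vertex number in register `4` by its type and position, seen from position `i`. -/
def relative (d t i : ℕ) : RamProgram :=
  .seq (.arith 5 .div (reg 4) (const t)) <| .seq (.arith 6 .mod (reg 4) (const t)) <|
  .seq (.branch (.eq (reg 5) (reg 0))
    (.branch (.lt (const i) (reg 6)) (setConst 4 (2 * d)) (setConst 4 (2 * d + 1)))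
    (direction d)) <|
  .seq (.arith 4 .mul (reg 4) (const t)) (.arith 4 .add (reg 4) (reg 6))

/-- Append the `k`-th digit of the current cell to register `3`. -/
def readDigit (d t B k : ℕ) : RamProgram :=
  .seq (.arith 4 .mul (const (4 * t)) (reg 0)) <| .seq (.arith 4 .add (reg 4) (const k)) <|
  .seq (.arith 4 .add (reg 4) (const 1)) <| .seq (.load 4 (reg 4)) <|
  .seq (if k % 4 = 0 then .skip else relative d t (k / 4)) <|
  .seq (.arith 3 .mul (reg 3) (const B)) (.arith 3 .add (reg 3) (reg 4))

/-- Append the digits `k = 0, …, n - 1` to register `3`, the last of them first. -/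
def readDigits (d t B : ℕ) : ℕ → RamProgram
  | 0 => .skip
  | n + 1 => .seq (readDigit d t B n) (readDigits d t B n)

/-- Compute the offset of the cell in the first `n` coordinates. -/
def bases (d : ℕ) (scale : ℕ → ℕ) : ℕ → RamProgram
  | 0 => .skip
  | n + 1 => .seq (bases d scale n) <|
    .seq (.arith 4 .div (reg 0) (reg (10 + n))) <| .seq (.arith 4 .mod (reg 4) (reg 1)) <|
    .arith (10 + d + n) .mul (reg 4) (const (scale n))

/-- Print the numbers `n` of the pairs `(l, n)` in a list, each increased by the offset of the cell
in coordinate `l`. -/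
def emitNums (d : ℕ) (l : List (ℕ × ℕ)) : RamProgram :=
  l.foldr (fun p q => .seq (.arith 4 .add (reg (10 + d + p.1)) (const p.2))
    (.seq (.emit (reg 4)) q)) .skip

/-- Print a list of boxes, translated by the offset of the cell. -/
def emitBoxes {d : ℕ} (l : List (BoxCode d)) : RamProgram :=
  l.foldr (fun b q => .seq (.emit (const (b.axis : ℕ)))
    (.seq (emitNums d (List.ofFn fun i : Fin d => ((i : ℕ), b.num i))) q)) .skip

/-- Select the program with the number stored in register `3`. -/
def select (f : ℕ → RamProgram) : ℕ → RamProgram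
  | 0 => .skip
  | n + 1 => .branch (.eq (reg 3) (const n)) (f n) (select f n)

/-- Register `10 + j` receives `s ^ j`, and register `2` in the end `s ^ n`. -/
def powers : ℕ → RamProgram
  | 0 => setConst 2 1
  | n + 1 => .seq (powers n) <| .seq (.arith (10 + n) .add (reg 2) (const 0))
      (.arith 2 .mul (reg 2) (reg 1))

/-- Treat one cell: read its digits into register `3`, and print the boxes that the table `tab`
assigns to them, translated to the cell. -/
def cell (d t : ℕ) (scale : ℕ → ℕ) (tab : ℕ → List (BoxCode d)) : RamProgram :=
  .seq (setConst 3 0) <| .seq (readDigits d t ((2 * d + 2) * t + 5) (4 * t)) <|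
  .seq (bases d scale d) <|
  .seq (select (fun κ => emitBoxes (tab κ)) (((2 * d + 2) * t + 5) ^ (4 * t))) <|
  .arith 0 .add (reg 0) (const 1)

/-- The initial part: print the denominator and compute the powers of the side length. -/
def start (d D : ℕ) : RamProgram :=
  .seq (.emit (const D)) <| .seq (.load 1 (const 0)) (powers d)

/-- The whole program. Register `0` holds the number of the current cell, register `1` the side
length `s`, register `2` the number `s ^ d` of cells, and register `3` the number of the view; the
registers `4` to `7` are used for intermediate results. For `j < d`, register `10 + j` holds `s ^ j`
and register `10 + d + j` the offset of the current cell in coordinate `j`. -/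
def main (d t D : ℕ) (scale : ℕ → ℕ) (tab : ℕ → List (BoxCode d)) : RamProgram :=
  .seq (start d D) (.loop (.lt (reg 0) (reg 2)) (cell d t scale tab))

/-- The part of the state that stays the same while cell number `z` is treated. -/
structure Inv (d s : ℕ) (mem : ℕ → ℕ) (z : ℕ) (σ : RamState) : Prop where
  r0 : σ.reg 0 = z
  r1 : σ.reg 1 = s
  r2 : σ.reg 2 = s ^ d
  pow : ∀ j < d, σ.reg (10 + j) = s ^ j
  mem_eq : σ.mem = mem

variable {d s t w z : ℕ} {mem : ℕ → ℕ} {σ : RamState} {Q : RamState → Prop}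

theorem Inv.setReg (h : Inv d s mem z σ) {r v : ℕ} (hr : 3 ≤ r) (hr' : r < 10 ∨ 10 + d ≤ r) :
    Inv d s mem z (σ.setReg r v) := by
  constructor
  · rw [RamState.setReg_reg, if_neg (by omega), h.r0]
  · rw [RamState.setReg_reg, if_neg (by omega), h.r1]
  · rw [RamState.setReg_reg, if_neg (by omega), h.r2]
  · intro j hj
    rw [RamState.setReg_reg, if_neg (by omega), h.pow j hj]
  · exact h.mem_eq

theorem runsTo_setConst {r v : ℕ} (hv : v < 2 ^ w) (hQ : Q (σ.setReg r v)) :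
    RunsTo w (setConst r v) Q σ := .arith v rfl hv hQ

/-- Only the scratch registers `4` and `7` change. -/
theorem runsTo_direction {X : ℕ} (j : ℕ) : ∀ (σ : RamState), j ≤ d → Inv d s mem z σ →
    z ≤ X → σ.reg 5 ≤ X → (∀ l < d, s ^ l ≤ X) → 2 * X < 2 ^ w → 2 * d + 2 < 2 ^ w →
    (∀ σ', Inv d s mem z σ' → σ'.reg 4 = directionCode s z (σ.reg 5) j → σ'.reg 3 = σ.reg 3 →
      σ'.reg 6 = σ.reg 6 → σ'.out = σ.out → Q σ') →
    RunsTo w (direction j) Q σ := by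
  induction j with
  | zero =>
    intro σ _ hI _ _ _ _ hw2 hQ
    refine runsTo_setConst (by omega) (hQ _ (hI.setReg (by omega) (by omega)) ?_ ?_ ?_ ?_) <;>
      simp [directionCode]
  | succ j ih =>
    intro σ hj hI hz h5 hX hw hw2 hQ
    have hp := hI.pow j (by omega)
    have hpX := hX j (by omega)
    refine .seq (.arith (z + s ^ j) (by simp [ArithOp.eval, Operand.val, hI.r0, hp]) (by omega) ?_)
    have hI1 := hI.setReg (r := 7) (v := z + s ^ j) (by omega) (by omega)
    refine .branch (fun hc => ?_) fun hc => ?_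
    · simp only [RamTest.Holds, Operand.val, RamState.setReg_reg] at hc
      norm_num at hc
      refine runsTo_setConst (by omega) (hQ _ (hI1.setReg (by omega) (by omega)) ?_ ?_ ?_ ?_) <;>
        simp [directionCode, hc]
    simp only [RamTest.Holds, Operand.val, RamState.setReg_reg] at hc
    norm_num at hc
    refine .seq (.arith (σ.reg 5 + s ^ j) (by simp [ArithOp.eval, Operand.val, hp]; omega)
      (by omega) ?_)
    have hI2 := hI1.setReg (r := 7) (v := σ.reg 5 + s ^ j) (by omega) (by omega)
    refine .branch (fun hc2 => ?_) fun hc2 => ?_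
    · simp only [RamTest.Holds, Operand.val, RamState.setReg_reg] at hc2
      norm_num [hI.r0] at hc2
      refine runsTo_setConst (by omega) (hQ _ (hI2.setReg (by omega) (by omega)) ?_ ?_ ?_ ?_) <;>
        simp [directionCode, hc, hc2]
    · simp only [RamTest.Holds, Operand.val, RamState.setReg_reg] at hc2
      norm_num [hI.r0] at hc2
      refine ih _ (by omega) hI2 hz (by simpa using h5) hX hw hw2 fun σ' h1 h2 h3 h4 h5 => ?_
      refine hQ σ' h1 ?_ (by simpa using h3) (by simpa using h4) (by simpa using h5)
      rw [h2]
      simp [directionCode, hc, hc2]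

theorem runsTo_relative {X i : ℕ} (ht : 0 < t) (hI : Inv d s mem z σ) (hz : z ≤ X)
    (h4 : σ.reg 4 ≤ X) (hX : ∀ l < d, s ^ l ≤ X) (hw : 2 * X < 2 ^ w)
    (hw2 : (2 * d + 2) * t + 5 < 2 ^ w)
    (hQ : ∀ σ', Inv d s mem z σ' →
      σ'.reg 4 = typeCode d s z i (σ.reg 4 / t) (σ.reg 4 % t) * t + σ.reg 4 % t →
      σ'.reg 3 = σ.reg 3 → σ'.out = σ.out → Q σ') :
    RunsTo w (relative d t i) Q σ := by
  have hdiv : σ.reg 4 / t ≤ X := (Nat.div_le_self _ _).trans h4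
  have hmod : σ.reg 4 % t < t := Nat.mod_lt _ ht
  have hd2 : 2 * d + 2 ≤ (2 * d + 2) * t := Nat.le_mul_of_pos_right _ ht
  have ht2 : t ≤ (2 * d + 2) * t := Nat.le_mul_of_pos_left _ (by omega)
  refine .seq (.arith (σ.reg 4 / t) (by simp [ArithOp.eval, Operand.val]) (by omega) ?_)
  refine .seq (.arith (σ.reg 4 % t) (by simp [ArithOp.eval, Operand.val]) (by omega) ?_)
  have hI1 := (hI.setReg (r := 5) (v := σ.reg 4 / t) (by omega) (by omega)).setReg
    (r := 6) (v := σ.reg 4 % t) (by omega) (by omega)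
  have key : ∀ σ', Inv d s mem z σ' →
      σ'.reg 4 = typeCode d s z i (σ.reg 4 / t) (σ.reg 4 % t) →
      σ'.reg 3 = σ.reg 3 → σ'.reg 6 = σ.reg 4 % t → σ'.out = σ.out →
      RunsTo w (.seq (.arith 4 .mul (reg 4) (const t)) (.arith 4 .add (reg 4) (reg 6))) Q σ' := by
    intro σ' hI' h4' h3' h6' ho'
    have hlt := typeCode_lt d s z i (σ.reg 4 / t) (σ.reg 4 % t)
    generalize typeCode d s z i (σ.reg 4 / t) (σ.reg 4 % t) = a at *
    have hb : a * t + σ.reg 4 % t < 2 ^ w := by nlinarith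
    refine .seq (.arith (a * t) (by simp [ArithOp.eval, Operand.val, h4']) (by omega) ?_)
    refine .arith (a * t + σ.reg 4 % t) (by simp [ArithOp.eval, Operand.val, h6']) hb ?_
    refine hQ _ ((hI'.setReg (by omega) (by omega)).setReg (by omega) (by omega)) ?_ ?_ ?_
    · simp
    · simpa using h3'
    · simpa using ho'
  refine .seq (.branch (fun hc => .branch (fun hc2 => ?_) fun hc2 => ?_) fun hc => ?_)
  · simp [RamTest.Holds, Operand.val, hI.r0] at hc hc2
    refine runsTo_setConst (by omega) (key _ (hI1.setReg (by omega) (by omega)) ?_ ?_ ?_ ?_) <;>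
      simp [typeCode, hc, hc2]
  · simp [RamTest.Holds, Operand.val, hI.r0] at hc hc2
    refine runsTo_setConst (by omega) (key _ (hI1.setReg (by omega) (by omega)) ?_ ?_ ?_ ?_) <;>
      simp [typeCode, hc]
    omega
  · simp [RamTest.Holds, Operand.val, hI.r0] at hc
    refine runsTo_direction (X := X) d _ le_rfl hI1 hz (by simpa using hdiv) hX hw (by omega) ?_
    intro σ' h1 h2 h3 h4 h5
    refine key σ' h1 ?_ (by simpa using h3) (by simpa using h4) (by simpa using h5)
    rw [h2]
    simp [typeCode, hc]

theorem runsTo_readDigit {X B k : ℕ} (ht : 0 < t) (hI : Inv d s mem z σ) (hz : z ≤ X)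
    (hm : mem (4 * t * z + k + 1) ≤ X) (hX : ∀ l < d, s ^ l ≤ X) (hw : 2 * X < 2 ^ w)
    (hw2 : (2 * d + 2) * t + 5 < 2 ^ w) (hw3 : 4 * t * z + k + 1 < 2 ^ w)
    (hw4 : σ.reg 3 * B + viewDigit d s t mem z k < 2 ^ w)
    (hQ : ∀ σ', Inv d s mem z σ' → σ'.reg 3 = σ.reg 3 * B + viewDigit d s t mem z k →
      σ'.out = σ.out → Q σ') :
    RunsTo w (readDigit d t B k) Q σ := by
  refine .seq (.arith (4 * t * z) (by simp [ArithOp.eval, Operand.val, hI.r0]) (by omega) ?_)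
  refine .seq (.arith (4 * t * z + k) (by simp [ArithOp.eval, Operand.val]) (by omega) ?_)
  refine .seq (.arith (4 * t * z + k + 1) (by simp [ArithOp.eval, Operand.val]) (by omega) ?_)
  refine .seq (.load (by simpa [Operand.val] using hw3) ?_ ?_)
  · simp only [Operand.val, RamState.setReg_reg, RamState.setReg_mem, hI.mem_eq, if_true]
    omega
  simp only [Operand.val, RamState.setReg_reg, RamState.setReg_mem, hI.mem_eq, if_true]
  have hI1 := (((hI.setReg (r := 4) (v := 4 * t * z) (by omega) (by omega)).setReg
    (r := 4) (v := 4 * t * z + k) (by omega) (by omega)).setReg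
    (r := 4) (v := 4 * t * z + k + 1) (by omega) (by omega)).setReg
    (r := 4) (v := mem (4 * t * z + k + 1)) (by omega) (by omega)
  have key : ∀ σ', Inv d s mem z σ' → σ'.reg 4 = viewDigit d s t mem z k →
      σ'.reg 3 = σ.reg 3 → σ'.out = σ.out →
      RunsTo w (.seq (.arith 3 .mul (reg 3) (const B)) (.arith 3 .add (reg 3) (reg 4))) Q σ' := by
    intro σ' hI' h4' h3' ho'
    refine .seq (.arith (σ.reg 3 * B) (by simp [ArithOp.eval, Operand.val, h3']) (by omega) ?_)
    refine .arith _ (by simp [ArithOp.eval, Operand.val, h4']) hw4 ?_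
    refine hQ _ ((hI'.setReg (by omega) (by omega)).setReg (by omega) (by omega)) ?_ ?_
    · simp
    · simpa using ho'
  refine .seq ?_
  by_cases hk : k % 4 = 0
  · rw [if_pos hk]
    refine .skip (key _ hI1 ?_ ?_ ?_) <;> simp [viewDigit, hk]
  · rw [if_neg hk]
    refine runsTo_relative (X := X) ht hI1 hz (by simpa using hm) hX hw hw2 ?_
    intro σ' h1 h2 h3 h4
    refine key σ' h1 ?_ (by simpa using h3) (by simpa using h4)
    rw [h2]
    simp [viewDigit, hk]

theorem runsTo_readDigits {X B : ℕ} (ht : 0 < t) (hz : z ≤ X) (hX : ∀ l < d, s ^ l ≤ X)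
    (hw : 2 * X < 2 ^ w) (hw2 : (2 * d + 2) * t + 5 < 2 ^ w) (n : ℕ) : ∀ σ : RamState,
    Inv d s mem z σ → (∀ k < n, mem (4 * t * z + k + 1) ≤ X) →
    4 * t * z + n < 2 ^ w → (∀ k < n, viewDigit d s t mem z k < B) →
    (σ.reg 3 + 1) * B ^ n < 2 ^ w →
    (∀ σ', Inv d s mem z σ' → σ'.reg 3 = horner (viewDigit d s t mem z) B n (σ.reg 3) →
      σ'.out = σ.out → Q σ') →
    RunsTo w (readDigits d t B n) Q σ := by
  induction n with
  | zero =>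
    intro σ hI _ _ _ _ hQ
    exact .skip (hQ _ hI rfl rfl)
  | succ n ih =>
    intro σ hI hm hw3 hB hw4 hQ
    have hBn := hB n (by omega)
    have hmono : (σ.reg 3 * B + viewDigit d s t mem z n + 1) * B ^ n ≤
        (σ.reg 3 + 1) * B ^ (n + 1) := by
      rw [pow_succ', ← mul_assoc]
      exact Nat.mul_le_mul_right _ (by nlinarith)
    have hpos : 1 ≤ B ^ n := Nat.one_le_pow _ _ (by omega)
    refine .seq (runsTo_readDigit (X := X) ht hI hz (hm n (by omega)) hX hw hw2 (by omega) ?_ ?_)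
    · nlinarith
    · intro σ' hI' h3 ho
      refine ih σ' hI' (fun k hk => hm k (by omega)) (by omega) (fun k hk => hB k (by omega)) ?_ ?_
      · rw [h3]; omega
      · intro σ'' hI'' h3' ho'
        exact hQ σ'' hI'' (by rw [h3', h3, horner]) (by rw [ho', ho])

theorem runsTo_bases {scale : ℕ → ℕ} (hz : z < 2 ^ w)
    (hw : ∀ l < d, s * scale l < 2 ^ w) (hs : 0 < s) (n : ℕ) : ∀ {Q : RamState → Prop},
    n ≤ d → Inv d s mem z σ →
    (∀ σ', Inv d s mem z σ' → (∀ l < n, σ'.reg (10 + d + l) = z / s ^ l % s * scale l) →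
      σ'.reg 3 = σ.reg 3 → σ'.out = σ.out → Q σ') →
    RunsTo w (bases d scale n) Q σ := by
  induction n with
  | zero =>
    intro Q _ hI hQ
    exact .skip (hQ _ hI (by simp) rfl rfl)
  | succ n ih =>
    intro Q hn hI hQ
    refine .seq (ih (by omega) hI fun σ' hI' hb h3 ho => ?_)
    have hdiv : z / s ^ n ≤ z := Nat.div_le_self _ _
    have hmod : z / s ^ n % s ≤ z / s ^ n := Nat.mod_le _ _
    have hmod' : z / s ^ n % s ≤ s := (Nat.mod_lt _ hs).le
    have hmul := Nat.mul_le_mul_right (scale n) hmod'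
    refine .seq (.arith (z / s ^ n)
      (by simp [ArithOp.eval, Operand.val, hI'.r0, hI'.pow n (by omega)]) (by omega) ?_)
    refine .seq (.arith (z / s ^ n % s)
      (by simp [ArithOp.eval, Operand.val, hI'.r1]) (by omega) ?_)
    refine .arith (z / s ^ n % s * scale n)
      (by simp [ArithOp.eval, Operand.val]) (hmul.trans_lt (hw n (by omega))) ?_
    refine hQ _ (((hI'.setReg (by omega) (by omega)).setReg (by omega) (by omega)).setReg
      (by omega) (by omega)) ?_ ?_ ?_
    · intro l hl
      rcases Nat.lt_succ_iff_lt_or_eq.1 hl with hl | rfl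
      · have h1 : ¬ 10 + d + l = 10 + d + n := by omega
        have h2 : ¬ 10 + d + l = 4 := by omega
        simp [h2, hb l hl, show l ≠ n by omega]
      · simp
    · have h1 : ¬ 3 = 10 + d + n := by omega
      simp [h1, h3]
    · simpa using ho

/-- The numbers that describe a list of boxes translated by `base`. -/
def boxWords {d : ℕ} (base : ℕ → ℕ) (l : List (BoxCode d)) : List ℕ :=
  l.flatMap fun b => (b.axis : ℕ) :: List.ofFn fun i : Fin d => base i + b.num i

/-- The registers that matter for printing. -/
structure PrintInv (d s : ℕ) (mem : ℕ → ℕ) (z : ℕ) (base : ℕ → ℕ) (σ : RamState) : Prop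
    extends Inv d s mem z σ where
  base_eq : ∀ l < d, σ.reg (10 + d + l) = base l

theorem PrintInv.setReg {base : ℕ → ℕ} (h : PrintInv d s mem z base σ) (v : ℕ) :
    PrintInv d s mem z base (σ.setReg 4 v) where
  toInv := h.toInv.setReg (by omega) (by omega)
  base_eq l hl := by
    rw [RamState.setReg_reg, if_neg (by omega), h.base_eq l hl]

theorem PrintInv.emit {base : ℕ → ℕ} (h : PrintInv d s mem z base σ) (o : List ℕ) :
    PrintInv d s mem z base { σ with out := o } where
  r0 := h.r0
  r1 := h.r1
  r2 := h.r2
  pow := h.pow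
  mem_eq := h.mem_eq
  base_eq := h.base_eq

theorem runsTo_emitNums {base : ℕ → ℕ} (l : List (ℕ × ℕ)) : ∀ σ : RamState,
    PrintInv d s mem z base σ → (∀ p ∈ l, p.1 < d ∧ base p.1 + p.2 < 2 ^ w) →
    (∀ σ', PrintInv d s mem z base σ' → σ'.out = σ.out ++ l.map (fun p => base p.1 + p.2) →
      Q σ') →
    RunsTo w (emitNums d l) Q σ := by
  induction l with
  | nil =>
    intro σ hI _ hQ
    exact .skip (hQ _ hI (by simp))
  | cons p l ih =>
    intro σ hI hl hQ
    obtain ⟨hp, hb⟩ := hl p (by simp)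
    refine .seq (.arith (base p.1 + p.2)
      (by simp [ArithOp.eval, Operand.val, hI.base_eq p.1 hp]) hb ?_)
    refine .seq (.emit (base p.1 + p.2) (by simp [Operand.val]) hb ?_)
    refine ih _ ((hI.setReg _).emit _) (fun q hq => hl q (by simp [hq])) fun σ' hI' ho => ?_
    exact hQ σ' hI' (by simp [ho])

theorem runsTo_emitBoxes {base : ℕ → ℕ} (hd : d < 2 ^ w) (l : List (BoxCode d)) :
    ∀ σ : RamState, PrintInv d s mem z base σ →
    (∀ b ∈ l, ∀ i : Fin d, base i + b.num i < 2 ^ w) →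
    (∀ σ', PrintInv d s mem z base σ' → σ'.out = σ.out ++ boxWords base l → Q σ') →
    RunsTo w (emitBoxes l) Q σ := by
  induction l with
  | nil =>
    intro σ hI _ hQ
    exact .skip (hQ _ hI (by simp [boxWords]))
  | cons b l ih =>
    intro σ hI hl hQ
    refine .seq (.emit _ rfl (b.axis.2.trans hd) (.seq ?_))
    refine runsTo_emitNums _ _ (hI.emit _) ?_ fun σ' hI' ho => ?_
    · intro p hp
      obtain ⟨i, rfl⟩ := (List.mem_ofFn' _ _).1 hp
      exact ⟨i.2, hl b (by simp) i⟩
    · refine ih σ' hI' (fun q hq => hl q (by simp [hq])) fun σ'' hI'' ho' => hQ σ'' hI'' ?_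
      rw [ho', ho]
      simp [boxWords, Operand.val, List.map_ofFn, Function.comp_def]

theorem runsTo_select {f : ℕ → RamProgram} (n : ℕ) (hn : σ.reg 3 < n)
    (h : RunsTo w (f (σ.reg 3)) Q σ) : RunsTo w (select f n) Q σ := by
  induction n with
  | zero => omega
  | succ n ih =>
    refine .branch (fun hc => ?_) fun hc => ih ?_
    · simp only [RamTest.Holds, Operand.val] at hc
      rwa [← hc]
    · simp only [RamTest.Holds, Operand.val] at hc
      omega

/-- The conditions under which all numbers that occur fit into words of `w` bits. Here `X` bounds
the numbers of vertices and cells, and `C` the numbers in the table. -/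
structure Fits (w d s t X C : ℕ) (scale : ℕ → ℕ) : Prop where
  pow : ∀ l ≤ d, s ^ l ≤ X
  cells : s ^ d * t ≤ X
  addr : 4 * X + 4 * t + 1 < 2 ^ w
  base : (2 * d + 2) * t + 5 < 2 ^ w
  code : ((2 * d + 2) * t + 5) ^ (4 * t) < 2 ^ w
  coord : ∀ l < d, s * scale l + C < 2 ^ w

variable {X C D : ℕ} {scale : ℕ → ℕ} {tab : ℕ → List (BoxCode d)}

theorem runsTo_cell (hF : Fits w d s t X C scale) (ht : 0 < t) (hs : 0 < s) (hz : z < s ^ d)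
    (hm : ∀ a, mem a ≤ X) (hm0 : ∀ a, a % 4 = 1 → mem a < 5)
    (htab : ∀ κ < ((2 * d + 2) * t + 5) ^ (4 * t), ∀ b ∈ tab κ, ∀ i, b.num i ≤ C)
    (hI : Inv d s mem z σ)
    (hQ : ∀ σ', Inv d s mem (z + 1) σ' → σ'.out = σ.out ++
      boxWords (fun l => z / s ^ l % s * scale l)
        (tab (horner (viewDigit d s t mem z) ((2 * d + 2) * t + 5) (4 * t) 0)) → Q σ') :
    RunsTo w (cell d t scale tab) Q σ := by
  have hzt : z * t + t ≤ X := by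
    have h1 : (z + 1) * t ≤ s ^ d * t := Nat.mul_le_mul_right _ hz
    have h2 := hF.cells
    nlinarith
  have hzX : z ≤ z * t := Nat.le_mul_of_pos_right _ ht
  have haddr := hF.addr
  have hbase := hF.base
  have hdt : 2 * d + 2 ≤ (2 * d + 2) * t := Nat.le_mul_of_pos_right _ ht
  have hdig : ∀ k < 4 * t, viewDigit d s t mem z k < (2 * d + 2) * t + 5 := fun k _ =>
    viewDigit_lt ht fun hk => hm0 _ (by
      rw [show 4 * t * z + k + 1 = k + 1 + 4 * (t * z) by ring]; omega)
  refine .seq (runsTo_setConst (by omega) (.seq ?_))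
  have hI1 := hI.setReg (r := 3) (v := 0) (by omega) (by omega)
  refine runsTo_readDigits (X := X) ht (by omega) (fun l hl => hF.pow l hl.le) (by omega) hbase
    (4 * t) _ hI1 (fun k _ => hm _) (by rw [show 4 * t * z = 4 * (z * t) by ring]; omega) hdig
    (by simpa using hF.code) fun σ₁ hI₁ h3 ho => ?_
  have hκ := horner_lt (4 * t) hdig 0
  simp only [RamState.setReg_reg, if_true] at h3
  refine .seq (runsTo_bases (by omega) (fun l hl => by have := hF.coord l hl; omega) hs d le_rfl hI₁
    fun σ₂ hI₂ hb h3' ho' => ?_)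
  refine .seq (runsTo_select _ (by rw [h3', h3]; simpa using hκ) ?_)
  rw [h3', h3]
  refine runsTo_emitBoxes (base := fun l => z / s ^ l % s * scale l) (by omega) _ _ ⟨hI₂, hb⟩ ?_ ?_
  · intro b hbt i
    have h1 := htab _ (by simpa using hκ) b hbt i
    have h2 := hF.coord i i.2
    have h4 := Nat.mul_le_mul_right (scale i) (Nat.mod_lt (z / s ^ (i : ℕ)) hs).le
    exact (Nat.add_le_add h4 h1).trans_lt h2
  · intro σ₃ hI₃ ho₃
    refine .arith (z + 1) (by simp [ArithOp.eval, Operand.val, hI₃.r0]) (by omega) (hQ _ ?_ ?_)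
    · constructor
      · simp
      · simpa using hI₃.r1
      · simpa using hI₃.r2
      · intro j hj
        simpa using hI₃.pow j hj
      · exact hI₃.mem_eq
    · rw [RamState.setReg_out, ho₃, ho', ho, RamState.setReg_out]

theorem runsTo_powers (hs1 : 1 < 2 ^ w) (n : ℕ) : ∀ {Q : RamState → Prop},
    (∀ l ≤ n, s ^ l < 2 ^ w) → σ.reg 1 = s →
    (∀ σ', σ'.reg 0 = σ.reg 0 → σ'.reg 1 = s → σ'.reg 2 = s ^ n →
      (∀ j < n, σ'.reg (10 + j) = s ^ j) → σ'.mem = σ.mem → σ'.out = σ.out → Q σ') →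
    RunsTo w (powers n) Q σ := by
  induction n with
  | zero =>
    intro Q _ h1 hQ
    exact runsTo_setConst hs1 (hQ _ (by simp) (by simpa using h1) (by simp) (by simp) rfl rfl)
  | succ n ih =>
    intro Q hn h1 hQ
    refine .seq (ih (fun l hl => hn l (by omega)) h1 fun σ' h0' h1' h2' hp hm ho => ?_)
    refine .seq (.arith (s ^ n) (by simp [ArithOp.eval, Operand.val, h2']) (hn n (by omega)) ?_)
    have h12 : ¬ 2 = 10 + n := by omega
    have h11 : ¬ 1 = 10 + n := by omega
    have h10 : ¬ 0 = 10 + n := by omega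
    refine .arith (s ^ (n + 1)) (by simp [ArithOp.eval, Operand.val, h2', h1', h12, h11, pow_succ])
      (hn _ le_rfl) (hQ _ ?_ ?_ ?_ ?_ ?_ ?_)
    · simp [h10, h0']
    · simp [h11, h1']
    · simp
    · intro j hj
      have hj2 : ¬ 10 + j = 2 := by omega
      rcases Nat.lt_succ_iff_lt_or_eq.1 hj with hj | rfl
      · simp [hj2, show j ≠ n by omega, hp j hj]
      · simp [hj2]
    · simpa using hm
    · simpa using ho

/-- The program prints the denominator, and then cell by cell the translated boxes from the table.
-/
theorem ramComputes_main (hF : Fits w d s t X C scale) (ht : 0 < t) (hs : 0 < s)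
    (hmem : mem 0 = s) (hm : ∀ a, mem a ≤ X) (hm0 : ∀ a, a % 4 = 1 → mem a < 5) (hD : D < 2 ^ w)
    (htab : ∀ κ < ((2 * d + 2) * t + 5) ^ (4 * t), ∀ b ∈ tab κ, ∀ i, b.num i ≤ C) {T : ℕ}
    (hT : (start d D).time + s ^ d * ((cell d t scale tab).time + 1) + 1 ≤ T) :
    RamComputes w (main d t D scale tab) mem T (D :: (List.range (s ^ d)).flatMap fun z =>
      boxWords (fun l => z / s ^ l % s * scale l)
        (tab (horner (viewDigit d s t mem z) ((2 * d + 2) * t + 5) (4 * t) 0))) := by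
  have haddr := hF.addr
  have hstart : RunsTo w (start d D) (fun σ => Inv d s mem 0 σ ∧ σ.out = [D])
      ⟨fun _ => 0, mem, []⟩ := by
    refine .seq (.emit D rfl hD (.seq (.load ?_ ?_ ?_)))
    · change 0 < 2 ^ w
      omega
    · change mem 0 < 2 ^ w
      have := hm 0
      omega
    · refine runsTo_powers (s := s) (by omega) d (fun l hl => ?_) ?_ ?_
      · have := hF.pow l hl
        omega
      · simpa [Operand.val] using hmem
      · intro σ' h0 h1 h2 hp hm' ho
        exact ⟨⟨by simpa using h0, h1, h2, hp, hm'⟩, by simpa using ho⟩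
  obtain ⟨k, hk, σ, he, hI, ho⟩ := hstart
  set I : ℕ → RamState → Prop := fun z σ => Inv d s mem z σ ∧
    σ.out = D :: (List.range z).flatMap fun z => boxWords (fun l => z / s ^ l % s * scale l)
      (tab (horner (viewDigit d s t mem z) ((2 * d + 2) * t + 5) (4 * t) 0)) with hIdef
  obtain ⟨l, hl, σ', he', hI'⟩ := RamExec.counting_loop (w := w) (c := .lt (reg 0) (reg 2))
    (p := cell d t scale tab) (I := I) (n := s ^ d)
    (fun z σ h => by simp [RamTest.Holds, Operand.val, h.1.r0, h.1.r2])
    (fun z σ hz h => runsTo_cell hF ht hs hz hm hm0 htab h.1 fun σ' hI' ho' =>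
      ⟨hI', by rw [ho', h.2, List.range_succ, List.flatMap_append]; simp⟩)
    (s ^ d) 0 σ (by omega) ⟨hI, by simpa using ho⟩
  exact ⟨k + l, by omega, σ', .seq he he', hI'.2⟩

end CellProgram

/-! ### Greedy choice of intermediate positions -/

theorem card_agreeing_on {d M : ℕ} (A : Finset (Fin d)) (c : Fin d → Fin M) :
    (Finset.univ.filter fun m : Fin d → Fin M => ∀ l ∈ A, m l = c l).card = M ^ (d - A.card) := by
  have : (Finset.univ.filter fun m : Fin d → Fin M => ∀ l ∈ A, m l = c l) =
      Fintype.piFinset fun l => if l ∈ A then {c l} else Finset.univ := by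
    ext m
    simp only [Finset.mem_filter, Finset.mem_univ, true_and, Fintype.mem_piFinset]
    refine forall_congr' fun l => ?_
    by_cases hl : l ∈ A <;> simp [hl]
  rw [this, Fintype.card_piFinset]
  have h2 : ∀ l, (if l ∈ A then {c l} else Finset.univ : Finset (Fin M)).card =
      if l ∈ A then 1 else M := fun l => by
    by_cases hl : l ∈ A <;> simp [hl]
  rw [Finset.prod_congr rfl fun l _ => h2 l, Finset.prod_ite]
  simp [Finset.filter_notMem_eq_sdiff, ← Finset.compl_eq_univ_sdiff, Finset.card_compl]

/-- At most `N ^ k` elements forbid, each, the vectors that agree with a given one in `k ≥ 1`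
coordinates; these are at most a fraction `1 / (2 d)` of all vectors. -/
theorem card_forbidden_le {ι : Type*} {d N M k : ℕ} (hM : 2 * d * N ≤ M) (hk : 1 ≤ k) (hkd : k ≤ d)
    (S : Finset ι) (hS : S.card ≤ N ^ k) (A : Finset (Fin d)) (hA : A.card = k)
    (c : ι → Fin d → Fin M) :
    2 * d * (S.biUnion fun e => Finset.univ.filter fun m : Fin d → Fin M =>
      ∀ l ∈ A, m l = c e l).card ≤ M ^ d := by
  have h1 : (S.biUnion fun e => Finset.univ.filter fun m : Fin d → Fin M =>
      ∀ l ∈ A, m l = c e l).card ≤ S.card * M ^ (d - k) :=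
    Finset.card_biUnion_le_card_mul _ _ _ fun e _ => by rw [card_agreeing_on, hA]
  calc _ ≤ 2 * d * (N ^ k * M ^ (d - k)) :=
        Nat.mul_le_mul_left _ (h1.trans (Nat.mul_le_mul_right _ hS))
    _ ≤ (2 * d) ^ k * (N ^ k * M ^ (d - k)) :=
        Nat.mul_le_mul_right _ (Nat.le_self_pow (by omega) _)
    _ = (2 * d * N) ^ k * M ^ (d - k) := by rw [mul_pow]; ring
    _ ≤ M ^ k * M ^ (d - k) := Nat.mul_le_mul_right _ (Nat.pow_le_pow_left hM _)
    _ = M ^ d := by rw [← pow_add, Nat.add_sub_cancel' hkd]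

open Classical in
/-- At most `N ^ k` pairs have an end with prescribed digits beyond the `k`-th. -/
theorem card_digits_le {ι κ : Type*} {d N k : ℕ} {dig : κ → ℕ → ℕ}
    (hdig : ∀ i l, dig i l < N)
    (hinj : ∀ i j, (∀ l, 1 ≤ l → l < d → dig i l = dig j l) → i = j)
    (S : Finset ι) (π : ι → κ) (hπ : Set.InjOn π S) (i : κ) :
    (S.filter fun e => ∀ l, k < l → l < d → dig (π e) l = dig i l).card ≤ N ^ k := by
  have hc : (Fintype.piFinset fun _ : Fin k => Finset.range N).card = N ^ k := by simp
  rw [← hc]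
  refine Finset.card_le_card_of_injOn (fun e l => dig (π e) (l + 1)) ?_ ?_
  · intro e _
    simp [hdig]
  · intro e he e' he' h
    simp only [Finset.coe_filter, Set.mem_ofPred_eq] at he he'
    refine hπ he.1 he'.1 (hinj _ _ fun l hl hld => ?_)
    rcases le_or_gt l k with hlk | hlk
    · have := congrFun h ⟨l - 1, by omega⟩
      simpa [Nat.sub_add_cancel hl] using this
    · rw [he.2 l hlk hld, he'.2 l hlk hld]

/-- The property of the intermediate positions `c`, `c'` of two edges with ends numbered `e`, `e'`
that keeps their routes apart: no mixture of leading coordinates of the intermediate position and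
trailing digits of an end coincides. -/
structure Separated {κ : Type*} (d : ℕ) (dig : κ → ℕ → ℕ) (e e' : κ × κ) (c c' : ℕ → ℕ) :
    Prop where
  fst : ∀ k, 1 ≤ k → k < d →
    ¬ ((∀ l < k, c l = c' l) ∧ ∀ l, k < l → l < d → dig e.1 l = dig e'.1 l)
  snd : ∀ k, 1 ≤ k → k < d →
    ¬ ((∀ l < k, c l = c' l) ∧ ∀ l, k < l → l < d → dig e.2 l = dig e'.2 l)
  last : ¬ ∀ l, 1 ≤ l → l < d → c l = c' l

theorem Separated.symm {κ : Type*} {d : ℕ} {dig : κ → ℕ → ℕ} {e e' : κ × κ} {c c' : ℕ → ℕ}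
    (h : Separated d dig e e' c c') : Separated d dig e' e c' c where
  fst k hk hkd hc := h.fst k hk hkd
    ⟨fun l hl => (hc.1 l hl).symm, fun l hl hld => (hc.2 l hl hld).symm⟩
  snd k hk hkd hc := h.snd k hk hkd
    ⟨fun l hl => (hc.1 l hl).symm, fun l hl hld => (hc.2 l hl hld).symm⟩
  last hc := h.last fun l hl hld => (hc l hl hld).symm

/-- A new edge finds a position: the vectors forbidden by the earlier edges are fewer than all. -/
theorem exists_separated_vector {κ : Type*} [DecidableEq κ] {d N M : ℕ} (hd : 2 ≤ d)
    (hM : 2 * d * N ≤ M) (hM0 : 0 < M) {dig : κ → ℕ → ℕ} (hdig : ∀ i l, dig i l < N)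
    (hinj : ∀ i j, (∀ l, 1 ≤ l → l < d → dig i l = dig j l) → i = j)
    (μ : Finset (κ × κ)) (h1 : Set.InjOn Prod.fst (μ : Set (κ × κ)))
    (h2 : Set.InjOn Prod.snd (μ : Set (κ × κ))) (c : κ × κ → Fin d → Fin M) (e : κ × κ) :
    ∃ m : Fin d → Fin M, ∀ e' ∈ μ, Separated d dig e e' (fun l => if h : l < d then m ⟨l, h⟩ else 0)
      (fun l => if h : l < d then c e' ⟨l, h⟩ else 0) := by
  classical
  let lead : ℕ → Finset (Fin d) := fun k => Finset.univ.filter fun l => (l : ℕ) < k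
  let tail : Finset (Fin d) := Finset.univ.filter fun l => 1 ≤ (l : ℕ)
  have hlead : ∀ k ≤ d, (lead k).card = k := fun k hk => by
    simp [lead, Fin.card_filter_val_lt, hk]
  have htail : tail.card = d - 1 := by
    have h3 : tail = (lead 1)ᶜ := by ext l; simp [tail, lead, Nat.one_le_iff_ne_zero]
    rw [h3, Finset.card_compl, hlead 1 (by omega), Fintype.card_fin]
  let bad : Finset (κ × κ) → Finset (Fin d) → Finset (Fin d → Fin M) := fun S A =>
    S.biUnion fun e' => Finset.univ.filter fun m => ∀ l ∈ A, m l = c e' l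
  let S₁ : ℕ → Finset (κ × κ) := fun k =>
    μ.filter fun e' => ∀ l, k < l → l < d → dig e'.1 l = dig e.1 l
  let S₂ : ℕ → Finset (κ × κ) := fun k =>
    μ.filter fun e' => ∀ l, k < l → l < d → dig e'.2 l = dig e.2 l
  have hμ : μ.card ≤ N ^ (d - 1) := by
    have h := card_digits_le (k := d - 1) hdig hinj μ Prod.fst h1 e.1
    rwa [Finset.filter_true_of_mem fun e' _ l (hl : d - 1 < l) hld => absurd hl (by omega)] at h
  have b1 : ∀ k ∈ Finset.Ico 1 d, 2 * d * (bad (S₁ k) (lead k)).card ≤ M ^ d := fun k hk => by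
    rw [Finset.mem_Ico] at hk
    exact card_forbidden_le hM hk.1 hk.2.le _ (card_digits_le hdig hinj μ Prod.fst h1 e.1) _
      (hlead k hk.2.le) c
  have b2 : ∀ k ∈ Finset.Ico 1 d, 2 * d * (bad (S₂ k) (lead k)).card ≤ M ^ d := fun k hk => by
    rw [Finset.mem_Ico] at hk
    exact card_forbidden_le hM hk.1 hk.2.le _ (card_digits_le hdig hinj μ Prod.snd h2 e.2) _
      (hlead k hk.2.le) c
  have b3 : 2 * d * (bad μ tail).card ≤ M ^ d :=
    card_forbidden_le hM (by omega) (by omega) _ hμ _ htail c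
  set all := (Finset.Ico 1 d).biUnion (fun k => bad (S₁ k) (lead k)) ∪
    ((Finset.Ico 1 d).biUnion (fun k => bad (S₂ k) (lead k)) ∪ bad μ tail) with hall
  have hcard : all.card < (Finset.univ : Finset (Fin d → Fin M)).card := by
    have e1 : 2 * d * ((Finset.Ico 1 d).biUnion fun k => bad (S₁ k) (lead k)).card ≤
        (d - 1) * M ^ d := by
      calc _ ≤ 2 * d * ∑ k ∈ Finset.Ico 1 d, (bad (S₁ k) (lead k)).card :=
            Nat.mul_le_mul_left _ Finset.card_biUnion_le
        _ = ∑ k ∈ Finset.Ico 1 d, 2 * d * (bad (S₁ k) (lead k)).card := Finset.mul_sum _ _ _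
        _ ≤ ∑ k ∈ Finset.Ico 1 d, M ^ d := Finset.sum_le_sum b1
        _ = (d - 1) * M ^ d := by simp
    have e2 : 2 * d * ((Finset.Ico 1 d).biUnion fun k => bad (S₂ k) (lead k)).card ≤
        (d - 1) * M ^ d := by
      calc _ ≤ 2 * d * ∑ k ∈ Finset.Ico 1 d, (bad (S₂ k) (lead k)).card :=
            Nat.mul_le_mul_left _ Finset.card_biUnion_le
        _ = ∑ k ∈ Finset.Ico 1 d, 2 * d * (bad (S₂ k) (lead k)).card := Finset.mul_sum _ _ _
        _ ≤ ∑ k ∈ Finset.Ico 1 d, M ^ d := Finset.sum_le_sum b2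
        _ = (d - 1) * M ^ d := by simp
    have e3 : all.card ≤ _ + (_ + _) :=
      (Finset.card_union_le _ _).trans (Nat.add_le_add_left (Finset.card_union_le _ _) _)
    have hp : 0 < M ^ d := pow_pos hM0 _
    have h5 : 2 * d * all.card < 2 * d * M ^ d := by
      have h6 := Nat.mul_le_mul_left (2 * d) e3
      have h7 : 2 * d * M ^ d = (d - 1) * M ^ d + ((d - 1) * M ^ d + M ^ d) + M ^ d := by
        obtain ⟨n, rfl⟩ : ∃ n, d = n + 1 := ⟨d - 1, by omega⟩
        rw [Nat.add_sub_cancel]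
        ring
      rw [mul_add, mul_add] at h6
      omega
    rw [Finset.card_univ, Fintype.card_fun, Fintype.card_fin, Fintype.card_fin]
    exact Nat.lt_of_mul_lt_mul_left h5
  obtain ⟨m, hm⟩ : ∃ m, m ∉ all := by
    by_contra hcon
    push Not at hcon
    exact absurd (Finset.card_le_card fun m _ => hcon m) (not_le.2 hcard)
  rw [hall, Finset.mem_union, Finset.mem_union, not_or, not_or] at hm
  obtain ⟨hm1, hm2, hm3⟩ := hm
  refine ⟨m, fun e' he' => ⟨fun k hk hkd hc => hm1 ?_, fun k hk hkd hc => hm2 ?_,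
    fun hc => hm3 ?_⟩⟩
  · refine Finset.mem_biUnion.2 ⟨k, Finset.mem_Ico.2 ⟨hk, hkd⟩, Finset.mem_biUnion.2 ⟨e',
      Finset.mem_filter.2 ⟨he', fun l hl hld => (hc.2 l hl hld).symm⟩, ?_⟩⟩
    simp only [Finset.mem_filter, Finset.mem_univ, true_and, lead]
    intro l hl
    have := hc.1 l hl
    simp only [l.2, dif_pos] at this
    exact Fin.ext this
  · refine Finset.mem_biUnion.2 ⟨k, Finset.mem_Ico.2 ⟨hk, hkd⟩, Finset.mem_biUnion.2 ⟨e',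
      Finset.mem_filter.2 ⟨he', fun l hl hld => (hc.2 l hl hld).symm⟩, ?_⟩⟩
    simp only [Finset.mem_filter, Finset.mem_univ, true_and, lead]
    intro l hl
    have := hc.1 l hl
    simp only [l.2, dif_pos] at this
    exact Fin.ext this
  · refine Finset.mem_biUnion.2 ⟨e', he', ?_⟩
    simp only [Finset.mem_filter, Finset.mem_univ, true_and, tail]
    intro l hl
    have := hc l hl l.2
    simp only [l.2, dif_pos] at this
    exact Fin.ext this

/-- Every matching has pairwise separated intermediate positions with few values per coordinate. -/
theorem exists_separated_positions {κ : Type*} [DecidableEq κ] {d N M : ℕ} (hd : 2 ≤ d)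
    (hM : 2 * d * N ≤ M) (hM0 : 0 < M) {dig : κ → ℕ → ℕ} (hdig : ∀ i l, dig i l < N)
    (hinj : ∀ i j, (∀ l, 1 ≤ l → l < d → dig i l = dig j l) → i = j)
    (μ : Finset (κ × κ)) (h1 : Set.InjOn Prod.fst (μ : Set (κ × κ)))
    (h2 : Set.InjOn Prod.snd (μ : Set (κ × κ))) :
    ∃ c : κ × κ → ℕ → ℕ, (∀ e l, c e l < M) ∧
      ∀ e ∈ μ, ∀ e' ∈ μ, e ≠ e' → Separated d dig e e' (c e) (c e') := by
  suffices h : ∃ c : κ × κ → Fin d → Fin M, ∀ e ∈ μ, ∀ e' ∈ μ, e ≠ e' →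
      Separated d dig e e' (fun l => if h : l < d then c e ⟨l, h⟩ else 0)
        (fun l => if h : l < d then c e' ⟨l, h⟩ else 0) by
    obtain ⟨c, hc⟩ := h
    refine ⟨fun e l => if h : l < d then c e ⟨l, h⟩ else 0, fun e l => ?_, hc⟩
    dsimp only
    split_ifs
    · exact (c e _).2
    · exact hM0
  induction μ using Finset.induction_on with
  | empty => exact ⟨fun _ _ => ⟨0, hM0⟩, by simp⟩
  | insert e μ he ih =>
    rw [Finset.coe_insert] at h1 h2
    have h1' := h1.mono (Set.subset_insert _ _)
    have h2' := h2.mono (Set.subset_insert _ _)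
    obtain ⟨c, hc⟩ := ih h1' h2'
    obtain ⟨m, hm⟩ := exists_separated_vector hd hM hM0 hdig hinj μ h1' h2' c e
    refine ⟨Function.update c e m, ?_⟩
    have hne : ∀ e' ∈ μ, e' ≠ e := fun e' he' h => he (h ▸ he')
    intro a ha b hb hab
    rcases Finset.mem_insert.1 ha with ha' | ha'
    · subst ha'
      rcases Finset.mem_insert.1 hb with hb' | hb'
      · exact absurd hb'.symm hab
      · rw [Function.update_self, Function.update_of_ne (hne b hb')]
        exact hm b hb'
    · rcases Finset.mem_insert.1 hb with hb' | hb'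
      · subst hb'
        rw [Function.update_self, Function.update_of_ne (hne a ha')]
        exact (hm a ha').symm
      · rw [Function.update_of_ne (hne a ha'), Function.update_of_ne (hne b hb')]
        exact hc a ha' b hb' hab

/-! ### Routes on the lattice -/

/-- The dimensions of the construction, for boxes of length `L` with integral part `Λ`. All lengths
except `Λ` and `L` count lattice steps, and a lattice step is `16` units of length. The intermediate
positions take `M` values per coordinate, `W` bounds the local deviations, and a straight part of a
route, of length about `U`, is covered by `q + 1` boxes. -/
structure Scale where
  (d Λ M W U q : ℕ)
  L : ℝ
  three_le_d : 3 ≤ d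
  sixteen_le_Λ : 16 ≤ Λ
  W_eq : W = (d + 1) * M
  U_eq : U = 10 * W
  Λ_le : 24 * Λ ≤ W
  q_pos : 0 < q
  step_le : 16 * U + 16 * W + 2 * Λ ≤ q * Λ
  le_step : 4 * (q * Λ) + 80 * W + 10 * Λ ≤ 80 * U
  Λ_le_L : (Λ : ℝ) ≤ L
  L_lt : L < Λ + 1

/-- The data that determine the route of a half-edge: the cell `x` and the position `dig` of its
vertex, the direction `ty` of the other cell (`d` for an edge inside a cell), the side `neg` of the
edge, the intermediate position `m` of the edge, and the index `lane` among the half-edges of the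
vertex. -/
structure Strand where
  x : ℕ → ℤ
  dig : ℕ → ℤ
  ty : ℕ
  neg : Bool
  m : ℕ → ℤ
  lane : ℕ

namespace Strand

variable (S : Scale) (A B : Strand)

/-- The bounds on the data of a route. -/
structure Valid : Prop where
  dig_nonneg : ∀ l, 0 ≤ A.dig l
  dig_lt : ∀ l, A.dig l < S.Λ
  m_nonneg : ∀ l, 0 ≤ A.m l
  m_lt : ∀ l, A.m l < S.M
  ty_le : A.ty ≤ S.d
  lane_lt : A.lane < 3

/-- `1` if the route leaves its cell in direction `l`, backwards. -/
def shift (l : ℕ) : ℤ := if A.neg = true ∧ A.ty = l then 1 else 0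

/-- The offset inside a block that encodes the direction and the intermediate position. -/
def g (l : ℕ) : ℤ := A.ty * S.M + A.m l

/-- The lattice coordinates of the vertex. -/
def source (l : ℕ) : ℤ :=
  if l = 0 then 4 * S.U * A.x 0 + 2 * S.U else 2 * S.U * A.x l + A.dig l

/-- The lattice coordinates of the place that the route heads for. -/
def target (l : ℕ) : ℤ :=
  if l = 0 then 4 * S.U * A.x 0 + (if A.neg = true then (S.U : ℤ) else 3 * S.U) + A.g S 0
  else 2 * S.U * (A.x l - A.shift l) + S.U + A.g S l

/-- The coordinate `0` of the meeting point of the two halves of the edge. -/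
def final : ℤ :=
  4 * S.U * A.x 0 + if A.ty = 0 then (if A.neg = true then (0 : ℤ) else 4 * S.U)
    else 2 * (S.U : ℤ)

/-- Phase `k` of a route, for `0 ≤ k ≤ d`, is parallel to axis `k % d`, from `first k` to `finish
k`: the coordinates are changed one after the other, and coordinate `0` is changed once more in the
end. -/
def first (k : ℕ) : ℤ := if k < S.d then A.source S k else A.target S 0

/-- The end of phase `k`, along its axis. -/
def finish (k : ℕ) : ℤ := if k < S.d then A.target S k else A.final S

/-- The other lattice coordinates in phase `k`. -/
def lat (k l : ℕ) : ℤ := if l < k then A.target S l else A.source S l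

/-- The smaller end of the range of phase `k`. -/
def lo (k : ℕ) : ℤ := min (A.first S k) (A.finish S k)

/-- The larger end of the range of phase `k`. -/
def hi (k : ℕ) : ℤ := max (A.first S k) (A.finish S k)

/-- The tilt of phase `k`: it decreases along the direction of travel as the turning point is moved
further away. -/
def tilt (k : ℕ) : ℤ := if A.first S k < A.finish S k then S.W - A.g S k else A.g S k

end Strand

theorem Int.le_of_mul_le_mul_add {P a b r : ℤ} (h : P * a ≤ P * b + r) (hr : r < P) (hP : 0 < P) :
    a ≤ b := by
  by_contra hab
  have h1 : b + 1 ≤ a := by omega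
  have h2 := mul_le_mul_of_nonneg_left h1 hP.le
  linarith

theorem Int.eq_of_mul_add_eq {P a b r r' : ℤ} (h : P * a + r = P * b + r') (hr : 0 ≤ r)
    (hr' : 0 ≤ r') (hrP : r < P) (hrP' : r' < P) : a = b ∧ r = r' := by
  have h1 : a ≤ b := Int.le_of_mul_le_mul_add (P := P) (r := r') (by linarith) hrP' (by linarith)
  have h2 : b ≤ a := Int.le_of_mul_le_mul_add (P := P) (r := r) (by linarith) hrP (by linarith)
  obtain rfl := le_antisymm h1 h2
  exact ⟨rfl, by linarith⟩

namespace Scale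

variable (S : Scale)

theorem U_eq_int : (S.U : ℤ) = 10 * S.W := by exact_mod_cast S.U_eq

theorem W_eq_int : (S.W : ℤ) = (S.d + 1) * S.M := by exact_mod_cast S.W_eq

theorem Λ_le_int : 24 * (S.Λ : ℤ) ≤ S.W := by exact_mod_cast S.Λ_le

theorem sixteen_le_Λ_int : 16 ≤ (S.Λ : ℤ) := by exact_mod_cast S.sixteen_le_Λ

end Scale

namespace Strand

variable {S : Scale} {A B : Strand}

theorem Valid.g_nonneg (hA : A.Valid S) (l : ℕ) : 0 ≤ A.g S l := by
  have := hA.m_nonneg l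
  unfold g
  positivity

theorem Valid.g_lt (hA : A.Valid S) (l : ℕ) : A.g S l < S.W := by
  have h1 := hA.m_lt l
  have h2 : (A.ty : ℤ) ≤ S.d := by exact_mod_cast hA.ty_le
  have h3 := mul_le_mul_of_nonneg_right h2 (Int.natCast_nonneg S.M)
  rw [S.W_eq_int, g]
  linarith

/-- The direction can be read off from any of the offsets. -/
theorem Valid.eq_of_g_eq (hA : A.Valid S) (hB : B.Valid S) {l : ℕ} (h : A.g S l = B.g S l) :
    A.ty = B.ty ∧ A.m l = B.m l := by
  have := Int.eq_of_mul_add_eq (P := S.M) (a := A.ty) (b := B.ty) (r := A.m l) (r' := B.m l)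
    (by unfold g at h; linarith) (hA.m_nonneg l) (hB.m_nonneg l) (hA.m_lt l) (hB.m_lt l)
  exact ⟨by exact_mod_cast this.1, this.2⟩

theorem target_zero : A.target S 0 =
    4 * S.U * A.x 0 + (if A.neg = true then (S.U : ℤ) else 3 * S.U) + A.g S 0 := if_pos rfl

theorem target_pos {l : ℕ} (hl : l ≠ 0) :
    A.target S l = 2 * S.U * (A.x l - A.shift l) + S.U + A.g S l := if_neg hl

theorem source_pos {l : ℕ} (hl : l ≠ 0) : A.source S l = 2 * S.U * A.x l + A.dig l := if_neg hl

theorem shift_eq (A : Strand) (l : ℕ) : A.shift l = 0 ∨ A.shift l = 1 := by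
  unfold shift; split_ifs <;> simp

theorem shift_congr (h : A.ty = B.ty) (h' : A.neg = B.neg) (l : ℕ) : A.shift l = B.shift l := by
  unfold shift; rw [h, h']

theorem Valid.of_target_zero (hA : A.Valid S) (hB : B.Valid S)
    (h : A.target S 0 = B.target S 0) :
    A.x 0 = B.x 0 ∧ A.ty = B.ty ∧ A.neg = B.neg ∧ A.m 0 = B.m 0 := by
  have := S.U_eq_int; have := S.Λ_le_int; have := S.sixteen_le_Λ_int
  have := hA.g_nonneg 0; have := hB.g_nonneg 0; have := hA.g_lt 0; have := hB.g_lt 0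
  rw [target_zero, target_zero] at h
  have key := Int.eq_of_mul_add_eq (P := 4 * S.U) (a := A.x 0) (b := B.x 0)
    (r := (if A.neg = true then (S.U : ℤ) else 3 * S.U) + A.g S 0)
    (r' := (if B.neg = true then (S.U : ℤ) else 3 * S.U) + B.g S 0) (by linarith)
    (by split_ifs <;> linarith) (by split_ifs <;> linarith)
    (by split_ifs <;> linarith) (by split_ifs <;> linarith)
  have hn : A.neg = B.neg := by
    have h2 := key.2
    cases hAn : A.neg <;> cases hBn : B.neg <;> simp [hAn, hBn] at h2 ⊢ <;> linarith
  have hg : A.g S 0 = B.g S 0 := by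
    have h2 := key.2
    rw [hn] at h2
    linarith
  exact ⟨key.1, (hA.eq_of_g_eq hB hg).1, hn, (hA.eq_of_g_eq hB hg).2⟩

theorem Valid.of_target_pos (hA : A.Valid S) (hB : B.Valid S) {l : ℕ} (hl : l ≠ 0)
    (h : A.target S l = B.target S l) :
    A.x l - A.shift l = B.x l - B.shift l ∧ A.ty = B.ty ∧ A.m l = B.m l := by
  have := S.U_eq_int; have := S.Λ_le_int; have := S.sixteen_le_Λ_int
  have := hA.g_nonneg l; have := hB.g_nonneg l; have := hA.g_lt l; have := hB.g_lt l
  rw [target_pos hl, target_pos hl] at h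
  have key := Int.eq_of_mul_add_eq (P := 2 * S.U) (a := A.x l - A.shift l)
    (b := B.x l - B.shift l) (r := A.g S l) (r' := B.g S l) (by linarith) (by linarith)
    (by linarith) (by linarith) (by linarith)
  exact ⟨key.1, hA.eq_of_g_eq hB key.2⟩

theorem Valid.of_source_pos (hA : A.Valid S) (hB : B.Valid S) {l : ℕ} (hl : l ≠ 0)
    (h : A.source S l = B.source S l) : A.x l = B.x l ∧ A.dig l = B.dig l := by
  have := S.U_eq_int; have := S.Λ_le_int; have := S.sixteen_le_Λ_int
  have := hA.dig_nonneg l; have := hB.dig_nonneg l; have := hA.dig_lt l; have := hB.dig_lt l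
  rw [source_pos hl, source_pos hl] at h
  exact Int.eq_of_mul_add_eq h (by linarith) (by linarith) (by linarith) (by linarith)

theorem Valid.source_ne_target (hA : A.Valid S) (hB : B.Valid S) {l : ℕ} (hl : l ≠ 0) :
    A.source S l ≠ B.target S l := by
  intro h
  have := S.U_eq_int; have := S.Λ_le_int; have := S.sixteen_le_Λ_int
  have := hA.dig_nonneg l; have := hB.g_nonneg l; have := hA.dig_lt l; have := hB.g_lt l
  rw [source_pos hl, target_pos hl] at h
  have key := Int.eq_of_mul_add_eq (P := 2 * S.U) (a := A.x l) (b := B.x l - B.shift l)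
    (r := A.dig l) (r' := S.U + B.g S l) (by linarith) (by linarith)
    (by linarith) (by linarith) (by linarith)
  linarith [key.2]

theorem first_of_lt {k : ℕ} (hk : k < S.d) : A.first S k = A.source S k := if_pos hk

theorem finish_of_lt {k : ℕ} (hk : k < S.d) : A.finish S k = A.target S k := if_pos hk

theorem first_last : A.first S S.d = A.target S 0 := if_neg (lt_irrefl _)

theorem finish_last : A.finish S S.d = A.final S := if_neg (lt_irrefl _)

theorem source_zero : A.source S 0 = 4 * S.U * A.x 0 + 2 * S.U := if_pos rfl

theorem zero_lt_d (S : Scale) : 0 < S.d := by have := S.three_le_d; omega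

/-- Phase `0` runs upwards exactly for the front half of an edge. -/
theorem Valid.up_zero (hA : A.Valid S) : A.first S 0 < A.finish S 0 ↔ A.neg = false := by
  have := S.U_eq_int; have := S.Λ_le_int; have := S.sixteen_le_Λ_int
  have := hA.g_nonneg 0; have := hA.g_lt 0
  rw [first_of_lt (zero_lt_d S), finish_of_lt (zero_lt_d S), source_zero, target_zero]
  cases A.neg <;> simp <;> linarith

theorem Valid.up_mid (hA : A.Valid S) {k : ℕ} (hk : 1 ≤ k) (hkd : k < S.d) :
    A.first S k < A.finish S k ↔ A.shift k = 0 := by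
  have := S.U_eq_int; have := S.Λ_le_int; have := S.sixteen_le_Λ_int
  have := hA.g_nonneg k; have := hA.g_lt k
  have := hA.dig_nonneg k; have := hA.dig_lt k
  rw [first_of_lt hkd, finish_of_lt hkd, source_pos (by omega), target_pos (by omega)]
  rcases A.shift_eq k with h | h <;> rw [h] <;> simp <;> linarith

/-- Each phase has length about `U`. -/
theorem Valid.length_bounds (hA : A.Valid S) {k : ℕ} (hkd : k ≤ S.d) :
    (S.U : ℤ) - S.W ≤ A.hi S k - A.lo S k ∧ A.hi S k - A.lo S k ≤ S.U + S.W := by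
  have := S.U_eq_int; have := S.Λ_le_int; have := S.sixteen_le_Λ_int
  have := hA.g_nonneg k; have := hA.g_lt k; have := hA.g_nonneg 0; have := hA.g_lt 0
  have := hA.dig_nonneg k; have := hA.dig_lt k
  unfold hi lo
  rcases Nat.lt_or_eq_of_le hkd with hkd | rfl
  · rw [first_of_lt hkd, finish_of_lt hkd]
    rcases Nat.eq_zero_or_pos k with rfl | hk
    · rw [source_zero, target_zero]
      rcases max_cases (4 * (S.U : ℤ) * A.x 0 + 2 * S.U) (4 * S.U * A.x 0 +
        (if A.neg = true then (S.U : ℤ) else 3 * S.U) + A.g S 0) with ⟨h1, h2⟩ | ⟨h1, h2⟩ <;>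
      rcases min_cases (4 * (S.U : ℤ) * A.x 0 + 2 * S.U) (4 * S.U * A.x 0 +
        (if A.neg = true then (S.U : ℤ) else 3 * S.U) + A.g S 0) with ⟨h3, h4⟩ | ⟨h3, h4⟩ <;>
      rw [h1, h3] <;> split_ifs at * <;> constructor <;> linarith
    · rw [source_pos (by omega), target_pos (by omega)]
      rcases A.shift_eq k with h | h <;> rw [h]
      · rw [max_eq_right (by linarith), min_eq_left (by linarith)]
        constructor <;> linarith
      · rw [max_eq_left (by linarith), min_eq_right (by linarith)]
        constructor <;> linarith
  · rw [first_last, finish_last, target_zero, final]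
    split_ifs
    · rw [max_eq_left (by linarith), min_eq_right (by linarith)]
      constructor <;> linarith
    · rw [max_eq_right (by linarith), min_eq_left (by linarith)]
      constructor <;> linarith
    · rw [max_eq_right (by linarith), min_eq_left (by linarith)]
      constructor <;> linarith
    · rw [max_eq_left (by linarith), min_eq_right (by linarith)]
      constructor <;> linarith

theorem Valid.window_zero (hA : A.Valid S) :
    4 * S.U * A.x 0 + S.U ≤ A.lo S 0 ∧ A.hi S 0 < 4 * S.U * A.x 0 + 3 * S.U + S.W := by
  have := S.U_eq_int; have := S.Λ_le_int; have := S.sixteen_le_Λ_int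
  have := hA.g_nonneg 0; have := hA.g_lt 0
  unfold hi lo
  rw [first_of_lt (zero_lt_d S), finish_of_lt (zero_lt_d S), source_zero, target_zero]
  constructor
  · exact le_min (by linarith) (by split_ifs <;> linarith)
  · exact max_lt (by linarith) (by split_ifs <;> linarith)

/-- The turns away from axis `0` are far from the levels of the vertices. -/
theorem Valid.target_zero_far (hB : B.Valid S) (h1 : A.source S 0 ≤ B.target S 0 + S.Λ)
    (h2 : B.target S 0 ≤ A.source S 0 + S.Λ) : False := by
  have := S.U_eq_int; have := S.Λ_le_int; have := S.sixteen_le_Λ_int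
  have := hB.g_nonneg 0; have := hB.g_lt 0
  have hU0 : (0 : ℤ) < 4 * S.U := by linarith
  rw [source_zero, target_zero] at h1 h2
  have hx : A.x 0 = B.x 0 := by
    split_ifs at h1 h2 <;>
    exact le_antisymm
      (Int.le_of_mul_le_mul_add (P := 4 * S.U) (r := 3 * S.U) (by linarith) (by linarith) hU0)
      (Int.le_of_mul_le_mul_add (P := 4 * S.U) (r := 3 * S.U) (by linarith) (by linarith) hU0)
  rw [hx] at h1 h2
  split_ifs at h1 h2 <;> linarith

theorem Valid.window_mid (hA : A.Valid S) {k : ℕ} (hk : 1 ≤ k) (hkd : k < S.d) :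
    2 * S.U * A.x k - A.shift k * S.U ≤ A.lo S k ∧
      A.hi S k < 2 * S.U * A.x k - A.shift k * S.U + (S.U + S.W) := by
  have := S.U_eq_int; have := S.Λ_le_int; have := S.sixteen_le_Λ_int
  have := hA.g_nonneg k; have := hA.g_lt k
  have := hA.dig_nonneg k; have := hA.dig_lt k
  unfold hi lo
  rw [first_of_lt hkd, finish_of_lt hkd, source_pos (by omega), target_pos (by omega)]
  rcases A.shift_eq k with h | h <;> rw [h]
  · exact ⟨le_min (by linarith) (by linarith), max_lt (by linarith) (by linarith)⟩
  · exact ⟨le_min (by linarith) (by linarith), max_lt (by linarith) (by linarith)⟩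

theorem Valid.window_last (hA : A.Valid S) :
    4 * S.U * A.x 0 + (if A.ty = 0 then (if A.neg = true then 0 else 3 * (S.U : ℤ))
        else if A.neg = true then (S.U : ℤ) else 2 * S.U) ≤ A.lo S S.d ∧
      A.hi S S.d ≤ 4 * S.U * A.x 0 + (if A.ty = 0 then (if A.neg = true then (S.U : ℤ) + S.W
        else 4 * (S.U : ℤ)) else if A.neg = true then 2 * (S.U : ℤ) else 3 * S.U + S.W) := by
  have := S.U_eq_int; have := S.Λ_le_int; have := S.sixteen_le_Λ_int
  have := hA.g_nonneg 0; have := hA.g_lt 0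
  unfold hi lo
  rw [first_last, finish_last, target_zero, final]
  split_ifs
  all_goals exact ⟨le_min (by linarith) (by linarith), max_le (by linarith) (by linarith)⟩

/-- Two routes come from the same cell and leave it in the same direction. -/
structure SameFamily (d : ℕ) (A B : Strand) : Prop where
  x : ∀ l < d, A.x l = B.x l
  ty : A.ty = B.ty
  neg : A.neg = B.neg

/-- Routes whose phases `k` lie on the same line and overlap agree in all relevant data. -/
theorem Valid.parallel_mid (hA : A.Valid S) (hB : B.Valid S) {k : ℕ} (hk : 1 ≤ k) (hkd : k < S.d)
    (hlat : ∀ l < S.d, l ≠ k → A.lat S k l = B.lat S k l) (h1 : A.lo S k ≤ B.hi S k)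
    (h2 : B.lo S k ≤ A.hi S k) :
    SameFamily S.d A B ∧ (∀ l < k, A.m l = B.m l) ∧ ∀ l, k < l → l < S.d → A.dig l = B.dig l := by
  have hU := S.U_eq_int; have := S.Λ_le_int; have := S.sixteen_le_Λ_int
  have h0 := hlat 0 (by omega) (by omega)
  rw [lat, lat, if_pos (by omega), if_pos (by omega)] at h0
  obtain ⟨hx0, hty, hneg, hm0⟩ := hA.of_target_zero hB h0
  have hlt : ∀ l < k, A.x l = B.x l ∧ A.m l = B.m l := fun l hl => by
    rcases Nat.eq_zero_or_pos l with rfl | hl0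
    · exact ⟨hx0, hm0⟩
    have h := hlat l (by omega) (by omega)
    rw [lat, lat, if_pos hl, if_pos hl] at h
    have h := hA.of_target_pos hB (by omega) h
    rw [shift_congr hty hneg] at h
    exact ⟨by linarith [h.1], h.2.2⟩
  have hgt : ∀ l, k < l → l < S.d → A.x l = B.x l ∧ A.dig l = B.dig l := fun l hl hld => by
    have h := hlat l (by omega) (by omega)
    rw [lat, lat, if_neg (by omega), if_neg (by omega)] at h
    exact hA.of_source_pos hB (by omega) h
  have hwA := hA.window_mid hk hkd
  have hwB := hB.window_mid hk hkd
  rw [shift_congr hty hneg] at hwA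
  have hxk : A.x k = B.x k := le_antisymm
    (Int.le_of_mul_le_mul_add (P := 2 * S.U) (r := S.U + S.W) (by linarith) (by linarith)
      (by linarith))
    (Int.le_of_mul_le_mul_add (P := 2 * S.U) (r := S.U + S.W) (by linarith) (by linarith)
      (by linarith))
  refine ⟨⟨fun l hl => ?_, hty, hneg⟩, fun l hl => (hlt l hl).2, fun l hl hld => (hgt l hl hld).2⟩
  rcases lt_trichotomy l k with h | rfl | h
  · exact (hlt l h).1
  · exact hxk
  · exact (hgt l h hl).1

theorem Valid.parallel_zero (hA : A.Valid S) (hB : B.Valid S)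
    (hlat : ∀ l < S.d, l ≠ 0 → A.lat S 0 l = B.lat S 0 l) (h1 : A.lo S 0 ≤ B.hi S 0 + S.Λ)
    (h2 : B.lo S 0 ≤ A.hi S 0 + S.Λ) :
    (∀ l < S.d, A.x l = B.x l) ∧ ∀ l, 1 ≤ l → l < S.d → A.dig l = B.dig l := by
  have hU := S.U_eq_int; have := S.Λ_le_int; have := S.sixteen_le_Λ_int
  have hgt : ∀ l, 0 < l → l < S.d → A.x l = B.x l ∧ A.dig l = B.dig l := fun l hl hld => by
    have h := hlat l (by omega) (by omega)
    rw [lat, lat, if_neg (by omega), if_neg (by omega)] at h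
    exact hA.of_source_pos hB (by omega) h
  have hwA := hA.window_zero
  have hwB := hB.window_zero
  have hxk : A.x 0 = B.x 0 := le_antisymm
    (Int.le_of_mul_le_mul_add (P := 4 * S.U) (r := 3 * S.U) (by linarith) (by linarith)
      (by linarith))
    (Int.le_of_mul_le_mul_add (P := 4 * S.U) (r := 3 * S.U) (by linarith) (by linarith)
      (by linarith))
  refine ⟨fun l hl => ?_, fun l hl hld => (hgt l hl hld).2⟩
  rcases Nat.eq_zero_or_pos l with rfl | h
  · exact hxk
  · exact (hgt l h hl).1

/-- `B` is the back half of an edge in the same direction as `A`, and `A` is the front half, and the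
edges join the same pair of cells. -/
structure Opposite (d : ℕ) (A B : Strand) : Prop where
  x : ∀ l < d, A.x l = B.x l - B.shift l
  ty : A.ty = B.ty
  negA : A.neg = false
  negB : B.neg = true

theorem Valid.parallel_last (hA : A.Valid S) (hB : B.Valid S)
    (hlat : ∀ l < S.d, l ≠ 0 → A.lat S S.d l = B.lat S S.d l) (h1 : A.lo S S.d ≤ B.hi S S.d)
    (h2 : B.lo S S.d ≤ A.hi S S.d) :
    (SameFamily S.d A B ∨ Opposite S.d A B ∨ Opposite S.d B A) ∧
      ∀ l, 1 ≤ l → l < S.d → A.m l = B.m l := by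
  have hU := S.U_eq_int; have := S.Λ_le_int; have := S.sixteen_le_Λ_int
  have hd := S.three_le_d
  have hgt : ∀ l, 1 ≤ l → l < S.d → A.x l - A.shift l = B.x l - B.shift l ∧ A.ty = B.ty ∧
      A.m l = B.m l := fun l hl hld => by
    have h := hlat l (by omega) (by omega)
    rw [lat, lat, if_pos (by omega), if_pos (by omega)] at h
    exact hA.of_target_pos hB (by omega) h
  have hty := (hgt 1 (by omega) (by omega)).2.1
  refine ⟨?_, fun l hl hld => (hgt l hl hld).2.2⟩
  have hwA := hA.window_last
  have hwB := hB.window_last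
  have hU0 : (0 : ℤ) < 4 * S.U := by linarith
  rw [hty] at hwA
  have hall : (A.x 0 - A.shift 0 = B.x 0 - B.shift 0) →
      ∀ l < S.d, A.x l - A.shift l = B.x l - B.shift l := fun h0 l hl => by
    rcases Nat.eq_zero_or_pos l with rfl | h
    · exact h0
    · exact (hgt l h hl).1
  have hsame : A.neg = B.neg → A.x 0 = B.x 0 → SameFamily S.d A B := fun hn h0 =>
    ⟨fun l hl => by
      have := hall (by rw [shift_congr hty hn, h0]) l hl
      rw [shift_congr hty hn] at this
      linarith, hty, hn⟩
  by_cases ht : B.ty = 0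
  · have htA : A.ty = 0 := hty.trans ht
    simp only [if_pos ht] at hwA hwB
    cases hAn : A.neg <;> cases hBn : B.neg <;> simp [hAn, hBn] at hwA hwB
    · exact Or.inl (hsame (by rw [hAn, hBn]) (le_antisymm
        (Int.le_of_mul_le_mul_add (r := S.U) (by linarith) (by linarith) hU0)
        (Int.le_of_mul_le_mul_add (r := S.U) (by linarith) (by linarith) hU0)))
    · have hsA : ∀ l, A.shift l = 0 := fun l => by simp [shift, hAn]
      have hsB : B.shift 0 = 1 := by simp [shift, hBn, ht]
      refine Or.inr (Or.inl ⟨fun l hl => ?_, hty, hAn, hBn⟩)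
      have h0 : A.x 0 + 1 = B.x 0 := le_antisymm
        (Int.le_of_mul_le_mul_add (P := 4 * S.U) (r := 2 * S.U + S.W)
          (by linarith) (by linarith) hU0)
        (Int.le_of_mul_le_mul_add (P := 4 * S.U) (r := S.U) (by linarith) (by linarith) hU0)
      have := hall (by rw [hsA, hsB]; linarith) l hl
      rw [hsA] at this
      linarith
    · have hsB : ∀ l, B.shift l = 0 := fun l => by simp [shift, hBn]
      have hsA : A.shift 0 = 1 := by simp [shift, hAn, htA]
      refine Or.inr (Or.inr ⟨fun l hl => ?_, hty.symm, hBn, hAn⟩)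
      have h0 : B.x 0 + 1 = A.x 0 := le_antisymm
        (Int.le_of_mul_le_mul_add (P := 4 * S.U) (r := 2 * S.U + S.W)
          (by linarith) (by linarith) hU0)
        (Int.le_of_mul_le_mul_add (P := 4 * S.U) (r := S.U) (by linarith) (by linarith) hU0)
      have := hall (by rw [hsA, hsB]; linarith) l hl
      rw [hsB] at this
      linarith
    · exact Or.inl (hsame (by rw [hAn, hBn]) (le_antisymm
        (Int.le_of_mul_le_mul_add (r := S.U + S.W) (by linarith) (by linarith) hU0)
        (Int.le_of_mul_le_mul_add (r := S.U + S.W) (by linarith) (by linarith) hU0)))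
  · have htA : ¬ A.ty = 0 := fun h => ht (hty.symm.trans h)
    simp only [if_neg ht] at hwA hwB
    have hsA : A.shift 0 = 0 := by simp [shift, htA]
    have hsB : B.shift 0 = 0 := by simp [shift, ht]
    have h0 : A.x 0 = B.x 0 := by
      cases hAn : A.neg <;> cases hBn : B.neg <;> simp [hAn, hBn] at hwA hwB <;>
      exact le_antisymm
        (Int.le_of_mul_le_mul_add (P := 4 * S.U) (r := 3 * S.U + S.W)
          (by linarith) (by linarith) hU0)
        (Int.le_of_mul_le_mul_add (P := 4 * S.U) (r := 3 * S.U + S.W)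
          (by linarith) (by linarith) hU0)
    have hx := hall (by rw [hsA, hsB, h0])
    cases hAn : A.neg <;> cases hBn : B.neg
    · exact Or.inl (hsame (by rw [hAn, hBn]) h0)
    · refine Or.inr (Or.inl ⟨fun l hl => ?_, hty, hAn, hBn⟩)
      have h3 : A.shift l = 0 := by simp [shift, hAn]
      rw [← hx l hl, h3, sub_zero]
    · refine Or.inr (Or.inr ⟨fun l hl => ?_, hty.symm, hBn, hAn⟩)
      have h3 : B.shift l = 0 := by simp [shift, hBn]
      rw [hx l hl, h3, sub_zero]
    · exact Or.inl (hsame (by rw [hAn, hBn]) h0)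

/-- If phase `k` of `A` reaches the place where `B` turns from axis `k`, with `B` tilted no more
than `A`, then both turn at the same place. -/
theorem Valid.turn_mid (hA : A.Valid S) (hB : B.Valid S) {k : ℕ} (hk : 1 ≤ k) (hkd : k < S.d)
    (hty : A.ty = B.ty) (hneg : A.neg = B.neg) (h1 : A.lo S k ≤ B.target S k)
    (h2 : B.target S k ≤ A.hi S k) (htilt : B.tilt S k ≤ A.tilt S k) :
    A.x k = B.x k ∧ A.m k = B.m k := by
  have hU := S.U_eq_int; have := S.Λ_le_int; have := S.sixteen_le_Λ_int
  have := hB.g_nonneg k; have := hB.g_lt k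
  have hw := hA.window_mid hk hkd
  have hs := shift_congr hty hneg k
  have hBt := target_pos (S := S) (A := B) (l := k) (by omega)
  have hAt := target_pos (S := S) (A := A) (l := k) (by omega)
  have hU0 : (0 : ℤ) < 2 * S.U := by linarith
  have hx : A.x k = B.x k := by
    rcases A.shift_eq k with h | h <;> rw [h] at hw <;> rw [← hs, h] at hBt
    · exact le_antisymm
        (Int.le_of_mul_le_mul_add (P := 2 * S.U) (r := S.U + S.W) (by linarith) (by linarith) hU0)
        (Int.le_of_mul_le_mul_add (P := 2 * S.U) (r := S.U + S.W) (by linarith) (by linarith) hU0)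
    · exact le_antisymm
        (Int.le_of_mul_le_mul_add (P := 2 * S.U) (r := S.U + S.W) (by linarith) (by linarith) hU0)
        (Int.le_of_mul_le_mul_add (P := 2 * S.U) (r := S.U + S.W) (by linarith) (by linarith) hU0)
  refine ⟨hx, (hA.eq_of_g_eq hB ?_).2⟩
  rw [hx, hs] at hAt
  unfold tilt at htilt
  by_cases hup : A.first S k < A.finish S k
  · have hupB := (hB.up_mid hk hkd).2 (hs ▸ (hA.up_mid hk hkd).1 hup)
    rw [if_pos hup, if_pos hupB] at htilt
    rw [hi, max_eq_right hup.le, finish_of_lt hkd] at h2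
    linarith
  · have hupB := mt (fun h => (hA.up_mid hk hkd).2 (hs.trans ((hB.up_mid hk hkd).1 h))) hup
    rw [if_neg hup, if_neg hupB] at htilt
    rw [lo, min_eq_right (not_lt.1 hup), finish_of_lt hkd] at h1
    linarith

theorem Valid.turn_zero (hA : A.Valid S) (hB : B.Valid S) (h1 : A.lo S 0 ≤ B.target S 0)
    (h2 : B.target S 0 ≤ A.hi S 0) (htilt : B.tilt S 0 ≤ A.tilt S 0) :
    A.x 0 = B.x 0 ∧ A.ty = B.ty ∧ A.neg = B.neg ∧ A.m 0 = B.m 0 := by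
  have hU := S.U_eq_int; have := S.Λ_le_int; have := S.sixteen_le_Λ_int
  have := hB.g_nonneg 0; have := hB.g_lt 0; have := hA.g_nonneg 0; have := hA.g_lt 0
  have hd := zero_lt_d S
  have hU0 : (0 : ℤ) < 4 * S.U := by linarith
  have hw := hA.window_zero
  have hBt := target_zero (S := S) (A := B)
  have hAt := target_zero (S := S) (A := A)
  have hx : A.x 0 = B.x 0 := by
    cases hBn : B.neg <;> simp only [hBn] at hBt <;> norm_num at hBt <;>
    exact le_antisymm
      (Int.le_of_mul_le_mul_add (P := 4 * S.U) (r := 2 * S.U + S.W) (by linarith) (by linarith) hU0)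
      (Int.le_of_mul_le_mul_add (P := 4 * S.U) (r := 2 * S.U + S.W) (by linarith) (by linarith) hU0)
  have hAf : A.first S 0 = 4 * S.U * A.x 0 + 2 * S.U := (first_of_lt hd).trans source_zero
  have hAs : A.finish S 0 = A.target S 0 := finish_of_lt hd
  unfold tilt at htilt
  have key : A.target S 0 = B.target S 0 := by
    cases hAn : A.neg
    · have hup := hA.up_zero.2 hAn
      rw [hi, max_eq_right hup.le, hAs] at h2
      rw [lo, min_eq_left hup.le, hAf] at h1
      simp only [hAn] at hAt
      cases hBn : B.neg
      · simp only [hBn] at hBt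
        rw [if_pos hup, if_pos (hB.up_zero.2 hBn)] at htilt
        norm_num at hAt hBt
        rw [hx] at hAt
        linarith
      · simp only [hBn] at hBt
        norm_num at hBt
        rw [hx] at h1
        linarith
    · have hup : ¬ A.first S 0 < A.finish S 0 := fun h => by simp [hA.up_zero.1 h] at hAn
      rw [hi, max_eq_left (not_lt.1 hup), hAf] at h2
      rw [lo, min_eq_right (not_lt.1 hup), hAs] at h1
      simp only [hAn] at hAt
      cases hBn : B.neg
      · simp only [hBn] at hBt
        norm_num at hBt
        rw [hx] at h2
        linarith
      · have hupB : ¬ B.first S 0 < B.finish S 0 := fun h => by simp [hB.up_zero.1 h] at hBn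
        simp only [hBn] at hBt
        rw [if_neg hup, if_neg hupB] at htilt
        norm_num at hAt hBt
        rw [hx] at hAt
        linarith
  exact hA.of_target_zero hB key

/-- If phase `k` of `A` reaches the line of phase `k + 1` of `B`, and the line extends to `A`, and
`B` is tilted no more than `A`, then the routes agree in all relevant data. -/
theorem Valid.turn (hA : A.Valid S) (hB : B.Valid S) {k : ℕ} (hkd : k < S.d)
    (hlat : ∀ l < S.d, l ≠ k → l ≠ (k + 1) % S.d → A.lat S k l = B.lat S (k + 1) l)
    (h1 : A.lo S k ≤ B.target S k) (h2 : B.target S k ≤ A.hi S k)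
    (h3 : B.lo S (k + 1) ≤ A.lat S k ((k + 1) % S.d))
    (h4 : A.lat S k ((k + 1) % S.d) ≤ B.hi S (k + 1)) (htilt : B.tilt S k ≤ A.tilt S k) :
    SameFamily S.d A B ∧ (∀ l < k + 1, (k + 1 = S.d → 1 ≤ l) → A.m l = B.m l) ∧
      ∀ l, k + 1 < l → l < S.d → A.dig l = B.dig l := by
  have hU := S.U_eq_int; have := S.Λ_le_int; have := S.sixteen_le_Λ_int
  have hd := S.three_le_d
  rcases Nat.lt_or_eq_of_le (Nat.succ_le_of_lt hkd) with hk1 | hk1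
  · -- turns between two inner axes
    have hk1' : k + 1 < S.d := hk1
    rw [Nat.mod_eq_of_lt hk1'] at hlat h3 h4
    have hgt : ∀ l, k + 1 < l → l < S.d → A.x l = B.x l ∧ A.dig l = B.dig l := fun l hl hld => by
      have h := hlat l (by omega) (by omega) (by omega)
      rw [lat, lat, if_neg (by omega), if_neg (by omega)] at h
      exact hA.of_source_pos hB (by omega) h
    have hlt : (A.ty = B.ty ∧ A.neg = B.neg) ∧ ∀ l < k + 1, A.x l = B.x l ∧ A.m l = B.m l := by
      rcases Nat.eq_zero_or_pos k with rfl | hk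
      · obtain ⟨hx, hty, hneg, hm⟩ := hA.turn_zero hB h1 h2 htilt
        refine ⟨⟨hty, hneg⟩, fun l hl => ?_⟩
        obtain rfl : l = 0 := by omega
        exact ⟨hx, hm⟩
      · have h0 := hlat 0 (by omega) (by omega) (by omega)
        rw [lat, lat, if_pos (by omega), if_pos (by omega)] at h0
        obtain ⟨hx0, hty, hneg, hm0⟩ := hA.of_target_zero hB h0
        refine ⟨⟨hty, hneg⟩, fun l hl => ?_⟩
        rcases Nat.eq_zero_or_pos l with rfl | hl0
        · exact ⟨hx0, hm0⟩
        rcases Nat.lt_or_eq_of_le (Nat.lt_succ_iff.1 hl) with hlk | rfl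
        · have h := hlat l (by omega) (by omega) (by omega)
          rw [lat, lat, if_pos (by omega), if_pos (by omega)] at h
          have h := hA.of_target_pos hB (by omega) h
          rw [shift_congr hty hneg] at h
          exact ⟨by linarith [h.1], h.2.2⟩
        · exact hA.turn_mid hB hk hkd hty hneg h1 h2 htilt
    obtain ⟨⟨hty, hneg⟩, hlt⟩ := hlt
    have hx1 : A.x (k + 1) = B.x (k + 1) := by
      have hw := hB.window_mid (k := k + 1) (by omega) hk1'
      have := hA.dig_nonneg (k + 1); have := hA.dig_lt (k + 1)
      rw [lat, if_neg (by omega), source_pos (by omega)] at h3 h4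
      have hU0 : (0 : ℤ) < 2 * S.U := by linarith
      rcases B.shift_eq (k + 1) with h | h <;> rw [h] at hw <;>
      exact le_antisymm
        (Int.le_of_mul_le_mul_add (P := 2 * S.U) (r := S.U + S.W) (by linarith) (by linarith) hU0)
        (Int.le_of_mul_le_mul_add (P := 2 * S.U) (r := S.U + S.W) (by linarith) (by linarith) hU0)
    refine ⟨⟨fun l hl => ?_, hty, hneg⟩, fun l hl _ => (hlt l hl).2,
      fun l hl hld => (hgt l hl hld).2⟩
    rcases lt_trichotomy l (k + 1) with h | rfl | h
    · exact (hlt l h).1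
    · exact hx1
    · exact (hgt l h hl).1
  · -- the turn into the last phase
    have hk1' : k + 1 = S.d := hk1
    rw [hk1', Nat.mod_self] at hlat h3 h4
    rw [hk1']
    have hlt : ∀ l, 1 ≤ l → l < k → A.x l - A.shift l = B.x l - B.shift l ∧ A.ty = B.ty ∧
        A.m l = B.m l := fun l hl hlk => by
      have h := hlat l (by omega) (by omega) (by omega)
      rw [lat, lat, if_pos (by omega), if_pos (by omega)] at h
      exact hA.of_target_pos hB (by omega) h
    have hty := (hlt 1 le_rfl (by omega)).2.1
    rw [lat, if_pos (by omega), target_zero] at h3 h4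
    have hw := hB.window_last
    have := hA.g_nonneg 0; have := hA.g_lt 0
    have hU0 : (0 : ℤ) < 4 * S.U := by linarith
    have hnx : A.neg = B.neg ∧ A.x 0 = B.x 0 := by
      by_cases ht : B.ty = 0
      · simp only [if_pos ht] at hw
        cases hAn : A.neg <;> cases hBn : B.neg <;> simp [hAn, hBn] at hw h3 h4 ⊢
        · exact le_antisymm
            (Int.le_of_mul_le_mul_add (P := 4 * S.U) (r := S.U + S.W)
              (by linarith) (by linarith) hU0)
            (Int.le_of_mul_le_mul_add (P := 4 * S.U) (r := S.U + S.W)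
              (by linarith) (by linarith) hU0)
        · have ha : A.x 0 + 1 ≤ B.x 0 := Int.le_of_mul_le_mul_add (P := 4 * S.U)
            (r := 2 * S.U + S.W) (by linarith) (by linarith) hU0
          have hb : B.x 0 ≤ A.x 0 := Int.le_of_mul_le_mul_add (P := 4 * S.U)
            (r := 3 * S.U + S.W) (by linarith) (by linarith) hU0
          linarith
        · have ha : A.x 0 ≤ B.x 0 := Int.le_of_mul_le_mul_add (P := 4 * S.U)
            (r := 3 * S.U) (by linarith) (by linarith) hU0
          have hb : B.x 0 + 1 ≤ A.x 0 := Int.le_of_mul_le_mul_add (P := 4 * S.U)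
            (r := 2 * S.U + S.W) (by linarith) (by linarith) hU0
          linarith
        · exact le_antisymm
            (Int.le_of_mul_le_mul_add (P := 4 * S.U) (r := S.U + S.W)
              (by linarith) (by linarith) hU0)
            (Int.le_of_mul_le_mul_add (P := 4 * S.U) (r := S.U + S.W)
              (by linarith) (by linarith) hU0)
      · simp only [if_neg ht] at hw
        cases hAn : A.neg <;> cases hBn : B.neg <;> simp [hAn, hBn] at hw h3 h4 ⊢
        · exact le_antisymm
            (Int.le_of_mul_le_mul_add (P := 4 * S.U) (r := S.U + S.W)
              (by linarith) (by linarith) hU0)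
            (Int.le_of_mul_le_mul_add (P := 4 * S.U) (r := S.U + S.W)
              (by linarith) (by linarith) hU0)
        · have ha : A.x 0 + 1 ≤ B.x 0 := Int.le_of_mul_le_mul_add (P := 4 * S.U)
            (r := 3 * S.U) (by linarith) (by linarith) hU0
          have hb : B.x 0 ≤ A.x 0 := Int.le_of_mul_le_mul_add (P := 4 * S.U)
            (r := 2 * S.U + S.W) (by linarith) (by linarith) hU0
          linarith
        · have ha : A.x 0 ≤ B.x 0 := Int.le_of_mul_le_mul_add (P := 4 * S.U)
            (r := 2 * S.U + S.W) (by linarith) (by linarith) hU0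
          have hb : B.x 0 + 1 ≤ A.x 0 := Int.le_of_mul_le_mul_add (P := 4 * S.U)
            (r := 3 * S.U + S.W) (by linarith) (by linarith) hU0
          linarith
        · exact le_antisymm
            (Int.le_of_mul_le_mul_add (P := 4 * S.U) (r := S.U + S.W)
              (by linarith) (by linarith) hU0)
            (Int.le_of_mul_le_mul_add (P := 4 * S.U) (r := S.U + S.W)
              (by linarith) (by linarith) hU0)
    obtain ⟨hneg, hx0⟩ := hnx
    obtain ⟨hxk, hmk⟩ := hA.turn_mid hB (k := k) (by omega) hkd hty hneg h1 h2 htilt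
    refine ⟨⟨fun l hl => ?_, hty, hneg⟩, fun l hl hl0 => ?_, fun l hl hld => by omega⟩
    · rcases Nat.eq_zero_or_pos l with rfl | hl0
      · exact hx0
      rcases Nat.lt_or_eq_of_le (show l ≤ k by omega) with hlk | rfl
      · have h := (hlt l hl0 hlk).1
        rw [shift_congr hty hneg] at h
        linarith
      · exact hxk
    · rcases Nat.lt_or_eq_of_le (show l ≤ k by omega) with hlk | rfl
      · exact (hlt l (hl0 rfl) hlk).2.2
      · exact hmk

end Strand

/-! ### The boxes of a route -/

/-- The boxes of a route: the `hub` is the box of the vertex, the `arm` is attached to it, and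
`run k r` is the `r`-th box of phase `k`. -/
inductive RoutePart
  | hub
  | arm
  | run (k r : ℕ)

namespace RoutePart

/-- The phase to which a box belongs; the boxes near the vertex are counted to phase `0`. -/
def phase : RoutePart → ℕ
  | hub => 0
  | arm => 0
  | run k _ => k

/-- A route has the phases `0, …, d`, with `q + 1` boxes each. -/
def Valid (S : Scale) : RoutePart → Prop
  | hub => True
  | arm => True
  | run k r => k ≤ S.d ∧ r ≤ S.q

end RoutePart

namespace Strand

variable (S : Scale) (A B : Strand)

/-- The position, along the axis of phase `k`, of the corner of its first box. -/
def startPos (k : ℕ) : ℤ :=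
  if A.first S k < A.finish S k then 16 * A.first S k + 1 else 16 * A.first S k + 9 - S.Λ

/-- The position, along the axis of phase `k`, of the corner of its last box. -/
def endPos (k : ℕ) : ℤ :=
  if A.first S k < A.finish S k then 16 * A.finish S k + 4 - S.Λ else 16 * A.finish S k

/-- The boxes of a phase are equally spaced. -/
noncomputable def along : RoutePart → ℝ
  | .run k r => A.startPos S k + (A.endPos S k - A.startPos S k : ℝ) * (r / S.q)
  | _ => 16 * A.source S 0

/-- The value for the lane of the route, among the values for the three lanes. -/
def pick (a b c : ℤ) : ℤ := if A.lane = 0 then a else if A.lane = 1 then b else c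

/-- Displacement of a box from its lattice line in direction `l`, in tenths of a unit and without
the tilt. In phase `k` the two axes that follow axis `k` play a special role: two consecutive phases
`k`, `k + 1` are displaced by `0` and by `1` along axis `k + 2`, so that they just touch there.

In phase `0` the axes `1` and `2` serve to separate the lanes: the arms of the three lanes touch the
hub, the first box of a lane touches its arm and the next box of the lane, and there are no other
contacts between these boxes. -/
def offTen : RoutePart → ℕ → ℤ
  | .hub, l => if l = 1 then 50 else if l = 2 then -15 else -8
  | .arm, l => if l = 1 then A.pick 60 45 40 else if l = 2 then A.pick (-18) (-6) (-18) else -8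
  | .run k r, l =>
    if k = 0 then
      if l = 1 then (if r = 0 then A.pick 70 53 30 else A.pick 80 57 20)
      else if l = 2 then (if r = 0 then A.pick (-8) 3 (-8) else 0) else -8
    else if l = (k + 1) % S.d then 10 else if l = (k + 2) % S.d ∧ k < S.d then 0 else -8

/-- The tilt of a box: phases `k` and `k + 1` are both tilted by `tilt k` along axis `k + 2`. -/
def offTilt : RoutePart → ℕ → ℤ
  | .run k r, l =>
    if k = 0 then (if l = 2 ∧ r ≠ 0 then A.tilt S 0 else 0)
    else if l = (k + 1) % S.d then A.tilt S (k - 1)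
    else if l = (k + 2) % S.d ∧ k < S.d then A.tilt S k else 0
  | _, _ => 0

/-- The displacement; the tilts contribute at most a tenth of a unit. -/
noncomputable def off (P : RoutePart) (l : ℕ) : ℝ :=
  (A.offTen S P l + (A.offTilt S P l : ℝ) / S.W) / 10

/-- The corner of a box. -/
noncomputable def corner (P : RoutePart) (l : ℕ) : ℝ :=
  if l = P.phase % S.d then A.along S P else 16 * A.lat S P.phase l + A.off S P l

/-- The boxes of `A` and `B` named `P` and `Q` intersect. -/
def Meet (P : RoutePart) (B : Strand) (Q : RoutePart) : Prop := ∀ l < S.d,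
  A.corner S P l ≤ B.corner S Q l + (if l = Q.phase % S.d then S.L else 1) ∧
  B.corner S Q l ≤ A.corner S P l + (if l = P.phase % S.d then S.L else 1)

end Strand

namespace Strand

variable {S : Scale} {A B : Strand} {P Q : RoutePart}

theorem Meet.symm (h : A.Meet S P B Q) : B.Meet S Q A P := fun l hl => (h l hl).symm

theorem Meet.lat_eq' (h : A.Meet S P B Q) {l : ℕ} (hl : l < S.d) (hP : l ≠ P.phase % S.d)
    (hQ : l ≠ Q.phase % S.d) :
    16 * (A.lat S P.phase l : ℝ) + A.off S P l ≤ 16 * B.lat S Q.phase l + B.off S Q l + 1 ∧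
    16 * (B.lat S Q.phase l : ℝ) + B.off S Q l ≤ 16 * A.lat S P.phase l + A.off S P l + 1 := by
  have := h l hl
  rwa [corner, corner, if_neg hP, if_neg hQ, if_neg hP, if_neg hQ] at this

theorem Meet.parallel (h : A.Meet S P B Q) (hPQ : P.phase % S.d = Q.phase % S.d) :
    A.along S P ≤ B.along S Q + S.L ∧ B.along S Q ≤ A.along S P + S.L := by
  have := h (P.phase % S.d) (Nat.mod_lt _ (zero_lt_d S))
  rwa [corner, corner, if_pos rfl, if_pos hPQ, if_pos rfl, if_pos hPQ] at this

theorem Meet.cross (h : A.Meet S P B Q) (hPQ : P.phase % S.d ≠ Q.phase % S.d) :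
    A.along S P ≤ 16 * B.lat S Q.phase (P.phase % S.d) + B.off S Q (P.phase % S.d) + 1 ∧
    16 * (B.lat S Q.phase (P.phase % S.d) : ℝ) + B.off S Q (P.phase % S.d) ≤
      A.along S P + S.L := by
  have := h (P.phase % S.d) (Nat.mod_lt _ (zero_lt_d S))
  rwa [corner, corner, if_pos rfl, if_neg hPQ, if_pos rfl, if_neg hPQ] at this

theorem W_pos (S : Scale) : (0 : ℝ) < S.W := by
  have h1 := S.Λ_le
  have h2 := S.sixteen_le_Λ
  have : 0 < S.W := by omega
  exact_mod_cast this

theorem Λ_bounds (S : Scale) : (16 : ℝ) ≤ S.Λ ∧ (S.Λ : ℝ) ≤ S.L ∧ S.L < S.Λ + 1 :=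
  ⟨by exact_mod_cast S.sixteen_le_Λ, S.Λ_le_L, S.L_lt⟩

theorem Valid.tilt_bounds (hA : A.Valid S) (k : ℕ) : 0 ≤ A.tilt S k ∧ A.tilt S k ≤ S.W := by
  have h1 := hA.g_nonneg k
  have h2 := hA.g_lt k
  unfold tilt
  split_ifs <;> constructor <;> linarith

theorem Valid.offTilt_bounds (hA : A.Valid S) (P : RoutePart) (l : ℕ) :
    0 ≤ A.offTilt S P l ∧ A.offTilt S P l ≤ S.W := by
  have hW : (0 : ℤ) ≤ S.W := by positivity
  unfold offTilt
  split
  · split_ifs <;> first | exact hA.tilt_bounds _ | exact ⟨le_rfl, hW⟩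
  · exact ⟨le_rfl, hW⟩

theorem Valid.off_bounds (hA : A.Valid S) (P : RoutePart) (l : ℕ) :
    (A.offTen S P l : ℝ) / 10 ≤ A.off S P l ∧ A.off S P l ≤ A.offTen S P l / 10 + 1 / 10 := by
  have hW := W_pos S
  have h := hA.offTilt_bounds P l
  have h1 : (0 : ℝ) ≤ A.offTilt S P l := by exact_mod_cast h.1
  have h2 : (A.offTilt S P l : ℝ) ≤ S.W := by exact_mod_cast h.2
  have h3 : (0 : ℝ) ≤ A.offTilt S P l / S.W := by positivity
  have h4 : (A.offTilt S P l : ℝ) / S.W ≤ 1 := (div_le_one hW).2 h2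
  unfold off
  constructor <;> linarith

theorem offTen_bounds (P : RoutePart) (l : ℕ) : -18 ≤ A.offTen S P l ∧ A.offTen S P l ≤ 80 := by
  unfold offTen pick
  split <;> split_ifs <;> norm_num

theorem off_eq_of_tilt_zero {l : ℕ} (h : A.offTilt S P l = 0) :
    A.off S P l = A.offTen S P l / 10 := by
  simp [off, h]

theorem Valid.off_range (hA : A.Valid S) (P : RoutePart) (l : ℕ) :
    -(18 / 10) ≤ A.off S P l ∧ A.off S P l ≤ 81 / 10 := by
  have h1 := hA.off_bounds P l
  have h2 := offTen_bounds (S := S) (A := A) P l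
  have h3 : (-18 : ℝ) ≤ A.offTen S P l := by exact_mod_cast h2.1
  have h4 : (A.offTen S P l : ℝ) ≤ 80 := by exact_mod_cast h2.2
  constructor <;> linarith

/-- Boxes that intersect lie on the same lattice hyperplanes perpendicular to both of their axes. -/
theorem Meet.lat_eq (hA : A.Valid S) (hB : B.Valid S) (h : A.Meet S P B Q) {l : ℕ} (hl : l < S.d)
    (hP : l ≠ P.phase % S.d) (hQ : l ≠ Q.phase % S.d) :
    A.lat S P.phase l = B.lat S Q.phase l ∧ A.off S P l ≤ B.off S Q l + 1 ∧
      B.off S Q l ≤ A.off S P l + 1 := by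
  have h1 := h.lat_eq' hl hP hQ
  have h2 := hA.off_range P l
  have h3 := hB.off_range Q l
  have h4 : A.lat S P.phase l < B.lat S Q.phase l + 1 := by
    have : (A.lat S P.phase l : ℝ) < B.lat S Q.phase l + 1 := by linarith
    exact_mod_cast this
  have h5 : B.lat S Q.phase l < A.lat S P.phase l + 1 := by
    have : (B.lat S Q.phase l : ℝ) < A.lat S P.phase l + 1 := by linarith
    exact_mod_cast this
  have h6 : A.lat S P.phase l = B.lat S Q.phase l := by omega
  rw [h6] at h1
  exact ⟨h6, by linarith, by linarith⟩

/-- In an upward phase consecutive boxes are moved by a fixed step between `4 / 5 Λ` and `Λ`. -/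
theorem Valid.along_up (hA : A.Valid S) {k : ℕ} (hk : k ≤ S.d) (hup : A.first S k < A.finish S k) :
    ∃ δ : ℝ, 4 / 5 * S.Λ ≤ δ ∧ δ ≤ S.Λ ∧ ∀ r : ℕ,
      A.along S (.run k r) = 16 * A.first S k + 1 + δ * r ∧
      A.along S (.run k r) = 16 * A.finish S k + 4 - S.Λ - δ * (S.q - r) := by
  have hq : (0 : ℝ) < S.q := by exact_mod_cast S.q_pos
  have hl := hA.length_bounds hk
  rw [hi, lo, max_eq_right hup.le, min_eq_left hup.le] at hl
  have hl1 : (S.U : ℝ) - S.W ≤ A.finish S k - A.first S k := by exact_mod_cast hl.1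
  have hl2 : (A.finish S k - A.first S k : ℝ) ≤ S.U + S.W := by exact_mod_cast hl.2
  have hs : (16 * S.U + 16 * S.W + 2 * S.Λ : ℝ) ≤ S.q * S.Λ := by exact_mod_cast S.step_le
  have hs' : (4 * (S.q * S.Λ) + 80 * S.W + 10 * S.Λ : ℝ) ≤ 80 * S.U := by exact_mod_cast S.le_step
  have hΛ := (Λ_bounds S).1
  refine ⟨(A.endPos S k - A.startPos S k) / S.q, ?_, ?_, fun r => ?_⟩
  · rw [le_div_iff₀ hq, endPos, startPos, if_pos hup, if_pos hup]
    push_cast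
    linarith
  · rw [div_le_iff₀ hq, endPos, startPos, if_pos hup, if_pos hup]
    push_cast
    linarith
  · rw [along, endPos, startPos, if_pos hup, if_pos hup]
    push_cast
    exact ⟨by field_simp, by field_simp; ring⟩

theorem Valid.along_down (hA : A.Valid S) {k : ℕ} (hk : k ≤ S.d)
    (hup : ¬ A.first S k < A.finish S k) :
    ∃ δ : ℝ, 4 / 5 * S.Λ ≤ δ ∧ δ ≤ S.Λ ∧ ∀ r : ℕ,
      A.along S (.run k r) = 16 * A.first S k + 9 - S.Λ - δ * r ∧
      A.along S (.run k r) = 16 * A.finish S k + δ * (S.q - r) := by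
  have hq : (0 : ℝ) < S.q := by exact_mod_cast S.q_pos
  have hl := hA.length_bounds hk
  rw [hi, lo, max_eq_left (not_lt.1 hup), min_eq_right (not_lt.1 hup)] at hl
  have hl1 : (S.U : ℝ) - S.W ≤ A.first S k - A.finish S k := by exact_mod_cast hl.1
  have hl2 : (A.first S k - A.finish S k : ℝ) ≤ S.U + S.W := by exact_mod_cast hl.2
  have hs : (16 * S.U + 16 * S.W + 2 * S.Λ : ℝ) ≤ S.q * S.Λ := by exact_mod_cast S.step_le
  have hs' : (4 * (S.q * S.Λ) + 80 * S.W + 10 * S.Λ : ℝ) ≤ 80 * S.U := by exact_mod_cast S.le_step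
  have hΛ := (Λ_bounds S).1
  refine ⟨(A.startPos S k - A.endPos S k) / S.q, ?_, ?_, fun r => ?_⟩
  · rw [le_div_iff₀ hq, endPos, startPos, if_neg hup, if_neg hup]
    push_cast
    linarith
  · rw [div_le_iff₀ hq, endPos, startPos, if_neg hup, if_neg hup]
    push_cast
    linarith
  · rw [along, endPos, startPos, if_neg hup, if_neg hup]
    push_cast
    constructor <;> (field_simp; ring)

/-- A box of a phase does not leave the range of the phase by more than a few units. -/
theorem Valid.along_bounds (hA : A.Valid S) {k r : ℕ} (hk : k ≤ S.d) (hr : r ≤ S.q) :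
    16 * (A.lo S k : ℝ) ≤ A.along S (.run k r) ∧
      A.along S (.run k r) + S.L ≤ 16 * A.hi S k + 10 ∧
      (A.first S k < A.finish S k → A.along S (.run k r) + S.L ≤ 16 * A.hi S k + 5) := by
  have hr' : (0 : ℝ) ≤ S.q - r := by
    have : (r : ℝ) ≤ S.q := by exact_mod_cast hr
    linarith
  have hr0 : (0 : ℝ) ≤ r := by positivity
  obtain ⟨hΛ, hL, hL'⟩ := Λ_bounds S
  by_cases hup : A.first S k < A.finish S k
  · obtain ⟨δ, h1, h2, h3⟩ := hA.along_up hk hup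
    obtain ⟨h3, h4⟩ := h3 r
    have e1 : 0 ≤ δ * r := mul_nonneg (by linarith) hr0
    have e2 : 0 ≤ δ * (S.q - r) := mul_nonneg (by linarith) hr'
    rw [lo, hi, min_eq_left hup.le, max_eq_right hup.le]
    exact ⟨by linarith, by linarith, fun _ => by linarith⟩
  · obtain ⟨δ, h1, h2, h3⟩ := hA.along_down hk hup
    obtain ⟨h3, h4⟩ := h3 r
    have e1 : 0 ≤ δ * r := mul_nonneg (by linarith) hr0
    have e2 : 0 ≤ δ * (S.q - r) := mul_nonneg (by linarith) hr'
    rw [lo, hi, min_eq_right (not_lt.1 hup), max_eq_left (not_lt.1 hup)]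
    exact ⟨by linarith, by linarith, fun h => absurd h hup⟩

/-- The boxes at the start of a route stay near the level of the vertex. -/
theorem Valid.along_zero_bounds (hA : A.Valid S) (hP : P = .hub ∨ P = .arm ∨ P = .run 0 0) :
    16 * (A.source S 0 : ℝ) + 9 - S.Λ ≤ A.along S P ∧ A.along S P ≤ 16 * A.source S 0 + 1 := by
  have hΛ := (Λ_bounds S).1
  have hf : A.first S 0 = A.source S 0 := first_of_lt (zero_lt_d S)
  rcases hP with rfl | rfl | rfl
  · simp only [along]
    constructor <;> linarith
  · simp only [along]
    constructor <;> linarith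
  · rw [← hf]
    by_cases hup : A.first S 0 < A.finish S 0
    · obtain ⟨δ, -, -, h⟩ := hA.along_up (Nat.zero_le _) hup
      rw [(h 0).1]
      exact ⟨by simp; linarith, by simp⟩
    · obtain ⟨δ, -, -, h⟩ := hA.along_down (Nat.zero_le _) hup
      rw [(h 0).1]
      exact ⟨by simp, by simp; linarith⟩

/-- A box of phase `k` that intersects a line perpendicular to it: the line is in range. -/
theorem Valid.mem_span (hA : A.Valid S) {k r : ℕ} (hk : k ≤ S.d) (hr : r ≤ S.q) {c : ℤ} {o : ℝ}
    (ho : -(18 / 10) ≤ o) (ho' : o ≤ 81 / 10) (h1 : A.along S (.run k r) ≤ 16 * c + o + 1)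
    (h2 : 16 * c + o ≤ A.along S (.run k r) + S.L) : A.lo S k ≤ c ∧ c ≤ A.hi S k := by
  obtain ⟨h3, h4, -⟩ := hA.along_bounds hk hr
  have h5 : A.lo S k < c + 1 := by
    have : (A.lo S k : ℝ) < c + 1 := by linarith
    exact_mod_cast this
  have h6 : c < A.hi S k + 1 := by
    have : (c : ℝ) < A.hi S k + 1 := by linarith
    exact_mod_cast this
  exact ⟨by omega, by omega⟩

theorem Meet.span (hA : A.Valid S) (hB : B.Valid S) {k r r' : ℕ} (hk : k ≤ S.d) (hr : r ≤ S.q)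
    (hr' : r' ≤ S.q) (h : A.Meet S (.run k r) B (.run k r')) :
    A.lo S k ≤ B.hi S k ∧ B.lo S k ≤ A.hi S k := by
  have h1 := h.parallel rfl
  obtain ⟨h2, h3, -⟩ := hA.along_bounds hk hr
  obtain ⟨h4, h5, -⟩ := hB.along_bounds hk hr'
  have h6 : A.lo S k < B.hi S k + 1 := by
    have : (A.lo S k : ℝ) < B.hi S k + 1 := by linarith
    exact_mod_cast this
  have h7 : B.lo S k < A.hi S k + 1 := by
    have : (B.lo S k : ℝ) < A.hi S k + 1 := by linarith
    exact_mod_cast this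
  exact ⟨by omega, by omega⟩

theorem Valid.along_phase_zero (hA : A.Valid S) (hP : P.Valid S) (h0 : P.phase = 0) :
    16 * (A.lo S 0 : ℝ) + 9 - S.Λ ≤ A.along S P ∧ A.along S P + S.L ≤ 16 * A.hi S 0 + 2 + S.Λ := by
  obtain ⟨hΛ, hL, hL'⟩ := Λ_bounds S
  have hlo : A.lo S 0 ≤ A.source S 0 := by
    rw [← first_of_lt (zero_lt_d S)]; exact min_le_left _ _
  have hhi : A.source S 0 ≤ A.hi S 0 := by
    rw [← first_of_lt (zero_lt_d S)]; exact le_max_left _ _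
  have hlo' : (A.lo S 0 : ℝ) ≤ A.source S 0 := by exact_mod_cast hlo
  have hhi' : (A.source S 0 : ℝ) ≤ A.hi S 0 := by exact_mod_cast hhi
  match P, h0, hP with
  | .hub, _, _ =>
    have := hA.along_zero_bounds (P := .hub) (by simp)
    constructor <;> linarith
  | .arm, _, _ =>
    have := hA.along_zero_bounds (P := .arm) (by simp)
    constructor <;> linarith
  | .run 0 r, _, hP =>
    have := hA.along_bounds hP.1 hP.2
    constructor <;> linarith

theorem Meet.span_zero (hA : A.Valid S) (hB : B.Valid S) (hP : P.Valid S) (hQ : Q.Valid S)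
    (hP0 : P.phase = 0) (hQ0 : Q.phase = 0) (h : A.Meet S P B Q) :
    A.lo S 0 ≤ B.hi S 0 + S.Λ ∧ B.lo S 0 ≤ A.hi S 0 + S.Λ := by
  have h1 := h.parallel (by rw [hP0, hQ0])
  have h2 := hA.along_phase_zero hP hP0
  have h3 := hB.along_phase_zero hQ hQ0
  obtain ⟨hΛ, hL, hL'⟩ := Λ_bounds S
  have h6 : A.lo S 0 < B.hi S 0 + S.Λ + 1 := by
    have : (A.lo S 0 : ℝ) < B.hi S 0 + S.Λ + 1 := by linarith
    exact_mod_cast this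
  have h7 : B.lo S 0 < A.hi S 0 + S.Λ + 1 := by
    have : (B.lo S 0 : ℝ) < A.hi S 0 + S.Λ + 1 := by linarith
    exact_mod_cast this
  exact ⟨by omega, by omega⟩

/-! ### Which boxes intersect -/

theorem succ_mod_ne {d k : ℕ} (hd : 2 ≤ d) : (k + 1) % d ≠ k % d := by
  intro h
  have h2 : (k + 1) ≡ k + 0 [MOD d] := h
  have h3 := (Nat.ModEq.add_left_cancel' k h2)
  have : (1 : ℕ) % d = 0 % d := h3
  rw [Nat.mod_eq_of_lt (by omega), Nat.zero_mod] at this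
  omega

theorem add_two_mod_ne {d k : ℕ} (hd : 3 ≤ d) : (k + 2) % d ≠ k % d := by
  intro h
  have h2 : (k + 2) ≡ k + 0 [MOD d] := h
  have h3 := (Nat.ModEq.add_left_cancel' k h2)
  have : (2 : ℕ) % d = 0 % d := h3
  rw [Nat.mod_eq_of_lt (by omega), Nat.zero_mod] at this
  omega

/-- The axis that follows the axis of a phase `k ≥ 1`. -/
theorem off_next {k r : ℕ} (hk : k ≠ 0) : A.offTen S (.run k r) ((k + 1) % S.d) = 10 ∧
    A.offTilt S (.run k r) ((k + 1) % S.d) = A.tilt S (k - 1) := by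
  simp [offTen, offTilt, hk]

theorem off_next_next {k r : ℕ} (hk : k < S.d) (hr : k = 0 → r ≠ 0) :
    A.offTen S (.run k r) ((k + 2) % S.d) = 0 ∧
    A.offTilt S (.run k r) ((k + 2) % S.d) = A.tilt S k := by
  have hd := S.three_le_d
  rcases Nat.eq_zero_or_pos k with rfl | hk0
  · have h2 : 2 % S.d = 2 := Nat.mod_eq_of_lt (by omega)
    simp [offTen, offTilt, h2, hr rfl]
  · have h1 : ¬ k = 0 := by omega
    have h2 : (k + 2) % S.d ≠ (k + 1) % S.d := succ_mod_ne (k := k + 1) (by omega)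
    simp [offTen, offTilt, h1, h2, hk]

/-- Along all axes except those that follow its own, the boxes are displaced alike. -/
theorem off_other {l : ℕ} (h1 : l ≠ (P.phase + 1) % S.d)
    (h2 : l ≠ (P.phase + 2) % S.d ∨ P.phase = S.d) : A.off S P l = -(8 / 10) := by
  have hd := S.three_le_d
  have e1 : 1 % S.d = 1 := Nat.mod_eq_of_lt (by omega)
  have e2 : 2 % S.d = 2 := Nat.mod_eq_of_lt (by omega)
  have hd0 : (0 : ℕ) ≠ S.d := by omega
  have key : A.offTen S P l = -8 ∧ A.offTilt S P l = 0 := by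
    match P with
    | .hub => simp_all [offTen, offTilt, RoutePart.phase]
    | .arm => simp_all [offTen, offTilt, RoutePart.phase]
    | .run k r =>
      simp only [RoutePart.phase] at h1 h2
      rcases Nat.eq_zero_or_pos k with rfl | hk
      · simp_all [offTen, offTilt]
      · have h3 : ¬ k = 0 := by omega
        have h4 : ¬ (l = (k + 2) % S.d ∧ k < S.d) := fun h => by
          rcases h2 with h2 | h2
          · exact h2 h.1
          · omega
        simp [offTen, offTilt, h3, h1, h4]
  rw [off_eq_of_tilt_zero key.2, key.1]
  norm_num

/-- Boxes of phases with non-adjacent axes, or with adjacent axes but not consecutive, are disjoint.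
-/
theorem Meet.phase_le (hA : A.Valid S) (hB : B.Valid S) (hP : P.Valid S) (hQ : Q.Valid S)
    (h : A.Meet S P B Q) : Q.phase ≤ P.phase + 1 := by
  by_contra hlt
  have hd := S.three_le_d
  set k := P.phase with hk
  obtain ⟨k', r', rfl⟩ : ∃ k' r', Q = .run k' r' := by
    rcases Q with _ | _ | ⟨k', r'⟩
    · simp [RoutePart.phase] at hlt
    · simp [RoutePart.phase] at hlt
    · exact ⟨k', r', rfl⟩
  have hk'd : k' ≤ S.d := hQ.1
  simp only [RoutePart.phase] at hlt
  have hk'0 : k' ≠ 0 := by omega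
  have hmk : k % S.d = k := Nat.mod_eq_of_lt (by omega)
  -- the axis after the one of the later phase separates, unless it is one of the first two
  by_cases h0 : k' + 1 = S.d ∧ k = 0
  · -- phases `d - 1` and `0`: the lanes of phase `0` are away from the lattice lines on axis `1`
    have e1 : k' % S.d = k' := Nat.mod_eq_of_lt (by omega)
    have hne1 : 1 ≠ k % S.d := by rw [hmk]; omega
    have hne2 : 1 ≠ (RoutePart.run k' r').phase % S.d := by
      simp only [RoutePart.phase]; rw [e1]; omega
    have h1 := (h.lat_eq hA hB (l := 1) (by omega) hne1 hne2).2.1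
    have h2 : (k' + 2) % S.d = 1 := by
      rw [show k' + 2 = 1 + S.d by omega, Nat.add_mod_right, Nat.mod_eq_of_lt (by omega)]
    have h3 := off_next_next (A := B) (S := S) (k := k') (r := r') (by omega) (by omega)
    rw [h2] at h3
    have h4 := hB.off_bounds (.run k' r') 1
    rw [h3.1] at h4
    have h5 : (20 : ℤ) ≤ A.offTen S P 1 := by
      match P, hk.symm.trans h0.2 with
      | .hub, _ => simp [offTen]
      | .arm, _ => simp only [offTen, pick]; split_ifs <;> norm_num
      | .run 0 r, _ => simp only [offTen, pick]; split_ifs <;> norm_num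
    have h6 : (20 : ℝ) ≤ A.offTen S P 1 := by exact_mod_cast h5
    have h7 := hA.off_bounds P 1
    push_cast at h4
    linarith
  by_cases h1 : k' = S.d ∧ k = 0
  · -- phases `d` and `0`: vertices and intermediate positions have different coordinates
    have e1 : k' % S.d = 0 := by rw [h1.1, Nat.mod_self]
    have hne1 : 1 ≠ k % S.d := by rw [hmk]; omega
    have hne2 : 1 ≠ (RoutePart.run k' r').phase % S.d := by
      simp only [RoutePart.phase]; rw [e1]; omega
    have h2 := (h.lat_eq hA hB (l := 1) (by omega) hne1 hne2).1
    rw [lat, lat, ← hk, if_neg (by omega), if_pos (by simp only [RoutePart.phase]; omega)] at h2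
    exact hA.source_ne_target hB one_ne_zero h2
  by_cases h2 : k' = S.d ∧ k = 1
  · -- phases `d` and `1` are separated on axis `2`
    have e1 : k' % S.d = 0 := by rw [h2.1, Nat.mod_self]
    have hne1 : 2 ≠ k % S.d := by rw [hmk]; omega
    have hne2 : 2 ≠ (RoutePart.run k' r').phase % S.d := by
      simp only [RoutePart.phase]; rw [e1]; omega
    have h3 := (h.lat_eq hA hB (l := 2) (by omega) hne1 hne2).2.1
    have hoQ : B.off S (.run k' r') 2 = -(8 / 10) := by
      refine off_other ?_ (Or.inr h2.1)
      simp only [RoutePart.phase]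
      rw [h2.1, Nat.add_mod_left, Nat.mod_eq_of_lt (by omega)]
      norm_num
    obtain ⟨r, rfl⟩ : ∃ r, P = .run 1 r := by
      match P, hk.symm.trans h2.2 with
      | .run 1 r, _ => exact ⟨r, rfl⟩
    have h4 := off_next (A := A) (S := S) (k := 1) (r := r) (by omega)
    rw [show (1 + 1) % S.d = 2 from Nat.mod_eq_of_lt (by omega)] at h4
    have h5 := hA.off_bounds (.run 1 r) 2
    rw [h4.1] at h5
    push_cast at h5
    linarith
  · have hl := Nat.mod_lt (k' + 1) (zero_lt_d S)
    have key : ∀ j, j < 3 → (k' + 1) % S.d ≠ (k + j) % S.d := by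
      intro j hj hcon
      have hm : k' + 1 = k + j ∨ k' + 1 = k + j + S.d := by
        have h3 : (k + j) ≡ (k' + 1) [MOD S.d] := hcon.symm
        rw [Nat.modEq_iff_dvd] at h3
        obtain ⟨c, hc⟩ := h3
        push_cast at hc
        have hc0 : 0 < (S.d : ℤ) * c := by omega
        have hc1 : 0 < c := by
          by_contra hcn
          nlinarith
        have hc2 : c < 2 := by
          by_contra hcn
          nlinarith
        obtain rfl : c = 1 := by omega
        right
        omega
      omega
    have hne1 : (k' + 1) % S.d ≠ k % S.d := key 0 (by omega)
    have hne2 : (k' + 1) % S.d ≠ (RoutePart.run k' r').phase % S.d := succ_mod_ne (by omega)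
    have h3 := (h.lat_eq hA hB hl hne1 hne2).2.2
    have h4 : A.off S P ((k' + 1) % S.d) = -(8 / 10) :=
      off_other (key 1 (by omega)) (Or.inl (key 2 (by omega)))
    have h5 := off_next (A := B) (S := S) (k := k') (r := r') hk'0
    have h6 := hB.off_bounds (.run k' r') ((k' + 1) % S.d)
    rw [h5.1] at h6
    push_cast at h6
    linarith

/-- Intersecting boxes of consecutive phases: the first one is tilted at least as much, and each one
reaches the line of the other. -/
theorem Meet.turn (hA : A.Valid S) (hB : B.Valid S) {k r r' : ℕ} (hk : k < S.d)
    (hr : r ≤ S.q) (hr' : r' ≤ S.q) (h0 : k = 0 → r ≠ 0)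
    (h : A.Meet S (.run k r) B (.run (k + 1) r')) :
    SameFamily S.d A B ∧ (∀ l < k + 1, (k + 1 = S.d → 1 ≤ l) → A.m l = B.m l) ∧
      ∀ l, k + 1 < l → l < S.d → A.dig l = B.dig l := by
  have hd := S.three_le_d
  have hkm : k % S.d = k := Nat.mod_eq_of_lt hk
  have hne : k % S.d ≠ (k + 1) % S.d := (succ_mod_ne (by omega)).symm
  have hlat : ∀ l < S.d, l ≠ k → l ≠ (k + 1) % S.d → A.lat S k l = B.lat S (k + 1) l :=
    fun l hl h1 h2 => (h.lat_eq hA hB hl (by simpa [RoutePart.phase, hkm] using h1) h2).1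
  have hc1 := h.cross hne
  have hc2 := h.symm.cross hne.symm
  simp only [RoutePart.phase, hkm] at hc1 hc2
  have ho1 := hB.off_range (.run (k + 1) r') k
  have ho2 := hA.off_range (.run k r) ((k + 1) % S.d)
  obtain ⟨s1, s2⟩ := hA.mem_span hk.le hr ho1.1 ho1.2 hc1.1 hc1.2
  obtain ⟨s3, s4⟩ := hB.mem_span hk hr' ho2.1 ho2.2 hc2.1 hc2.2
  rw [lat, if_pos (Nat.lt_succ_self k)] at s1 s2
  refine hA.turn hB hk hlat s1 s2 s3 s4 ?_
  have h2 : (k + 2) % S.d ≠ (k + 1) % S.d := succ_mod_ne (k := k + 1) (by omega)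
  have h3 : (k + 2) % S.d ≠ k % S.d := add_two_mod_ne hd
  have ht := (h.lat_eq hA hB (Nat.mod_lt _ (zero_lt_d S)) h3 h2).2.2
  have e1 := off_next_next (A := A) (S := S) hk h0
  have e2 := off_next (A := B) (S := S) (k := k + 1) (r := r') (by omega)
  have hW := W_pos S
  unfold off at ht
  rw [e1.1, e1.2, e2.1, e2.2, Nat.add_sub_cancel] at ht
  push_cast at ht
  have h4 : (B.tilt S k : ℝ) / S.W ≤ A.tilt S k / S.W := by linarith
  have h5 := (div_le_div_iff_of_pos_right hW).1 h4
  exact_mod_cast h5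

/-- The boxes at the start of a route do not meet any box of phase `1`. -/
theorem not_meet_start (hA : A.Valid S) (hB : B.Valid S)
    (hP : P = .hub ∨ P = .arm ∨ P = .run 0 0) {r' : ℕ} : ¬ A.Meet S P B (.run 1 r') := by
  intro h
  have hd := S.three_le_d
  have hph : P.phase = 0 := by rcases hP with rfl | rfl | rfl <;> rfl
  have hc := h.cross (by
    rw [hph, RoutePart.phase, Nat.zero_mod, Nat.mod_eq_of_lt (show 1 < S.d by omega)]
    norm_num)
  rw [hph, RoutePart.phase, Nat.zero_mod] at hc
  have hal := hA.along_zero_bounds hP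
  have ho := hB.off_range (.run 1 r') 0
  obtain ⟨hΛ, hL, hL'⟩ := Λ_bounds S
  rw [lat, if_pos one_pos] at hc
  refine hB.target_zero_far (A := A) ?_ ?_
  · have : (A.source S 0 : ℝ) < B.target S 0 + S.Λ + 1 := by linarith
    have : A.source S 0 < B.target S 0 + S.Λ + 1 := by exact_mod_cast this
    omega
  · have : (B.target S 0 : ℝ) < A.source S 0 + S.Λ + 1 := by linarith
    have : B.target S 0 < A.source S 0 + S.Λ + 1 := by exact_mod_cast this
    omega

end Strand

namespace Strand

variable {S : Scale} {A B : Strand} {P Q : RoutePart}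

theorem exists_run_of_phase_pos (h : 0 < P.phase) : ∃ r, P = .run P.phase r := by
  rcases P with _ | _ | ⟨k, r⟩
  · simp [RoutePart.phase] at h
  · simp [RoutePart.phase] at h
  · exact ⟨r, rfl⟩

/-- Intersecting boxes of phase `0` belong to the same vertex. -/
theorem Meet.same_vertex (hA : A.Valid S) (hB : B.Valid S) (hP : P.Valid S) (hQ : Q.Valid S)
    (hP0 : P.phase = 0) (hQ0 : Q.phase = 0) (h : A.Meet S P B Q) :
    (∀ l < S.d, A.x l = B.x l) ∧ ∀ l, 1 ≤ l → l < S.d → A.dig l = B.dig l := by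
  have hs := h.span_zero hA hB hP hQ hP0 hQ0
  refine hA.parallel_zero hB (fun l hl h0 => ?_) hs.1 hs.2
  have := (h.lat_eq hA hB hl (by rwa [hP0, Nat.zero_mod]) (by rwa [hQ0, Nat.zero_mod])).1
  rwa [hP0, hQ0] at this

/-- Intersecting boxes of the same inner phase. -/
theorem Meet.parallel_mid (hA : A.Valid S) (hB : B.Valid S) {k r r' : ℕ} (hk : 1 ≤ k)
    (hkd : k < S.d) (hr : r ≤ S.q) (hr' : r' ≤ S.q) (h : A.Meet S (.run k r) B (.run k r')) :
    SameFamily S.d A B ∧ (∀ l < k, A.m l = B.m l) ∧ ∀ l, k < l → l < S.d → A.dig l = B.dig l := by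
  have hs := h.span hA hB hkd.le hr hr'
  refine hA.parallel_mid hB hk hkd (fun l hl h0 => ?_) hs.1 hs.2
  rw [← Nat.mod_eq_of_lt hkd] at h0
  exact (h.lat_eq hA hB hl h0 h0).1

/-- Intersecting boxes of the last phase. -/
theorem Meet.parallel_last (hA : A.Valid S) (hB : B.Valid S) {r r' : ℕ} (hr : r ≤ S.q)
    (hr' : r' ≤ S.q) (h : A.Meet S (.run S.d r) B (.run S.d r')) :
    (SameFamily S.d A B ∨ Opposite S.d A B ∨ Opposite S.d B A) ∧
      ∀ l, 1 ≤ l → l < S.d → A.m l = B.m l := by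
  have hs := h.span hA hB le_rfl hr hr'
  refine hA.parallel_last hB (fun l hl h0 => ?_) hs.1 hs.2
  rw [← Nat.mod_self S.d] at h0
  exact (h.lat_eq hA hB hl h0 h0).1

/-- Intersecting boxes of different phases, both of the route of a half-edge, agree in all data
relevant for these phases. -/
theorem Meet.of_phase_lt (hA : A.Valid S) (hB : B.Valid S) (hP : P.Valid S) (hQ : Q.Valid S)
    (hPQ : P.phase < Q.phase) (h : A.Meet S P B Q) :
    ∃ k r r', k < S.d ∧ (k = 0 → r ≠ 0) ∧ P = .run k r ∧ Q = .run (k + 1) r' ∧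
    SameFamily S.d A B ∧ (∀ l < k + 1, (k + 1 = S.d → 1 ≤ l) → A.m l = B.m l) ∧
      ∀ l, k + 1 < l → l < S.d → A.dig l = B.dig l := by
  have hle := h.phase_le hA hB hP hQ
  obtain ⟨r', hQr⟩ := exists_run_of_phase_pos (P := Q) (by omega)
  have hQk : Q.phase = P.phase + 1 := by omega
  rw [hQk] at hQr
  subst hQr
  have h0 : ¬ (P = .hub ∨ P = .arm ∨ P = .run 0 0) := fun hc => by
    have : P.phase = 0 := by rcases hc with rfl | rfl | rfl <;> rfl
    rw [this] at h
    exact not_meet_start hA hB hc h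
  rcases P with _ | _ | ⟨k, r⟩
  · simp at h0
  · simp at h0
  · have hk : k < S.d := by
      have := hQ.1
      simp only [RoutePart.phase] at this
      omega
    have hr : k = 0 → r ≠ 0 := fun hk hr => h0 (by simp [hk, hr])
    exact ⟨k, r, r', hk, hr, rfl, rfl, Meet.turn hA hB hk hP.2 hQ.2 hr h⟩

/-- The boxes near a vertex are told apart by their cross-sections. -/
theorem Meet.offTen_le (hA : A.Valid S) (hB : B.Valid S) (hP0 : P.phase = 0) (hQ0 : Q.phase = 0)
    (h : A.Meet S P B Q) {l : ℕ} (hl : l < S.d) (h0 : l ≠ 0) :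
    A.offTen S P l ≤ B.offTen S Q l + 11 ∧ B.offTen S Q l ≤ A.offTen S P l + 11 := by
  have h1 := h.lat_eq hA hB hl (by rwa [hP0, Nat.zero_mod]) (by rwa [hQ0, Nat.zero_mod])
  have h2 := hA.off_bounds P l
  have h3 := hB.off_bounds Q l
  have h4 : (A.offTen S P l : ℝ) ≤ B.offTen S Q l + 11 := by linarith
  have h5 : (B.offTen S Q l : ℝ) ≤ A.offTen S P l + 11 := by linarith
  exact ⟨by exact_mod_cast h4, by exact_mod_cast h5⟩

theorem Valid.lane_cases (hA : A.Valid S) : A.lane = 0 ∨ A.lane = 1 ∨ A.lane = 2 := by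
  have := hA.lane_lt
  omega

/-- Boxes of different routes from the same vertex do not intersect near the vertex, except for the
box of the vertex itself. -/
theorem not_meet_of_lane_ne (hA : A.Valid S) (hB : B.Valid S) (hlane : A.lane ≠ B.lane)
    (hP0 : P.phase = 0) (hQ0 : Q.phase = 0) (hP : P ≠ .hub) (hQ : Q ≠ .hub) :
    ¬ A.Meet S P B Q := by
  intro h
  have hd := S.three_le_d
  have h1 := h.offTen_le hA hB hP0 hQ0 (l := 1) (by omega) one_ne_zero
  have h2 := h.offTen_le hA hB hP0 hQ0 (l := 2) (by omega) two_ne_zero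
  have hA' := hA.lane_cases
  have hB' := hB.lane_cases
  rcases P with _ | _ | ⟨k, r⟩
  · exact hP rfl
  · rcases Q with _ | _ | ⟨k', r'⟩
    · exact hQ rfl
    · simp only [offTen, pick] at h1 h2
      rcases hA' with a | a | a <;> rcases hB' with b | b | b <;> simp [a, b] at h1 h2 hlane
    · obtain rfl : k' = 0 := hQ0
      by_cases hr' : r' = 0 <;> simp only [offTen, pick, hr'] at h1 h2 <;>
      rcases hA' with a | a | a <;> rcases hB' with b | b | b <;> simp [a, b] at h1 h2 hlane
  · obtain rfl : k = 0 := hP0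
    rcases Q with _ | _ | ⟨k', r'⟩
    · exact hQ rfl
    · by_cases hr : r = 0 <;> simp only [offTen, pick, hr] at h1 h2 <;>
      rcases hA' with a | a | a <;> rcases hB' with b | b | b <;> simp [a, b] at h1 h2 hlane
    · obtain rfl : k' = 0 := hQ0
      by_cases hr : r = 0 <;> by_cases hr' : r' = 0 <;>
      simp only [offTen, pick, hr, hr'] at h1 h2 <;>
      rcases hA' with a | a | a <;> rcases hB' with b | b | b <;> simp [a, b] at h1 h2 hlane

theorem not_meet_hub_run (hA : A.Valid S) (hB : B.Valid S) {r : ℕ} :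
    ¬ A.Meet S .hub B (.run 0 r) := by
  intro h
  have hd := S.three_le_d
  have h1 := h.offTen_le hA hB rfl rfl (l := 1) (by omega) one_ne_zero
  have h2 := h.offTen_le hA hB rfl rfl (l := 2) (by omega) two_ne_zero
  by_cases hr : r = 0 <;> simp only [offTen, pick, hr] at h1 h2 <;>
  rcases hB.lane_cases with b | b | b <;> simp [b] at h1 h2

theorem not_meet_arm_run (hA : A.Valid S) {r : ℕ} (hr : r ≠ 0) :
    ¬ A.Meet S .arm A (.run 0 r) := by
  intro h
  have hd := S.three_le_d
  have h1 := h.offTen_le hA hA rfl rfl (l := 1) (by omega) one_ne_zero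
  simp only [offTen, pick, hr] at h1
  rcases hA.lane_cases with b | b | b <;> simp [b] at h1

/-! ### Consecutive boxes of a route -/

theorem step_mul_lt (S : Scale) {δ : ℝ} (hδ : 4 / 5 * S.Λ ≤ δ) {n : ℕ} (h : δ * n < 128 / 10) :
    n = 0 := by
  by_contra hn
  have h1 : (1 : ℝ) ≤ n := by exact_mod_cast Nat.one_le_iff_ne_zero.2 hn
  have hΛ := (Λ_bounds S).1
  have h2 : δ * 1 ≤ δ * n := mul_le_mul_of_nonneg_left h1 (by linarith)
  linarith

/-- Boxes of the same phase of a route intersect only if they are consecutive. -/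
theorem Meet.run_le (hA : A.Valid S) {k r r' : ℕ} (hk : k ≤ S.d)
    (h : A.Meet S (.run k r) A (.run k r')) : r ≤ r' + 1 := by
  by_contra hlt
  have h1 := h.parallel rfl
  obtain ⟨hΛ, hL, hL'⟩ := Λ_bounds S
  have h2 : (2 : ℝ) ≤ r - r' := by
    have : ((r' + 2 : ℕ) : ℝ) ≤ r := by exact_mod_cast (by omega : r' + 2 ≤ r)
    push_cast at this
    linarith
  by_cases hup : A.first S k < A.finish S k
  · obtain ⟨δ, h3, -, h4⟩ := hA.along_up hk hup
    have e1 := (h4 r).1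
    have e2 := (h4 r').1
    have e3 : δ * 2 ≤ δ * (r - r') := mul_le_mul_of_nonneg_left h2 (by linarith)
    linarith
  · obtain ⟨δ, h3, -, h4⟩ := hA.along_down hk hup
    have e1 := (h4 r).1
    have e2 := (h4 r').1
    have e3 : δ * 2 ≤ δ * (r - r') := mul_le_mul_of_nonneg_left h2 (by linarith)
    linarith

/-- Boxes of consecutive phases of a route intersect only at the turn. -/
theorem Meet.run_succ (hA : A.Valid S) {k r r' : ℕ} (hk : k < S.d) (hr : r ≤ S.q)
    (h : A.Meet S (.run k r) A (.run (k + 1) r')) : r = S.q ∧ r' = 0 := by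
  have hd := S.three_le_d
  have hkm : k % S.d = k := Nat.mod_eq_of_lt hk
  have hne : k % S.d ≠ (k + 1) % S.d := (succ_mod_ne (by omega)).symm
  have hc1 := h.cross hne
  have hc2 := h.symm.cross hne.symm
  simp only [RoutePart.phase, hkm] at hc1 hc2
  have ho1 := hA.off_range (.run (k + 1) r') k
  have ho2 := hA.off_range (.run k r) ((k + 1) % S.d)
  obtain ⟨hΛ, hL, hL'⟩ := Λ_bounds S
  rw [lat, if_pos (Nat.lt_succ_self k), ← finish_of_lt hk] at hc1
  have hlat : A.lat S k ((k + 1) % S.d) = A.first S (k + 1) := by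
    rcases Nat.lt_or_eq_of_le (Nat.succ_le_of_lt hk) with h1 | h1
    · rw [Nat.mod_eq_of_lt h1, lat, if_neg (by omega), first_of_lt h1]
    · rw [show k + 1 = S.d from h1, Nat.mod_self, lat, if_pos (by omega), first_last]
  rw [hlat] at hc2
  constructor
  · have hqr : S.q - r = 0 := by
      have hcast : ((S.q - r : ℕ) : ℝ) = S.q - r := by push_cast [hr]; ring
      by_cases hup : A.first S k < A.finish S k
      · obtain ⟨δ, h3, -, h4⟩ := hA.along_up hk.le hup
        have e1 := (h4 r).2
        refine step_mul_lt S h3 ?_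
        rw [hcast]
        linarith
      · obtain ⟨δ, h3, -, h4⟩ := hA.along_down hk.le hup
        have e1 := (h4 r).2
        refine step_mul_lt S h3 ?_
        rw [hcast]
        linarith
    omega
  · by_cases hup : A.first S (k + 1) < A.finish S (k + 1)
    · obtain ⟨δ, h3, -, h4⟩ := hA.along_up hk hup
      have e1 := (h4 r').1
      refine step_mul_lt S h3 ?_
      linarith
    · obtain ⟨δ, h3, -, h4⟩ := hA.along_down hk hup
      have e1 := (h4 r').1
      refine step_mul_lt S h3 ?_
      linarith

theorem meet_self (P : RoutePart) : A.Meet S P A P := by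
  obtain ⟨hΛ, hL, hL'⟩ := Λ_bounds S
  intro l hl
  split_ifs <;> constructor <;> linarith

/-- Parallel boxes of a route intersect if their cross-sections and their extents do. -/
theorem meet_of_parallel (hPQ : P.phase = Q.phase)
    (h1 : A.along S P ≤ A.along S Q + S.L) (h2 : A.along S Q ≤ A.along S P + S.L)
    (h3 : ∀ l < S.d, A.off S P l ≤ A.off S Q l + 1 ∧ A.off S Q l ≤ A.off S P l + 1) :
    A.Meet S P A Q := by
  intro l hl
  have := h3 l hl
  simp only [corner, ← hPQ]
  split_ifs
  · exact ⟨h1, h2⟩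
  · constructor <;> linarith

theorem meet_run_run (hA : A.Valid S) {k r : ℕ} (hk : k ≤ S.d) :
    A.Meet S (.run k r) A (.run k (r + 1)) := by
  obtain ⟨hΛ, hL, hL'⟩ := Λ_bounds S
  have key : A.along S (.run k r) ≤ A.along S (.run k (r + 1)) + S.L ∧
      A.along S (.run k (r + 1)) ≤ A.along S (.run k r) + S.L := by
    by_cases hup : A.first S k < A.finish S k
    · obtain ⟨δ, h3, h5, h4⟩ := hA.along_up hk hup
      rw [(h4 r).1, (h4 (r + 1)).1]
      push_cast
      constructor <;> linarith
    · obtain ⟨δ, h3, h5, h4⟩ := hA.along_down hk hup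
      rw [(h4 r).1, (h4 (r + 1)).1]
      push_cast
      constructor <;> linarith
  refine meet_of_parallel rfl key.1 key.2 fun l hl => ?_
  have hW := W_pos S
  have ht := hA.tilt_bounds 0
  have ht0 : (0 : ℝ) ≤ A.tilt S 0 / S.W := by
    have : (0 : ℝ) ≤ A.tilt S 0 := by exact_mod_cast ht.1
    positivity
  have ht1 : (A.tilt S 0 / S.W : ℝ) ≤ 1 := by
    rw [div_le_one hW]; exact_mod_cast ht.2
  by_cases hk0 : k = 0
  · by_cases hr : r = 0
    · subst hk0 hr
      by_cases h1 : l = 1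
      · rcases hA.lane_cases with b | b | b <;> simp [off, offTen, offTilt, pick, h1, b] <;>
        norm_num
      by_cases h2 : l = 2
      · rcases hA.lane_cases with b | b | b <;> simp [off, offTen, offTilt, pick, h2, b] <;>
        constructor <;> linarith
      · simp [off, offTen, offTilt, h1, h2]
    · have e : A.off S (.run k (r + 1)) l = A.off S (.run k r) l := by
        simp [off, offTen, offTilt, hk0, hr]
      rw [e]
      constructor <;> linarith
  · have e : A.off S (.run k (r + 1)) l = A.off S (.run k r) l := by
      simp [off, offTen, offTilt, hk0]
    rw [e]
    constructor <;> linarith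

theorem meet_hub_arm (hB : B.Valid S) (hs : ∀ l < S.d, A.source S l = B.source S l) :
    A.Meet S .hub B .arm := by
  obtain ⟨hΛ, hL, hL'⟩ := Λ_bounds S
  intro l hl
  simp only [corner, RoutePart.phase, Nat.zero_mod, lat, along, Nat.not_lt_zero, if_false,
    hs l hl, hs 0 (zero_lt_d S)]
  by_cases h0 : l = 0
  · simp only [h0, if_true]
    constructor <;> linarith
  · simp only [if_neg h0, off, offTen, offTilt, pick]
    rcases hB.lane_cases with b | b | b <;> simp only [b] <;>
    split_ifs <;> simp_all <;> norm_num <;> constructor <;> linarith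

theorem meet_arm_run (hA : A.Valid S) : A.Meet S .arm A (.run 0 0) := by
  obtain ⟨hΛ, hL, hL'⟩ := Λ_bounds S
  have h1 := hA.along_zero_bounds (P := .run 0 0) (by simp)
  have h2 : A.along S .arm = 16 * A.source S 0 := rfl
  refine meet_of_parallel rfl (by linarith) (by linarith) fun l hl => ?_
  simp only [off, offTen, offTilt, pick]
  rcases hA.lane_cases with b | b | b <;> simp only [b] <;>
  split_ifs <;> simp_all <;> norm_num

/-- The displacements in the phases after the first. -/
theorem Valid.off_range_pos (hA : A.Valid S) {k r l : ℕ} (hk : k ≠ 0) :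
    -(8 / 10) ≤ A.off S (.run k r) l ∧ A.off S (.run k r) l ≤ 11 / 10 ∧
      (l ≠ (k + 1) % S.d → A.off S (.run k r) l ≤ 1 / 10) := by
  have h := hA.off_bounds (.run k r) l
  have h1 : -8 ≤ A.offTen S (.run k r) l ∧ A.offTen S (.run k r) l ≤ 10 ∧
      (l ≠ (k + 1) % S.d → A.offTen S (.run k r) l ≤ 0) := by
    simp only [offTen, if_neg hk]
    split_ifs <;> simp_all
  have h2 : (-8 : ℝ) ≤ A.offTen S (.run k r) l := by exact_mod_cast h1.1
  have h3 : (A.offTen S (.run k r) l : ℝ) ≤ 10 := by exact_mod_cast h1.2.1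
  refine ⟨by linarith, by linarith, fun hl => ?_⟩
  have h4 : (A.offTen S (.run k r) l : ℝ) ≤ 0 := by exact_mod_cast h1.2.2 hl
  linarith

theorem meet_turn (hA : A.Valid S) {k : ℕ} (hk : k < S.d) :
    A.Meet S (.run k S.q) A (.run (k + 1) 0) := by
  have hd := S.three_le_d
  have hq := S.q_pos
  obtain ⟨hΛ, hL, hL'⟩ := Λ_bounds S
  have hkm : k % S.d = k := Nat.mod_eq_of_lt hk
  have hne : k % S.d ≠ (k + 1) % S.d := (succ_mod_ne (by omega)).symm
  have hP : (RoutePart.run k S.q).phase % S.d = k := hkm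
  have hQ : (RoutePart.run (k + 1) 0).phase % S.d = (k + 1) % S.d := rfl
  intro l hl
  simp only [corner, hP, hQ]
  rw [hkm] at hne
  by_cases hlk : l = k
  · subst hlk
    simp only [if_neg hne, if_true, RoutePart.phase]
    rw [lat, if_pos (Nat.lt_succ_self l), ← finish_of_lt hk]
    have ho := hA.off_range_pos (k := l + 1) (r := 0) (l := l) (by omega)
    by_cases hup : A.first S l < A.finish S l
    · obtain ⟨δ, -, -, h4⟩ := hA.along_up hk.le hup
      rw [(h4 S.q).2, sub_self, mul_zero]
      constructor <;> linarith
    · obtain ⟨δ, -, -, h4⟩ := hA.along_down hk.le hup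
      rw [(h4 S.q).2, sub_self, mul_zero]
      constructor <;> linarith
  by_cases hlk1 : l = (k + 1) % S.d
  · simp only [if_neg hlk, if_pos hlk1, RoutePart.phase]
    have hlat : A.lat S k l = A.first S (k + 1) := by
      rcases Nat.lt_or_eq_of_le (Nat.succ_le_of_lt hk) with h1 | h1
      · rw [hlk1, Nat.mod_eq_of_lt h1, lat, if_neg (by omega), first_of_lt h1]
      · rw [hlk1, show k + 1 = S.d from h1, Nat.mod_self, lat, if_pos (by omega), first_last]
    have ho : 0 ≤ A.off S (.run k S.q) l := by
      have h1 := (hA.off_bounds (.run k S.q) l).1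
      have h2 : 0 ≤ A.offTen S (.run k S.q) l := by
        rcases Nat.eq_zero_or_pos k with rfl | hk0
        · rw [hlk1, Nat.mod_eq_of_lt (by omega)]
          simp only [offTen, pick, hq.ne']
          norm_num
          split_ifs <;> norm_num
        · rw [hlk1, (off_next (by omega)).1]
          norm_num
      have h3 : (0 : ℝ) ≤ A.offTen S (.run k S.q) l := by exact_mod_cast h2
      linarith
    have ho2 := (hA.off_range (.run k S.q) l).2
    rw [hlat]
    by_cases hup : A.first S (k + 1) < A.finish S (k + 1)
    · obtain ⟨δ, -, -, h4⟩ := hA.along_up hk hup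
      rw [(h4 0).1, Nat.cast_zero, mul_zero]
      constructor <;> linarith
    · obtain ⟨δ, -, -, h4⟩ := hA.along_down hk hup
      rw [(h4 0).1, Nat.cast_zero, mul_zero]
      constructor <;> linarith
  simp only [if_neg hlk, if_neg hlk1, RoutePart.phase]
  have hlat : A.lat S (k + 1) l = A.lat S k l := by
    unfold lat
    by_cases h : l < k
    · rw [if_pos h, if_pos (by omega)]
    · rw [if_neg h, if_neg (by omega)]
  rw [hlat]
  by_cases hlk2 : l = (k + 2) % S.d
  · have e1 := off_next_next (A := A) (S := S) (r := S.q) hk (fun _ => hq.ne')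
    have e2 := off_next (A := A) (S := S) (k := k + 1) (r := 0) (by omega)
    rw [← hlk2] at e1
    rw [show k + 1 + 1 = k + 2 from rfl, ← hlk2] at e2
    simp only [off, e1, e2, Nat.add_sub_cancel]
    push_cast
    constructor <;> linarith
  · have e1 : A.off S (.run k S.q) l = -(8 / 10) := off_other hlk1 (Or.inl hlk2)
    have e2 := hA.off_range_pos (k := k + 1) (r := 0) (l := l) (by omega)
    have e3 := e2.2.2 hlk2
    rw [e1]
    constructor <;> linarith

/-! ### The two halves of an edge -/

theorem Opposite.final_eq (h : Opposite S.d A B) : A.final S = B.final S := by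
  have hx := h.x 0 (zero_lt_d S)
  unfold final
  rw [hx, h.ty, h.negA, h.negB]
  by_cases ht : B.ty = 0 <;> simp [shift, h.negB, ht]
  ring

theorem Valid.up_last (hA : A.Valid S) : A.first S S.d < A.finish S S.d ↔
    (A.ty = 0 ↔ A.neg = false) := by
  have := S.U_eq_int; have := S.Λ_le_int; have := S.sixteen_le_Λ_int
  have := hA.g_nonneg 0; have := hA.g_lt 0
  rw [first_last, finish_last, target_zero, final]
  by_cases ht : A.ty = 0 <;> cases hn : A.neg <;> simp [ht] <;> linarith

theorem meet_last_aux (hA : A.Valid S) (hB : B.Valid S) (hf : A.finish S S.d = B.finish S S.d)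
    (hup : A.first S S.d < A.finish S S.d) (hdown : ¬ B.first S S.d < B.finish S S.d) {r r' : ℕ}
    (hr : r ≤ S.q) (hr' : r' ≤ S.q) :
    (A.along S (.run S.d r) ≤ B.along S (.run S.d r') + S.L ∧
      B.along S (.run S.d r') ≤ A.along S (.run S.d r) + S.L) ↔ r = S.q ∧ r' = S.q := by
  obtain ⟨hΛ, hL, hL'⟩ := Λ_bounds S
  obtain ⟨δ, h1, -, h2⟩ := hA.along_up le_rfl hup
  obtain ⟨δ', h1', -, h2'⟩ := hB.along_down le_rfl hdown
  have hc : ((S.q - r : ℕ) : ℝ) = S.q - r := by push_cast [hr]; ring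
  have hc' : ((S.q - r' : ℕ) : ℝ) = S.q - r' := by push_cast [hr']; ring
  rw [(h2 r).2, (h2' r').2, hf, ← hc, ← hc']
  constructor
  · rintro ⟨-, h⟩
    have p1 : (0 : ℝ) ≤ δ * (S.q - r : ℕ) := mul_nonneg (by linarith) (Nat.cast_nonneg _)
    have p2 : (0 : ℝ) ≤ δ' * (S.q - r' : ℕ) := mul_nonneg (by linarith) (Nat.cast_nonneg _)
    have e1 := step_mul_lt S h1 (n := S.q - r) (by linarith)
    have e2 := step_mul_lt S h1' (n := S.q - r') (by linarith)
    omega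
  · rintro ⟨rfl, rfl⟩
    simp only [Nat.sub_self, Nat.cast_zero, mul_zero]
    constructor <;> linarith

theorem Opposite.along (hA : A.Valid S) (hB : B.Valid S) (h : Opposite S.d A B) {r r' : ℕ}
    (hr : r ≤ S.q) (hr' : r' ≤ S.q) :
    (A.along S (.run S.d r) ≤ B.along S (.run S.d r') + S.L ∧
      B.along S (.run S.d r') ≤ A.along S (.run S.d r) + S.L) ↔ r = S.q ∧ r' = S.q := by
  have hf : A.finish S S.d = B.finish S S.d := by rw [finish_last, finish_last, h.final_eq]
  by_cases ht : B.ty = 0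
  · refine meet_last_aux hA hB hf (hA.up_last.2 ?_) (mt hB.up_last.1 ?_) hr hr'
    · simp [h.ty, ht, h.negA]
    · simp [ht, h.negB]
  · rw [and_comm, and_comm (a := r = S.q)]
    refine meet_last_aux hB hA hf.symm (hB.up_last.2 ?_) (mt hA.up_last.1 ?_) hr' hr
    · simp [ht, h.negB]
    · simp [h.ty, ht, h.negA]

/-- The last phases of the two halves of an edge meet end to end. -/
theorem Opposite.meet_iff (hA : A.Valid S) (hB : B.Valid S) (h : Opposite S.d A B)
    (hm : ∀ l < S.d, A.m l = B.m l) {r r' : ℕ} (hr : r ≤ S.q) (hr' : r' ≤ S.q) :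
    A.Meet S (.run S.d r) B (.run S.d r') ↔ r = S.q ∧ r' = S.q := by
  rw [← h.along hA hB hr hr']
  refine ⟨fun h => h.parallel rfl, fun hal l hl => ?_⟩
  have hd := S.three_le_d
  simp only [corner, RoutePart.phase, Nat.mod_self]
  by_cases hl0 : l = 0
  · simpa [hl0] using hal
  simp only [if_neg hl0]
  have hlat : A.lat S S.d l = B.lat S S.d l := by
    have hA0 : A.shift l = 0 := by simp [shift, h.negA]
    rw [lat, lat, if_pos hl, if_pos hl, target_pos hl0, target_pos hl0, hA0, h.x l hl, g, g, h.ty,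
      hm l hl, sub_zero]
  rw [hlat]
  by_cases hl1 : l = (S.d + 1) % S.d
  · have e1 := off_next (A := A) (S := S) (k := S.d) (r := r) (by omega)
    have e2 := off_next (A := B) (S := S) (k := S.d) (r := r') (by omega)
    have h1 := hA.off_bounds (.run S.d r) l
    have h2 := hB.off_bounds (.run S.d r') l
    rw [hl1, e1.1] at h1
    rw [hl1, e2.1] at h2
    rw [hl1]
    constructor <;> linarith
  · rw [off_other (P := .run S.d r) hl1 (Or.inr rfl), off_other (P := .run S.d r') hl1 (Or.inr rfl)]
    constructor <;> linarith

end Strand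

/-! ### Subdivisions described by half-edges -/

section HalfEdges

variable {V : Type} (G : SimpleGraph V) (N : ℕ)

/-- The graph obtained from `G` by putting `2 * (N + 1)` vertices on every edge. The `N + 1`
vertices on the first half of the dart `δ`, in the order of the dart, are `inr (δ, 0), …, inr (δ,
N)`. -/
def halfEdgeSubdivision : SimpleGraph (V ⊕ G.Dart × Fin (N + 1)) where
  Adj
    | .inl _, .inl _ => False
    | .inl v, .inr (δ, n) => δ.fst = v ∧ n = 0
    | .inr (δ, n), .inl v => δ.fst = v ∧ n = 0
    | .inr (δ, n), .inr (δ', n') =>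
      (δ = δ' ∧ ((n : ℕ) + 1 = n' ∨ (n' : ℕ) + 1 = n)) ∨
        (δ' = δ.symm ∧ n = Fin.last N ∧ n' = Fin.last N)
  symm := by
    refine ⟨?_⟩
    rintro (v | ⟨δ, n⟩) (v' | ⟨δ', n'⟩) h
    · exact h
    · exact h
    · exact h
    · rcases h with ⟨h1, h2⟩ | ⟨rfl, h2, h3⟩
      · exact Or.inl ⟨h1.symm, h2.symm⟩
      · exact Or.inr ⟨δ.symm_symm.symm, h3, h2⟩
  loopless := by
    refine ⟨?_⟩
    rintro (v | ⟨δ, n⟩) h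
    · exact h
    · rcases h with ⟨-, h⟩ | ⟨h, -⟩
      · omega
      · exact δ.symm_ne h.symm

theorem pair_infix_append {α : Type*} {x y : α} (l₁ l₂ : List α) :
    [x, y] <:+: l₁ ++ l₂ ↔ [x, y] <:+: l₁ ∨ [x, y] <:+: l₂ ∨
      (l₁.getLast? = some x ∧ l₂.head? = some y) := by
  induction l₁ with
  | nil => simp
  | cons a l ih =>
    rcases l with _ | ⟨b, l⟩
    · rcases l₂ with _ | ⟨c, l₂⟩
      · simp
      · have h := not_pair_infix_singleton (x := x) (y := y) (a := a)
        rw [List.singleton_append, pair_infix_cons_cons]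
        simp only [h, false_or, List.getLast?_singleton, List.head?_cons, Option.some.injEq]
        tauto
    · rw [List.cons_append, List.cons_append, pair_infix_cons_cons, ← List.cons_append, ih,
        pair_infix_cons_cons, List.getLast?_cons_cons, or_assoc]

theorem pair_infix_map_finRange {α : Type*} {x y : α} (n : ℕ) (f : Fin n → α) :
    [x, y] <:+: (List.finRange n).map f ↔
      ∃ i j : Fin n, (i : ℕ) + 1 = j ∧ f i = x ∧ f j = y := by
  constructor
  · rintro ⟨s, s', h⟩
    have h1 := congrArg (fun l => l[s.length]?) h
    have h2 := congrArg (fun l => l[s.length + 1]?) h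
    simp [List.getElem?_map] at h1 h2
    obtain ⟨i, hi, hx⟩ := h1
    obtain ⟨j, hj, hy⟩ := h2
    rw [List.getElem?_eq_some_iff] at hi hj
    obtain ⟨hi1, hi⟩ := hi
    obtain ⟨hj1, hj⟩ := hj
    refine ⟨i, j, ?_, hx, hy⟩
    rw [← hi, ← hj]
    simp
  · rintro ⟨i, j, hij, rfl, rfl⟩
    refine ⟨((List.finRange n).map f).take i, ((List.finRange n).map f).drop (i + 2), ?_⟩
    have hi : (i : ℕ) < ((List.finRange n).map f).length := by simp
    have hj : (i : ℕ) + 1 < ((List.finRange n).map f).length := by simp; omega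
    have e1 : ((List.finRange n).map f).drop i = f i :: ((List.finRange n).map f).drop (i + 1) := by
      rw [List.drop_eq_getElem_cons hi]
      simp
    have e2 : ((List.finRange n).map f).drop (i + 1) =
        f j :: ((List.finRange n).map f).drop (i + 2) := by
      rw [List.drop_eq_getElem_cons hj]
      have : (⟨i + 1, by omega⟩ : Fin n) = j := Fin.ext hij
      simp [this]
    calc _ = ((List.finRange n).map f).take i ++
          (f i :: f j :: ((List.finRange n).map f).drop (i + 2)) := by simp
      _ = _ := by rw [← e2, ← e1, List.take_append_drop]

variable {G}

/-- The new vertices on the first half of a dart. -/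
def halfPath (δ : G.Dart) : List (V ⊕ G.Dart × Fin (N + 1)) :=
  (List.finRange (N + 1)).map fun n => .inr (δ, n)

variable {N}

theorem mem_halfPath {δ : G.Dart} {w : V ⊕ G.Dart × Fin (N + 1)} :
    w ∈ halfPath N δ ↔ ∃ n, w = .inr (δ, n) := by
  simp [halfPath, eq_comm]

theorem head?_halfPath (δ : G.Dart) : (halfPath N δ).head? = some (.inr (δ, 0)) := by
  simp [halfPath, List.finRange_succ]

theorem getLast?_halfPath (δ : G.Dart) :
    (halfPath N δ).getLast? = some (.inr (δ, Fin.last N)) := by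
  simp [halfPath, List.finRange_succ_last]

theorem nodup_halfPath (δ : G.Dart) : (halfPath N δ).Nodup :=
  (List.nodup_finRange _).map fun n n' h => by simpa using h

theorem halfPath_ne_nil (δ : G.Dart) : halfPath N δ ≠ [] := fun h => by
  have := head?_halfPath (N := N) δ
  simp [h] at this

/-- The new vertices on a dart. -/
def dartPath (N : ℕ) (δ : G.Dart) : List (V ⊕ G.Dart × Fin (N + 1)) :=
  halfPath N δ ++ (halfPath N δ.symm).reverse

theorem dartPath_symm (δ : G.Dart) : dartPath N δ.symm = (dartPath N δ).reverse := by
  simp [dartPath]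

theorem pair_infix_dartPath (δ : G.Dart) (w w' : V ⊕ G.Dart × Fin (N + 1)) :
    [w, w'] <:+: .inl δ.fst :: (dartPath N δ ++ [.inl δ.snd]) ↔
      (w = .inl δ.fst ∧ w' = .inr (δ, 0)) ∨
      (∃ n n' : Fin (N + 1), (n : ℕ) + 1 = n' ∧ w = .inr (δ, n) ∧ w' = .inr (δ, n')) ∨
      (w = .inr (δ, Fin.last N) ∧ w' = .inr (δ.symm, Fin.last N)) ∨
      (∃ n n' : Fin (N + 1), (n : ℕ) + 1 = n' ∧ w' = .inr (δ.symm, n) ∧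
        w = .inr (δ.symm, n')) ∨
      (w' = .inl δ.snd ∧ w = .inr (δ.symm, 0)) := by
  have e : Sum.inl δ.fst :: (dartPath N δ ++ [.inl δ.snd]) =
      [.inl δ.fst] ++ (halfPath N δ ++ ((halfPath N δ.symm).reverse ++ [.inl δ.snd])) := by
    simp [dartPath]
  have h1 : (halfPath N δ ++ ((halfPath N δ.symm).reverse ++ [Sum.inl δ.snd])).head? =
      some (.inr (δ, 0)) := by
    rw [List.head?_append_of_ne_nil _ (halfPath_ne_nil _), head?_halfPath]
  have h2 : ((halfPath N δ.symm).reverse ++ [Sum.inl δ.snd]).head? =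
      some (.inr (δ.symm, Fin.last N)) := by
    rw [List.head?_append_of_ne_nil _ (by simpa using halfPath_ne_nil _), List.head?_reverse,
      getLast?_halfPath]
  rw [e, pair_infix_append, h1, pair_infix_append, h2, pair_infix_append, pair_infix_reverse,
    List.getLast?_reverse, head?_halfPath, getLast?_halfPath, halfPath, halfPath,
    pair_infix_map_finRange, pair_infix_map_finRange]
  simp only [not_pair_infix_singleton, List.getLast?_singleton, List.head?_cons,
    Option.some.injEq, false_or]
  constructor
  · rintro ((⟨n, n', h, rfl, rfl⟩ | (⟨n, n', h, rfl, rfl⟩ | ⟨rfl, rfl⟩) | ⟨rfl, rfl⟩) | ⟨rfl, rfl⟩)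
    · exact Or.inr (Or.inl ⟨n, n', h, rfl, rfl⟩)
    · exact Or.inr (Or.inr (Or.inr (Or.inl ⟨n, n', h, rfl, rfl⟩)))
    · exact Or.inr (Or.inr (Or.inr (Or.inr ⟨rfl, rfl⟩)))
    · exact Or.inr (Or.inr (Or.inl ⟨rfl, rfl⟩))
    · exact Or.inl ⟨rfl, rfl⟩
  · rintro (⟨rfl, rfl⟩ | ⟨n, n', h, rfl, rfl⟩ | ⟨rfl, rfl⟩ | ⟨n, n', h, rfl, rfl⟩ | ⟨rfl, rfl⟩)
    · exact Or.inr ⟨rfl, rfl⟩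
    · exact Or.inl (Or.inl ⟨n, n', h, rfl, rfl⟩)
    · exact Or.inl (Or.inr (Or.inr ⟨rfl, rfl⟩))
    · exact Or.inl (Or.inr (Or.inl (Or.inl ⟨n, n', h, rfl, rfl⟩)))
    · exact Or.inl (Or.inr (Or.inl (Or.inr ⟨rfl, rfl⟩)))

variable (G N)

open Classical in
/-- The paths of `halfEdgeSubdivision`. -/
noncomputable def halfEdgeModel : EvenPathModel G (halfEdgeSubdivision G N) where
  f := .inl
  path a b := if h : G.Adj a b then dartPath N ⟨(a, b), h⟩ else []
  f_inj := Sum.inl_injective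
  nodup {a b} h := by
    rw [dif_pos h, dartPath, List.nodup_append]
    refine ⟨nodup_halfPath _, List.nodup_reverse.2 (nodup_halfPath _), ?_⟩
    rintro w hw w' hw' rfl
    rw [List.mem_reverse] at hw'
    obtain ⟨n, rfl⟩ := mem_halfPath.1 hw
    obtain ⟨n', h'⟩ := mem_halfPath.1 hw'
    simp only [Sum.inr.injEq, Prod.mk.injEq] at h'
    exact (SimpleGraph.Dart.symm_ne _) h'.1.symm
  even {a b} h := by
    rw [dif_pos h]
    simp [dartPath, halfPath]
  rev {a b} h := by
    rw [dif_pos h, dif_pos h.symm]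
    exact dartPath_symm ⟨(a, b), h⟩
  notMem {a b} c h := by
    rw [dif_pos h]
    simp [dartPath, mem_halfPath]
  uniq {a b a' b' w} h h' hw hw' := by
    rw [dif_pos h] at hw
    rw [dif_pos h'] at hw'
    simp only [dartPath, List.mem_append, List.mem_reverse, mem_halfPath] at hw hw'
    rcases hw with ⟨n, rfl⟩ | ⟨n, rfl⟩ <;> rcases hw' with ⟨n', hw'⟩ | ⟨n', hw'⟩ <;>
      simp only [Sum.inr.injEq, Prod.mk.injEq] at hw' <;>
      have := congrArg SimpleGraph.Dart.edge hw'.1 <;> simp at this ⊢ <;> tauto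
  cover w := by
    rcases w with v | ⟨δ, n⟩
    · exact Or.inl ⟨v, rfl⟩
    · refine Or.inr ⟨δ.fst, δ.snd, δ.adj, ?_⟩
      rw [dif_pos δ.adj, dartPath, List.mem_append]
      exact Or.inl (mem_halfPath.2 ⟨n, rfl⟩)
  adj w w' := by
    have key : (∃ a b, G.Adj a b ∧ [w, w'] <:+: .inl a ::
        ((if h : G.Adj a b then dartPath N ⟨(a, b), h⟩ else []) ++ [.inl b])) ↔
        ∃ δ : G.Dart, [w, w'] <:+: .inl δ.fst :: (dartPath N δ ++ [.inl δ.snd]) := by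
      constructor
      · rintro ⟨a, b, h, h'⟩
        rw [dif_pos h] at h'
        exact ⟨⟨(a, b), h⟩, h'⟩
      · rintro ⟨δ, h⟩
        refine ⟨δ.fst, δ.snd, δ.adj, ?_⟩
        rwa [dif_pos δ.adj]
    rw [key]
    simp only [pair_infix_dartPath]
    constructor
    · intro h
      rcases w with v | ⟨δ, n⟩ <;> rcases w' with v' | ⟨δ', n'⟩
      · exact h.elim
      · obtain ⟨rfl, rfl⟩ := h
        exact ⟨δ', Or.inl ⟨rfl, rfl⟩⟩
      · obtain ⟨rfl, rfl⟩ := h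
        exact ⟨δ.symm, Or.inr (Or.inr (Or.inr (Or.inr ⟨rfl, by rw [δ.symm_symm]⟩)))⟩
      · rcases h with ⟨rfl, h | h⟩ | ⟨rfl, rfl, rfl⟩
        · exact ⟨δ, Or.inr (Or.inl ⟨n, n', h, rfl, rfl⟩)⟩
        · exact ⟨δ.symm, Or.inr (Or.inr (Or.inr (Or.inl ⟨n', n, h, by rw [δ.symm_symm],
            by rw [δ.symm_symm]⟩)))⟩
        · exact ⟨δ, Or.inr (Or.inr (Or.inl ⟨rfl, rfl⟩))⟩
    · rintro ⟨δ, ⟨rfl, rfl⟩ | ⟨n, n', h, rfl, rfl⟩ | ⟨rfl, rfl⟩ | ⟨n, n', h, rfl, rfl⟩ | ⟨rfl, rfl⟩⟩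
      · exact ⟨rfl, rfl⟩
      · exact Or.inl ⟨rfl, Or.inl h⟩
      · exact Or.inr ⟨rfl, rfl, rfl⟩
      · exact Or.inl ⟨rfl, Or.inr h⟩
      · exact ⟨rfl, rfl⟩

theorem isEvenSubdivision_halfEdgeSubdivision [Finite V] :
    IsEvenSubdivision (halfEdgeSubdivision G N) G :=
  have : Finite G.Dart := Finite.of_injective _ SimpleGraph.Dart.toProd_injective
  (halfEdgeModel G N).isEvenSubdivision

end HalfEdges

theorem IsEvenSubdivision.congr {W W' : Type} {H : SimpleGraph W} {H' : SimpleGraph W'}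
    (e : H ≃g H') {V : Type} {G : SimpleGraph V} (h : IsEvenSubdivision H G) :
    IsEvenSubdivision H' G := by
  induction h with
  | iso e' => exact .iso (e'.trans e)
  | step huv _ ih => exact .step huv ih

/-! ### Routes as chains of boxes -/

namespace RoutePart

/-- The boxes of a route after the hub, in order. -/
def chain (q : ℕ) : ℕ → RoutePart
  | 0 => .arm
  | n + 1 => .run (n / (q + 1)) (n % (q + 1))

/-- The place of a box in the chain. -/
def idx (q : ℕ) : RoutePart → ℕ
  | hub => 0
  | arm => 0
  | run k r => k * (q + 1) + r + 1

theorem idx_chain (q n : ℕ) : (chain q n).idx q = n := by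
  rcases n with _ | n
  · rfl
  · simp only [chain, idx]
    rw [Nat.div_add_mod']

theorem chain_ne_hub (q n : ℕ) : chain q n ≠ .hub := by
  rcases n with _ | n <;> simp [chain]

theorem chain_mul_add {q k r : ℕ} (hr : r ≤ q) : chain q (k * (q + 1) + r + 1) = .run k r := by
  rw [chain, mul_comm, Nat.mul_add_div (by omega), Nat.mul_add_mod, Nat.mod_eq_of_lt (by omega),
    Nat.div_eq_of_lt (by omega), add_zero]

theorem chain_valid {S : Scale} {n : ℕ} (hn : n ≤ (S.d + 1) * (S.q + 1)) :
    (chain S.q n).Valid S := by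
  rcases n with _ | n
  · trivial
  · refine ⟨?_, ?_⟩
    · exact Nat.le_of_lt_succ ((Nat.div_lt_iff_lt_mul (by omega)).2 hn)
    · exact Nat.le_of_lt_succ (Nat.mod_lt _ (by omega))

theorem chain_last (S : Scale) : chain S.q ((S.d + 1) * (S.q + 1)) = .run S.d S.q := by
  rw [← chain_mul_add le_rfl]
  congr 1
  ring

theorem chain_eq_last {S : Scale} {n : ℕ} (h : chain S.q n = .run S.d S.q) :
    n = (S.d + 1) * (S.q + 1) := by
  rw [← idx_chain S.q n, h, idx]
  ring

end RoutePart

namespace Strand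

open RoutePart

variable {S : Scale} {A B : Strand} {P Q : RoutePart}

/-- Boxes of a route that intersect are equal or consecutive. -/
theorem Meet.idx_le (hA : A.Valid S) (hP : P.Valid S) (hQ : Q.Valid S) (hP' : P ≠ .hub)
    (hQ' : Q ≠ .hub) (h : A.Meet S P A Q) : P.idx S.q ≤ Q.idx S.q + 1 := by
  rcases lt_trichotomy P.phase Q.phase with hlt | heq | hlt
  · obtain ⟨k, r, r', hk, -, rfl, rfl, -⟩ := h.of_phase_lt hA hA hP hQ hlt
    have := hP.2
    simp only [idx, add_mul]
    omega
  · rcases P with _ | _ | ⟨k, r⟩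
    · exact (hP' rfl).elim
    · simp [idx]
    rcases Q with _ | _ | ⟨k', r'⟩
    · exact (hQ' rfl).elim
    · obtain rfl : k = 0 := heq
      have hr : r = 0 := by
        by_contra hr
        exact not_meet_arm_run hA hr h.symm
      simp [idx, hr]
    · obtain rfl : k = k' := heq
      have := h.run_le hA hP.1
      simp only [idx]
      omega
  · obtain ⟨k, r, r', hk, -, rfl, rfl, -⟩ := h.symm.of_phase_lt hA hA hQ hP hlt
    obtain ⟨rfl, rfl⟩ := h.symm.run_succ hA hk hQ.2
    simp only [idx, add_mul]
    omega

theorem meet_chain_succ (hA : A.Valid S) {n : ℕ} (hn : n + 1 ≤ (S.d + 1) * (S.q + 1)) :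
    A.Meet S (chain S.q n) A (chain S.q (n + 1)) := by
  rcases n with _ | n
  · simpa [chain] using meet_arm_run hA
  obtain ⟨k, r, hr, rfl⟩ : ∃ k r, r ≤ S.q ∧ n = k * (S.q + 1) + r :=
    ⟨n / (S.q + 1), n % (S.q + 1), Nat.le_of_lt_succ (Nat.mod_lt _ (by omega)),
      (Nat.div_add_mod' _ _).symm⟩
  rw [chain_mul_add hr]
  have hk : k ≤ S.d := by
    by_contra hk
    have := Nat.mul_le_mul_right (S.q + 1) (not_le.1 hk)
    rw [Nat.succ_eq_add_one] at this
    omega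
  rcases Nat.lt_or_eq_of_le hr with hr | rfl
  · rw [show k * (S.q + 1) + r + 1 + 1 = k * (S.q + 1) + (r + 1) + 1 by ring, chain_mul_add hr]
    exact meet_run_run hA hk
  · have hk' : k < S.d := by
      refine lt_of_le_of_ne hk ?_
      rintro rfl
      rw [add_mul] at hn
      omega
    rw [show k * (S.q + 1) + S.q + 1 + 1 = (k + 1) * (S.q + 1) + 0 + 1 by ring,
      chain_mul_add (Nat.zero_le _)]
    exact meet_turn hA hk'

theorem meet_chain_iff (hA : A.Valid S) {n n' : ℕ} (hn : n ≤ (S.d + 1) * (S.q + 1))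
    (hn' : n' ≤ (S.d + 1) * (S.q + 1)) :
    A.Meet S (chain S.q n) A (chain S.q n') ↔ n = n' ∨ n + 1 = n' ∨ n' + 1 = n := by
  constructor
  · intro h
    have h1 := h.idx_le hA (chain_valid hn) (chain_valid hn') (chain_ne_hub _ _) (chain_ne_hub _ _)
    have h2 := h.symm.idx_le hA (chain_valid hn') (chain_valid hn) (chain_ne_hub _ _)
      (chain_ne_hub _ _)
    rw [idx_chain, idx_chain] at h1 h2
    omega
  · rintro (rfl | rfl | rfl)
    · exact meet_self _
    · exact meet_chain_succ hA hn'
    · exact (meet_chain_succ hA hn).symm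

theorem source_congr (hx : ∀ l < S.d, A.x l = B.x l)
    (hdig : ∀ l, 1 ≤ l → l < S.d → A.dig l = B.dig l) {l : ℕ} (hl : l < S.d) :
    A.source S l = B.source S l := by
  rcases Nat.eq_zero_or_pos l with rfl | h
  · rw [source_zero, source_zero, hx 0 hl]
  · rw [source_pos (by omega), source_pos (by omega), hx l hl, hdig l h hl]

/-- The box of a vertex meets exactly the first boxes of its routes. -/
theorem meet_hub_chain_iff (hA : A.Valid S) (hB : B.Valid S) {n : ℕ}
    (hn : n ≤ (S.d + 1) * (S.q + 1)) : A.Meet S .hub B (chain S.q n) ↔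
      n = 0 ∧ (∀ l < S.d, A.x l = B.x l) ∧ ∀ l, 1 ≤ l → l < S.d → A.dig l = B.dig l := by
  constructor
  · intro h
    have hv := chain_valid (S := S) hn
    rcases Nat.eq_zero_or_pos (chain S.q n).phase with h0 | h0
    · have hs := h.same_vertex hA hB (show RoutePart.Valid S .hub from trivial) hv rfl h0
      refine ⟨?_, hs⟩
      rcases n with _ | n
      · rfl
      · rw [chain] at h h0
        rw [RoutePart.phase] at h0
        rw [h0] at h
        exact (not_meet_hub_run hA hB h).elim
    · obtain ⟨k, r, r', -, -, h1, -⟩ :=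
        h.of_phase_lt hA hB (show RoutePart.Valid S .hub from trivial) hv h0
      simp at h1
  · rintro ⟨rfl, hx, hdig⟩
    exact meet_hub_arm hB fun l hl => source_congr hx hdig hl

/-- What can be concluded for the routes of two boxes that intersect. -/
theorem Meet.routes (hA : A.Valid S) (hB : B.Valid S) (hP : P.Valid S) (hQ : Q.Valid S)
    (h : A.Meet S P B Q) :
    ((P.phase = 0 ∧ Q.phase = 0) ∧
      (∀ l < S.d, A.x l = B.x l) ∧ ∀ l, 1 ≤ l → l < S.d → A.dig l = B.dig l) ∨
    (SameFamily S.d A B ∧ ((∀ l, 1 ≤ l → l < S.d → A.m l = B.m l) ∨ ∃ k, 1 ≤ k ∧ k < S.d ∧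
      (∀ l < k, A.m l = B.m l) ∧ ∀ l, k < l → l < S.d → A.dig l = B.dig l)) ∨
    ((P.phase = S.d ∧ Q.phase = S.d) ∧ (Opposite S.d A B ∨ Opposite S.d B A) ∧
      ∀ l, 1 ≤ l → l < S.d → A.m l = B.m l) := by
  have hlt : ∀ {A B : Strand} {P Q : RoutePart}, A.Valid S → B.Valid S → P.Valid S → Q.Valid S →
      A.Meet S P B Q → P.phase < Q.phase →
      SameFamily S.d A B ∧ ((∀ l, 1 ≤ l → l < S.d → A.m l = B.m l) ∨ ∃ k, 1 ≤ k ∧ k < S.d ∧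
      (∀ l < k, A.m l = B.m l) ∧ ∀ l, k < l → l < S.d → A.dig l = B.dig l) := by
    intro A B P Q hA hB hP hQ h hlt
    obtain ⟨k, r, r', hk, -, -, -, h1, h2, h3⟩ := h.of_phase_lt hA hB hP hQ hlt
    refine ⟨h1, ?_⟩
    by_cases hk1 : k + 1 = S.d
    · exact Or.inl fun l hl hld => h2 l (by omega) fun _ => hl
    · exact Or.inr ⟨k + 1, by omega, by omega, fun l hl => h2 l hl (by omega), h3⟩
  rcases lt_trichotomy P.phase Q.phase with h1 | h1 | h1
  · exact Or.inr (Or.inl (hlt hA hB hP hQ h h1))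
  · rcases Nat.eq_zero_or_pos P.phase with h0 | h0
    · exact Or.inl ⟨⟨h0, by omega⟩, h.same_vertex hA hB hP hQ h0 (by omega)⟩
    · obtain ⟨r, hPr⟩ := exists_run_of_phase_pos h0
      obtain ⟨r', hQr⟩ := exists_run_of_phase_pos (P := Q) (by omega)
      rw [← h1] at hQr
      generalize P.phase = k at *
      subst hPr hQr
      rcases Nat.lt_or_eq_of_le hP.1 with hk | rfl
      · obtain ⟨h2, h3, h4⟩ := h.parallel_mid hA hB h0 hk hP.2 hQ.2
        exact Or.inr (Or.inl ⟨h2, Or.inr ⟨k, h0, hk, h3, h4⟩⟩)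
      · obtain ⟨h2 | h2, h3⟩ := h.parallel_last hA hB hP.2 hQ.2
        · exact Or.inr (Or.inl ⟨h2, Or.inl h3⟩)
        · exact Or.inr (Or.inr ⟨⟨rfl, rfl⟩, h2, h3⟩)
  · obtain ⟨⟨h2, h3, h4⟩, h5⟩ := hlt hB hA hQ hP h.symm h1
    refine Or.inr (Or.inl ⟨⟨fun l hl => (h2 l hl).symm, h3.symm, h4.symm⟩, ?_⟩)
    rcases h5 with h5 | ⟨k, hk, hkd, h5, h6⟩
    · exact Or.inl fun l hl hld => (h5 l hl hld).symm
    · exact Or.inr ⟨k, hk, hkd, fun l hl => (h5 l hl).symm, fun l hl hld => (h6 l hl hld).symm⟩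

end Strand

/-! ### Integer coordinates -/

/-- The common denominator of the coordinates. -/
def Scale.denominator (S : Scale) : ℕ := 10 * S.W * S.q

/-- The distance between neighbouring cells in direction `l`, in lattice steps. -/
def Scale.spacing (S : Scale) (l : ℕ) : ℕ := if l = 0 then 4 * S.U else 2 * S.U

theorem Scale.denominator_pos (S : Scale) : 0 < S.denominator := by
  have h1 := S.Λ_le
  have h2 := S.sixteen_le_Λ
  have h3 := S.q_pos
  have : 0 < S.W := by omega
  unfold denominator
  positivity

namespace Strand

variable (S : Scale) (A B : Strand)

/-- The coordinates of the corner of a box, multiplied by the common denominator. -/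
def numerator (P : RoutePart) (l : ℕ) : ℤ :=
  if l = P.phase % S.d then
    match P with
    | .run k r => 10 * S.W * (S.q * A.startPos S k + (A.endPos S k - A.startPos S k) * r)
    | _ => S.denominator * (16 * A.source S 0)
  else S.denominator * (16 * A.lat S P.phase l) + S.q * (S.W * A.offTen S P l + A.offTilt S P l)

/-- The same route in another cell. -/
def translate (y : ℕ → ℤ) : Strand where
  x l := A.x l + y l
  dig := A.dig
  ty := A.ty
  neg := A.neg
  m := A.m
  lane := A.lane

variable {S A B}

theorem corner_eq (P : RoutePart) (l : ℕ) :
    A.corner S P l = (A.numerator S P l : ℝ) / S.denominator := by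
  have hD : (S.denominator : ℝ) ≠ 0 := by exact_mod_cast S.denominator_pos.ne'
  have hq : (S.q : ℝ) ≠ 0 := by exact_mod_cast S.q_pos.ne'
  have hW := (W_pos S).ne'
  have hD' : (S.denominator : ℝ) = 10 * S.W * S.q := by
    rw [Scale.denominator]
    push_cast
    rfl
  rw [eq_div_iff hD]
  unfold corner numerator
  split_ifs
  · rcases P with _ | _ | ⟨k, r⟩
    · simp only [along]
      push_cast
      ring
    · simp only [along]
      push_cast
      ring
    · simp only [along]
      rw [hD']
      push_cast
      field_simp
  · simp only [off]
    push_cast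
    rw [hD']
    field_simp

theorem source_translate (y : ℕ → ℤ) (l : ℕ) :
    (A.translate y).source S l = A.source S l + S.spacing l * y l := by
  unfold source translate Scale.spacing
  split_ifs with h
  · subst h
    push_cast
    ring
  · push_cast
    ring

theorem target_translate (y : ℕ → ℤ) (l : ℕ) :
    (A.translate y).target S l = A.target S l + S.spacing l * y l := by
  unfold target translate Scale.spacing shift g
  by_cases h : l = 0
  · subst h
    simp only [if_true]
    push_cast
    ring
  · simp only [if_neg h]
    push_cast
    ring

theorem final_translate (y : ℕ → ℤ) :
    (A.translate y).final S = A.final S + S.spacing 0 * y 0 := by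
  unfold final translate Scale.spacing
  push_cast
  ring

theorem first_translate (y : ℕ → ℤ) {k : ℕ} (hk : k ≤ S.d) :
    (A.translate y).first S k = A.first S k + S.spacing (k % S.d) * y (k % S.d) := by
  unfold first
  split_ifs with h
  · rw [source_translate, Nat.mod_eq_of_lt h]
  · obtain rfl : k = S.d := by omega
    rw [target_translate, Nat.mod_self]

theorem finish_translate (y : ℕ → ℤ) {k : ℕ} (hk : k ≤ S.d) :
    (A.translate y).finish S k = A.finish S k + S.spacing (k % S.d) * y (k % S.d) := by
  unfold finish
  split_ifs with h
  · rw [target_translate, Nat.mod_eq_of_lt h]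
  · obtain rfl : k = S.d := by omega
    rw [final_translate, Nat.mod_self]

theorem lat_translate (y : ℕ → ℤ) (k l : ℕ) :
    (A.translate y).lat S k l = A.lat S k l + S.spacing l * y l := by
  unfold lat
  split_ifs
  · exact target_translate y l
  · exact source_translate y l

theorem up_translate (y : ℕ → ℤ) {k : ℕ} (hk : k ≤ S.d) :
    (A.translate y).first S k < (A.translate y).finish S k ↔ A.first S k < A.finish S k := by
  rw [first_translate y hk, finish_translate y hk, add_lt_add_iff_right]

theorem tilt_translate (y : ℕ → ℤ) {k : ℕ} (hk : k ≤ S.d) :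
    (A.translate y).tilt S k = A.tilt S k := by
  unfold tilt
  simp only [up_translate y hk]
  rfl

theorem offTilt_translate (y : ℕ → ℤ) {P : RoutePart} (hP : P.Valid S) (l : ℕ) :
    (A.translate y).offTilt S P l = A.offTilt S P l := by
  rcases P with _ | _ | ⟨k, r⟩
  · rfl
  · rfl
  · simp only [offTilt]
    rw [tilt_translate y (Nat.zero_le _), tilt_translate y hP.1,
      tilt_translate y ((Nat.sub_le _ _).trans hP.1)]

theorem startPos_translate (y : ℕ → ℤ) {k : ℕ} (hk : k ≤ S.d) :
    (A.translate y).startPos S k = A.startPos S k + 16 * (S.spacing (k % S.d) * y (k % S.d)) := by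
  unfold startPos
  simp only [up_translate y hk]
  rw [first_translate y hk]
  split_ifs <;> ring

theorem endPos_translate (y : ℕ → ℤ) {k : ℕ} (hk : k ≤ S.d) :
    (A.translate y).endPos S k = A.endPos S k + 16 * (S.spacing (k % S.d) * y (k % S.d)) := by
  unfold endPos
  simp only [up_translate y hk]
  rw [finish_translate y hk]
  split_ifs <;> ring

theorem numerator_translate (y : ℕ → ℤ) {P : RoutePart} (hP : P.Valid S) {l : ℕ} :
    (A.translate y).numerator S P l =
      A.numerator S P l + (16 * S.spacing l * S.denominator : ℕ) * y l := by
  have hD' : (S.denominator : ℤ) = 10 * S.W * S.q := by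
    rw [Scale.denominator]
    push_cast
    rfl
  unfold numerator
  by_cases h : l = P.phase % S.d
  · rw [if_pos h, if_pos h]
    rcases P with _ | _ | ⟨k, r⟩
    · obtain rfl : l = 0 := by simpa [RoutePart.phase] using h
      simp only [source_translate]
      push_cast
      ring
    · obtain rfl : l = 0 := by simpa [RoutePart.phase] using h
      simp only [source_translate]
      push_cast
      ring
    · simp only [RoutePart.phase] at h
      simp only [startPos_translate y hP.1, endPos_translate y hP.1, ← h]
      push_cast
      rw [hD']
      ring
  · rw [if_neg h, if_neg h, lat_translate, offTilt_translate y hP]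
    have : (A.translate y).offTen S P l = A.offTen S P l := rfl
    rw [this]
    push_cast
    ring

theorem Valid.translate (hA : A.Valid S) (y : ℕ → ℤ) : (A.translate y).Valid S :=
  ⟨hA.dig_nonneg, hA.dig_lt, hA.m_nonneg, hA.m_lt, hA.ty_le, hA.lane_lt⟩

/-- In a cell with coordinates `1` all coordinates are nonnegative. -/
theorem Valid.numerator_nonneg (hA : A.Valid S) (hx : ∀ l, A.x l = 1) {P : RoutePart}
    (hP : P.Valid S) (l : ℕ) : 0 ≤ A.numerator S P l := by
  have hU := S.U_eq_int; have := S.Λ_le_int; have := S.sixteen_le_Λ_int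
  have hsrc : ∀ l, (S.U : ℤ) ≤ A.source S l := fun l => by
    have := hA.dig_nonneg l
    unfold source
    rw [hx, hx]
    split_ifs <;> linarith
  have htgt : ∀ l, (S.U : ℤ) ≤ A.target S l := fun l => by
    have := hA.g_nonneg l
    have := hA.g_nonneg 0
    unfold target
    rw [hx, hx]
    rcases A.shift_eq l with h | h <;> rw [h] <;> split_ifs <;> linarith
  have hfin : (S.U : ℤ) ≤ A.final S := by
    unfold final
    rw [hx]
    split_ifs <;> linarith
  have hlo : ∀ k, (S.U : ℤ) ≤ A.lo S k := fun k => by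
    unfold lo first finish
    split_ifs
    · exact le_min (hsrc k) (htgt k)
    · exact le_min (htgt 0) hfin
  have hlat : ∀ k, (S.U : ℤ) ≤ A.lat S k l := fun k => by
    unfold lat
    split_ifs
    · exact htgt l
    · exact hsrc l
  have hU' : (1 : ℝ) ≤ S.U := by
    have : (1 : ℤ) ≤ S.U := by linarith
    exact_mod_cast this
  have hD : (0 : ℝ) < S.denominator := by exact_mod_cast S.denominator_pos
  have key : 0 ≤ A.corner S P l := by
    unfold corner
    split_ifs
    · rcases P with _ | _ | ⟨k, r⟩
      · have : (S.U : ℝ) ≤ A.source S 0 := by exact_mod_cast hsrc 0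
        simp only [along]
        linarith
      · have : (S.U : ℝ) ≤ A.source S 0 := by exact_mod_cast hsrc 0
        simp only [along]
        linarith
      · have h1 := (hA.along_bounds hP.1 hP.2).1
        have : (S.U : ℝ) ≤ A.lo S k := by exact_mod_cast hlo k
        linarith
    · have h1 := (hA.off_range P l).1
      have : (S.U : ℝ) ≤ A.lat S P.phase l := by exact_mod_cast hlat P.phase
      linarith
  rw [corner_eq, le_div_iff₀ hD, zero_mul] at key
  exact_mod_cast key

end Strand

/-! ### Placing the vertices of a cell -/

theorem Nat.eq_of_digits_eq {b : ℕ} : ∀ (n : ℕ) {i j : ℕ}, i < b ^ n → j < b ^ n →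
    (∀ l < n, i / b ^ l % b = j / b ^ l % b) → i = j
  | 0, i, j, hi, hj, _ => by
    rw [pow_zero] at hi hj
    omega
  | n + 1, i, j, hi, hj, h => by
    have h0 := h 0 (by omega)
    rw [pow_zero, Nat.div_one, Nat.div_one] at h0
    have h1 : i / b = j / b := by
      refine Nat.eq_of_digits_eq (b := b) n (Nat.div_lt_of_lt_mul ?_) (Nat.div_lt_of_lt_mul ?_)
        fun l hl => ?_
      · rwa [← pow_succ']
      · rwa [← pow_succ']
      · rw [Nat.div_div_eq_div_mul, Nat.div_div_eq_div_mul, ← pow_succ']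
        exact h (l + 1) (by omega)
    rw [← Nat.div_add_mod i b, ← Nat.div_add_mod j b, h0, h1]

/-- The choices in the construction: the place `dig i` of the `i`-th vertex of a cell in the grid of
the remaining axes, and the intermediate positions of the edges of a matching. -/
structure Placement (S : Scale) (t : ℕ) where
  dig : Fin t → ℕ → ℕ
  pos : Finset (Fin t × Fin t) → Fin t × Fin t → ℕ → ℕ
  dig_lt : ∀ i l, dig i l < S.Λ
  dig_inj : ∀ i j, (∀ l, 1 ≤ l → l < S.d → dig i l = dig j l) → i = j
  pos_lt : ∀ μ e l, pos μ e l < S.M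
  separated : ∀ μ : Finset (Fin t × Fin t), Set.InjOn Prod.fst (μ : Set (Fin t × Fin t)) →
    Set.InjOn Prod.snd (μ : Set (Fin t × Fin t)) → ∀ e ∈ μ, ∀ e' ∈ μ, e ≠ e' →
    Separated S.d dig e e' (pos μ e) (pos μ e')

theorem Scale.M_pos (S : Scale) : 0 < S.M := by
  have h1 := S.Λ_le
  have h2 := S.sixteen_le_Λ
  have h3 := S.W_eq
  refine Nat.pos_of_ne_zero fun h => ?_
  rw [h, mul_zero] at h3
  omega

theorem exists_placement {S : Scale} {t : ℕ} (hM : 2 * S.d * S.Λ ≤ S.M)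
    (ht : t ≤ S.Λ ^ (S.d - 1)) : Nonempty (Placement S t) := by
  have hd := S.three_le_d
  have hΛ : 0 < S.Λ := by have := S.sixteen_le_Λ; omega
  let dig : Fin t → ℕ → ℕ := fun i l => i / S.Λ ^ (l - 1) % S.Λ
  have hdig : ∀ i l, dig i l < S.Λ := fun i l => Nat.mod_lt _ hΛ
  have hinj : ∀ i j, (∀ l, 1 ≤ l → l < S.d → dig i l = dig j l) → i = j := fun i j h => by
    refine Fin.ext (Nat.eq_of_digits_eq (b := S.Λ) (S.d - 1) (i.2.trans_le ht) (j.2.trans_le ht)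
      fun l hl => ?_)
    simpa [dig] using h (l + 1) (by omega) (by omega)
  have hpos : ∀ μ : Finset (Fin t × Fin t), ∃ c : Fin t × Fin t → ℕ → ℕ, (∀ e l, c e l < S.M) ∧
      (Set.InjOn Prod.fst (μ : Set (Fin t × Fin t)) → Set.InjOn Prod.snd (μ : Set (Fin t × Fin t)) →
        ∀ e ∈ μ, ∀ e' ∈ μ, e ≠ e' → Separated S.d dig e e' (c e) (c e')) := fun μ => by
    by_cases h : Set.InjOn Prod.fst (μ : Set (Fin t × Fin t)) ∧
      Set.InjOn Prod.snd (μ : Set (Fin t × Fin t))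
    · obtain ⟨c, h1, h2⟩ := exists_separated_positions (by omega) hM S.M_pos hdig hinj μ h.1 h.2
      exact ⟨c, h1, fun _ _ => h2⟩
    · exact ⟨fun _ _ => 0, fun _ _ => S.M_pos, fun h1 h2 => (h ⟨h1, h2⟩).elim⟩
  choose c h1 h2 using hpos
  exact ⟨⟨dig, c, hdig, hinj, h1, h2⟩⟩

/-! ### Cells and their views -/

/-- The part of the graph that is seen from a cell: for each position, `none` if it is empty, and
the list of the half-edges at its vertex otherwise. A half-edge is given by its type and by the
position of its other end. The types `2 * l` and `2 * l + 1` lead to the next and to the previous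
cell in direction `l`; the types `2 * d` and `2 * d + 1` lead to a larger and to a smaller position
of the same cell. -/
abbrev CellView (t : ℕ) := Fin t → Option (List (ℕ × Fin t))

namespace CellView

variable {S : Scale} {t : ℕ} (p : Placement S t) (σ : CellView t)

/-- The edge of a half-edge of type `T`; its front half has an even type. -/
def orient (T : ℕ) (i r : Fin t) : Fin t × Fin t := if T % 2 = 0 then (i, r) else (r, i)

open Classical in
/-- The edges of the half-edges of a given type. -/
noncomputable def matching (T : ℕ) : Finset (Fin t × Fin t) :=
  Finset.univ.filter fun e => ∃ i r, orient T i r = e ∧ ∃ l, σ i = some l ∧ (T, r) ∈ l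

/-- The route of the half-edge of type `a.1` from `i` to `a.2`, drawn for the cell with
coordinates `1`. -/
noncomputable def route (i : Fin t) (a : ℕ × Fin t) (lane : ℕ) : Strand where
  x _ := 1
  dig l := p.dig i l
  ty := a.1 / 2
  neg := decide (a.1 % 2 = 1)
  m l := p.pos (σ.matching a.1) (orient a.1 i a.2) l
  lane := lane

/-- A route that is used only for the place of its vertex. -/
def hubRoute (i : Fin t) : Strand where
  x _ := 1
  dig l := p.dig i l
  ty := 0
  neg := false
  m _ := 0
  lane := 0

/-- The names of the boxes drawn by a cell: `(i, none)` is the box of a vertex, and `(i, some (j,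
n))` is the `n`-th box of its `j`-th half-edge. -/
abbrev Label (t : ℕ) := Fin t × Option (ℕ × ℕ)

/-- The route that contains a box. For a name that does not occur it has no meaning. -/
noncomputable def labelRoute : Label t → Strand
  | (i, none) => hubRoute p i
  | (i, some (j, _)) => σ.route p i (((σ i).getD []).getD j (0, i)) j

/-- The place of a box in its route. -/
def labelPart (q : ℕ) : Label t → RoutePart
  | (_, none) => .hub
  | (_, some (_, n)) => .chain q n

/-- The names of all boxes of a cell. -/
def labels (N : ℕ) : List (Label t) :=
  (List.finRange t).flatMap fun i => match σ i with
    | none => []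
    | some l => (i, none) :: (List.range l.length).flatMap fun j =>
        (List.range (N + 1)).map fun n => (i, some (j, n))

theorem mem_labels_none {N : ℕ} {i : Fin t} : (i, none) ∈ σ.labels N ↔ ∃ l, σ i = some l := by
  simp only [labels, List.mem_flatMap, List.mem_finRange, true_and]
  constructor
  · rintro ⟨i', h⟩
    cases h' : σ i' with
    | none => simp [h'] at h
    | some l =>
      simp [h'] at h
      exact ⟨l, h ▸ h'⟩
  · rintro ⟨l, h⟩
    exact ⟨i, by simp [h]⟩

theorem mem_labels_some {N : ℕ} {i : Fin t} {j n : ℕ} :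
    (i, some (j, n)) ∈ σ.labels N ↔ ∃ l, σ i = some l ∧ j < l.length ∧ n ≤ N := by
  simp only [labels, List.mem_flatMap, List.mem_finRange, true_and]
  constructor
  · rintro ⟨i', h⟩
    cases h' : σ i' with
    | none => simp [h'] at h
    | some l =>
      simp [h'] at h
      obtain ⟨h1, h2, rfl⟩ := h
      exact ⟨l, h', h1, by omega⟩
  · rintro ⟨l, h, h1, h2⟩
    exact ⟨i, by simp [h]; omega⟩

theorem nodup_labels (N : ℕ) : (σ.labels N).Nodup := by
  rw [labels, List.nodup_flatMap]
  refine ⟨fun i _ => ?_, (List.nodup_finRange t).imp fun {i i'} hne => ?_⟩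
  · cases σ i with
    | none => exact List.nodup_nil
    | some l =>
      rw [List.nodup_cons, List.nodup_flatMap]
      refine ⟨by simp, fun j _ => List.nodup_range.map fun n n' h => by simpa using h,
        List.nodup_range.imp fun {j j'} hne => ?_⟩
      intro a ha ha'
      simp only [List.mem_map] at ha ha'
      obtain ⟨n, -, rfl⟩ := ha
      obtain ⟨n', -, h⟩ := ha'
      simp only [Prod.mk.injEq, Option.some.injEq, true_and] at h
      exact hne h.1.symm
  · intro a ha ha'
    have key : ∀ i, a ∈ (match σ i with
      | none => []
      | some l => (i, none) :: (List.range l.length).flatMap fun j =>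
        (List.range (N + 1)).map fun n => (i, some (j, n))) → a.1 = i := by
      intro i h
      cases h' : σ i with
      | none => simp [h'] at h
      | some l =>
        simp only [h', List.mem_cons, List.mem_flatMap, List.mem_map] at h
        rcases h with rfl | ⟨j, -, n, -, rfl⟩ <;> rfl
    exact hne ((key i ha).symm.trans (key i' ha'))

theorem valid_hubRoute (i : Fin t) : (hubRoute p i).Valid S where
  dig_nonneg l := by simp [hubRoute]
  dig_lt l := by simpa [hubRoute] using p.dig_lt i l
  m_nonneg l := le_rfl
  m_lt l := by simpa [hubRoute] using S.M_pos
  ty_le := Nat.zero_le _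
  lane_lt := by simp [hubRoute]

theorem valid_route (i : Fin t) {a : ℕ × Fin t} {lane : ℕ} (ha : a.1 ≤ 2 * S.d + 1)
    (hlane : lane < 3) : (σ.route p i a lane).Valid S where
  dig_nonneg l := by simp [route]
  dig_lt l := by simpa [route] using p.dig_lt i l
  m_nonneg l := by simp [route]
  m_lt l := by simpa [route] using p.pos_lt _ _ l
  ty_le := by simp only [route]; omega
  lane_lt := hlane

end CellView

/-! ### The type of a half-edge -/

variable {d s t : ℕ}

/-- The cell `y` is reached from `x` along a half-edge of type `T`. -/
def Step (T : ℕ) (x y : Fin d → Fin s) : Prop :=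
  ∀ j : Fin d, ((y j : ℕ) : ℤ) = (x j : ℕ) + if T / 2 = j then (if T % 2 = 0 then 1 else -1) else 0

theorem Step.unique {T : ℕ} {x y y' : Fin d → Fin s} (h : Step T x y) (h' : Step T x y') :
    y = y' := funext fun j => Fin.ext (by
  have h1 := h j
  rw [← h' j] at h1
  exact_mod_cast h1)

theorem Step.eq_iff {T : ℕ} {x y : Fin d → Fin s} (h : Step T x y) : x = y ↔ d ≤ T / 2 := by
  constructor
  · rintro rfl
    by_contra hlt
    have h1 := h ⟨T / 2, by omega⟩
    simp only [if_true] at h1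
    split_ifs at h1 <;> omega
  · intro hT
    funext j
    have h1 := h j
    rw [if_neg (by omega)] at h1
    exact Fin.ext (by omega)

theorem exists_step_of_adj {x y : Fin d → Fin s} (h : (gridGraph d s).Adj x y) :
    ∃ j : Fin d, Step (2 * j) x y ∨ Step (2 * j + 1) x y := by
  have h : ∑ i, (((x i : ℕ) : ℤ) - ((y i : ℕ) : ℤ)) ^ 2 = 1 := h
  obtain ⟨j, hj⟩ : ∃ j, ((x j : ℕ) : ℤ) - ((y j : ℕ) : ℤ) ≠ 0 := by
    by_contra! hc
    simp [hc] at h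
  have h1 := Finset.add_sum_erase Finset.univ
    (fun i => (((x i : ℕ) : ℤ) - ((y i : ℕ) : ℤ)) ^ 2) (Finset.mem_univ j)
  have h2 : 0 ≤ ∑ i ∈ Finset.univ.erase j, (((x i : ℕ) : ℤ) - ((y i : ℕ) : ℤ)) ^ 2 :=
    Finset.sum_nonneg fun i _ => sq_nonneg _
  have h3 : 1 ≤ (((x j : ℕ) : ℤ) - ((y j : ℕ) : ℤ)) ^ 2 := by
    have := sq_pos_of_ne_zero hj
    omega
  have h4 : ∑ i ∈ Finset.univ.erase j, (((x i : ℕ) : ℤ) - ((y i : ℕ) : ℤ)) ^ 2 = 0 := by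
    linarith
  have h5 : (((x j : ℕ) : ℤ) - ((y j : ℕ) : ℤ)) ^ 2 = 1 := by
    linarith
  have h6 : ∀ i, i ≠ j → (y i : ℕ) = x i := fun i hi => by
    have := (Finset.sum_eq_zero_iff_of_nonneg fun i _ => sq_nonneg _).1 h4 i (by simp [hi])
    have := pow_eq_zero_iff (two_ne_zero) |>.1 this
    omega
  refine ⟨j, ?_⟩
  rcases sq_eq_one_iff.1 h5 with h7 | h7
  · right
    intro i
    rw [show (2 * (j : ℕ) + 1) / 2 = j by omega, if_neg (by omega : ¬ (2 * (j : ℕ) + 1) % 2 = 0)]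
    split_ifs with hi
    · obtain rfl : j = i := Fin.ext hi
      omega
    · rw [h6 i fun h => hi (by rw [h])]
      simp
  · left
    intro i
    rw [show (2 * (j : ℕ)) / 2 = j by omega, if_pos (by omega : (2 * (j : ℕ)) % 2 = 0)]
    split_ifs with hi
    · obtain rfl : j = i := Fin.ext hi
      omega
    · rw [h6 i fun h => hi (by rw [h])]
      simp

/-- The number of a cell. -/
def cellNumber (x : Fin d → Fin s) : ℕ := finFunctionFinEquiv x

theorem cellNumber_eq (x : Fin d → Fin s) : cellNumber x = ∑ j, (x j : ℕ) * s ^ (j : ℕ) :=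
  finFunctionFinEquiv_apply x

theorem cellNumber_inj {x y : Fin d → Fin s} : cellNumber x = cellNumber y ↔ x = y := by
  rw [cellNumber, cellNumber, Fin.val_inj, finFunctionFinEquiv.apply_eq_iff_eq]

theorem Step.cellNumber {T : ℕ} {x y : Fin d → Fin s} (h : Step T x y) (hT : T / 2 < d) :
    (_root_.cellNumber y : ℤ) =
      _root_.cellNumber x + (if T % 2 = 0 then 1 else -1) * (s : ℤ) ^ (T / 2) := by
  rw [cellNumber_eq, cellNumber_eq]
  push_cast
  simp only [h _, add_mul, Finset.sum_add_distrib, ite_mul, zero_mul]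
  congr 1
  rw [Finset.sum_eq_single ⟨T / 2, hT⟩]
  · simp
  · intro j _ hj
    rw [if_neg fun h => hj (Fin.ext h.symm)]
  · simp

theorem directionCode_eq {z c T : ℕ} (hs : 2 ≤ s)
    (h : (c : ℤ) = z + (if T % 2 = 0 then 1 else -1) * (s : ℤ) ^ (T / 2)) :
    ∀ j, T / 2 < j → directionCode s z c j = T
  | 0, hj => by omega
  | j + 1, hj => by
    have hpos : ∀ l, 0 < s ^ l := fun l => Nat.pos_of_ne_zero (by positivity)
    have hinj : ∀ l, s ^ l = s ^ (T / 2) → l = T / 2 := fun l hl => Nat.pow_right_injective hs hl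
    have h1 := hpos j
    have h2 := hpos (T / 2)
    rw [directionCode]
    by_cases hT : T % 2 = 0
    · have h' : c = z + s ^ (T / 2) := by
        rw [if_pos hT, one_mul] at h
        exact_mod_cast h
      by_cases hjT : j = T / 2
      · rw [if_pos (by rw [h', hjT])]
        omega
      · rw [if_neg fun hc => hjT (hinj j (by omega)), if_neg (by omega)]
        exact directionCode_eq hs h j (by omega)
    · have h' : z = c + s ^ (T / 2) := by
        rw [if_neg hT] at h
        have : (z : ℤ) = c + (s : ℤ) ^ (T / 2) := by linarith
        exact_mod_cast this
      by_cases hjT : j = T / 2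
      · rw [if_neg (by omega), if_pos (by rw [h', hjT])]
        omega
      · rw [if_neg (by omega), if_neg fun hc => hjT (hinj j (by omega))]
        exact directionCode_eq hs h j (by omega)

/-- The type of the half-edge from `v` to `u`. -/
def halfType (v u : BlowupVertex d s t) : ℕ :=
  typeCode d s (cellNumber v.1) v.2 (cellNumber u.1) u.2

theorem halfType_lt (v u : BlowupVertex d s t) : halfType v u < 2 * d + 2 := typeCode_lt _ _ _ _ _ _

theorem halfType_eq_of_eq {v u : BlowupVertex d s t} (h : v.1 = u.1) :
    halfType v u = if v.2 < u.2 then 2 * d else 2 * d + 1 := by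
  simp [halfType, typeCode, h]

theorem step_halfType {v u : BlowupVertex d s t} (h : (blownUpCube d s t).Adj v u) :
    Step (halfType v u) v.1 u.1 := by
  by_cases he : v.1 = u.1
  · rw [halfType_eq_of_eq he, he]
    intro j
    have : ¬ (if v.2 < u.2 then 2 * d else 2 * d + 1) / 2 = (j : ℕ) := by split_ifs <;> omega
    rw [if_neg this, add_zero]
  · obtain ⟨j, hj⟩ := exists_step_of_adj (h.2.resolve_left he)
    obtain ⟨T, hT, hTd⟩ : ∃ T, Step T v.1 u.1 ∧ T / 2 < d := by
      rcases hj with hj | hj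
      · exact ⟨_, hj, by omega⟩
      · exact ⟨_, hj, by omega⟩
    have hs : 2 ≤ s := by
      by_contra hs
      refine he (funext fun j => Fin.ext ?_)
      have h1 := (v.1 j).2
      have h2 := (u.1 j).2
      omega
    have hne : cellNumber u.1 ≠ cellNumber v.1 := fun h => he (cellNumber_inj.1 h).symm
    rw [halfType, typeCode, if_neg hne, directionCode_eq hs (hT.cellNumber hTd) d hTd]
    exact hT

/-- The two halves of an edge have types that differ only in the last bit. -/
theorem halfType_symm {v u : BlowupVertex d s t} (h : (blownUpCube d s t).Adj v u) :
    halfType u v / 2 = halfType v u / 2 ∧ (halfType u v % 2 = 0 ↔ ¬ halfType v u % 2 = 0) := by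
  by_cases he : v.1 = u.1
  · have hne : v.2 ≠ u.2 := fun h' => h.1 (Prod.ext he h')
    rw [halfType_eq_of_eq he, halfType_eq_of_eq he.symm]
    rcases lt_or_gt_of_ne hne with hlt | hlt
    · rw [if_pos hlt, if_neg (not_lt.2 hlt.le)]
      omega
    · rw [if_neg (not_lt.2 hlt.le), if_pos hlt]
      omega
  · have h1 := step_halfType h
    have h2 := step_halfType h.symm
    have hT : halfType v u / 2 < d := not_le.1 (mt h1.eq_iff.2 he)
    have e1 := h1 ⟨_, hT⟩
    have e2 := h2 ⟨_, hT⟩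
    simp only [if_true] at e1 e2
    split_ifs at e1 e2 <;> omega

/-! ### The boxes of a graph -/

section Graph

variable {S : Scale} {s t : ℕ} (p : Placement S t) (G : (blownUpCube S.d s t).Subgraph)
  (nb : BlowupVertex S.d s t → List (BlowupVertex S.d s t))

open Classical in
/-- The view from a cell of the cube. -/
noncomputable def view (x : Fin S.d → Fin s) : CellView t := fun i =>
  if (x, i) ∈ G.verts then some ((nb (x, i)).map fun u => (halfType (x, i) u, u.2)) else none

/-- The coordinates of a cell, continued by zeros. -/
def extend {d : ℕ} (x : Fin d → Fin s) (l : ℕ) : ℕ := if h : l < d then x ⟨l, h⟩ else 0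

theorem extend_inj {d : ℕ} {x y : Fin d → Fin s} (h : ∀ l < d, extend x l = extend y l) :
    x = y := by
  funext j
  have := h j j.2
  simp only [extend, j.2, dif_pos] at this
  exact Fin.ext this

/-- The vertices of `G` and of its subdivision name the boxes. -/
abbrev BoxName (N : ℕ) : Type := G.verts ⊕ G.coe.Dart × Fin (N + 1)

variable {G}

/-- The cell that draws a box. -/
def BoxName.cell {N : ℕ} : BoxName G N → Fin S.d → Fin s
  | .inl v => v.1.1
  | .inr (δ, _) => δ.fst.1.1

/-- The index of a half-edge in the adjacency list of its vertex. -/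
def laneOf (δ : G.coe.Dart) : ℕ := (nb δ.fst.1).idxOf δ.snd.1

/-- The name of a box inside the cell that draws it. -/
def BoxName.label {N : ℕ} : BoxName G N → CellView.Label t
  | .inl v => (v.1.2, none)
  | .inr (δ, n) => (δ.fst.1.2, some (laneOf nb δ, n))

variable (G) in
/-- The route that contains the box with name `a` in the cell `x`. -/
noncomputable def labelStrand (x : Fin S.d → Fin s) (a : CellView.Label t) : Strand :=
  ((view G nb x).labelRoute p a).translate fun l => extend x l

/-- The route that contains a box. -/
noncomputable def BoxName.strand {N : ℕ} (w : BoxName G N) : Strand :=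
  labelStrand p G nb w.cell (w.label nb)

/-- The type of a half-edge of `G`. -/
def dartType (δ : G.coe.Dart) : ℕ := halfType δ.fst.1 δ.snd.1

/-- The route of a half-edge of `G`. -/
noncomputable def dartStrand (δ : G.coe.Dart) : Strand :=
  ((view G nb δ.fst.1.1).route p δ.fst.1.2 (dartType δ, δ.snd.1.2) (laneOf nb δ)).translate
    fun l => extend δ.fst.1.1 l

/-- A route that is used only for the place of the vertex `v`. -/
noncomputable def hubStrand (v : BlowupVertex S.d s t) : Strand :=
  (CellView.hubRoute p v.2).translate fun l => extend v.1 l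

variable {p nb}

theorem dart_adj (δ : G.coe.Dart) : G.Adj δ.fst.1 δ.snd.1 := δ.adj

theorem laneOf_lt (hnb : IsAdjacencyLists G nb) (δ : G.coe.Dart) :
    laneOf nb δ < (nb δ.fst.1).length :=
  List.idxOf_lt_length_of_mem (((hnb _).2 _).2 (dart_adj δ))

theorem length_le_three (hnb : IsAdjacencyLists G nb) (hdeg : ∀ v, (G.neighborSet v).ncard ≤ 3)
    (v : BlowupVertex S.d s t) : (nb v).length ≤ 3 := by
  have h : G.neighborSet v = ((nb v).toFinset : Set (BlowupVertex S.d s t)) := by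
    ext u
    simp [(hnb v).2]
  rw [← List.toFinset_card_of_nodup (hnb v).1, ← Set.ncard_coe_finset, ← h]
  exact hdeg v

theorem labelRoute_dart (hnb : IsAdjacencyLists G nb) (δ : G.coe.Dart) (n : ℕ) :
    (view G nb δ.fst.1.1).labelRoute p (δ.fst.1.2, some (laneOf nb δ, n)) =
      (view G nb δ.fst.1.1).route p δ.fst.1.2 (dartType δ, δ.snd.1.2) (laneOf nb δ) := by
  have h1 : (δ.fst.1.1, δ.fst.1.2) ∈ G.verts := δ.fst.2
  have h2 := laneOf_lt hnb δ
  have h3 : (view G nb δ.fst.1.1 δ.fst.1.2) =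
      some ((nb δ.fst.1).map fun u => (halfType δ.fst.1 u, u.2)) := if_pos h1
  rw [CellView.labelRoute, h3]
  congr 1
  rw [Option.getD_some, List.getD_eq_getElem _ _ (by simpa using h2), List.getElem_map]
  have h4 : (nb δ.fst.1)[laneOf nb δ] = δ.snd.1 := List.getElem_idxOf h2
  rw [h4, dartType]

theorem strand_inr (hnb : IsAdjacencyLists G nb) {N : ℕ} (δ : G.coe.Dart) (n : Fin (N + 1)) :
    BoxName.strand p nb (.inr (δ, n)) = dartStrand p nb δ := by
  rw [BoxName.strand, labelStrand, dartStrand, ← labelRoute_dart hnb δ n]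
  rfl

theorem valid_dartStrand (hnb : IsAdjacencyLists G nb) (hdeg : ∀ v, (G.neighborSet v).ncard ≤ 3)
    (δ : G.coe.Dart) : (dartStrand p nb δ).Valid S := by
  have h1 := laneOf_lt hnb δ
  have h2 := length_le_three hnb hdeg δ.fst.1
  have h3 := halfType_lt δ.fst.1 δ.snd.1
  exact (CellView.valid_route p _ _ (Nat.le_of_lt_succ h3) (by omega)).translate _

theorem valid_hubStrand (v : BlowupVertex S.d s t) : (hubStrand p v).Valid S :=
  (CellView.valid_hubRoute p _).translate _

variable (hsep : ∀ v u u', G.Adj v u → G.Adj v u' → u ≠ u' → u.1 ≠ u'.1)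

include hsep in
theorem eq_of_adj_of_cell_eq {v u u' : BlowupVertex S.d s t} (h : G.Adj v u) (h' : G.Adj v u')
    (hc : u.1 = u'.1) : u = u' := by
  by_contra hne
  exact hsep v u u' h h' hne hc

theorem mem_matching (hnb : IsAdjacencyLists G nb) {x : Fin S.d → Fin s} {T : ℕ}
    {e : Fin t × Fin t} : e ∈ (view G nb x).matching T ↔
      ∃ i u, CellView.orient T i u.2 = e ∧ G.Adj (x, i) u ∧ halfType (x, i) u = T := by
  simp only [CellView.matching, Finset.mem_filter, Finset.mem_univ, true_and]
  constructor
  · rintro ⟨i, r, rfl, l, h, hl⟩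
    rw [view] at h
    split_ifs at h with hv
    obtain rfl := Option.some_injective _ h
    obtain ⟨u, hu, hu'⟩ := List.mem_map.1 hl
    simp only [Prod.mk.injEq] at hu'
    exact ⟨i, u, by rw [hu'.2], ((hnb _).2 _).1 hu, hu'.1⟩
  · rintro ⟨i, u, rfl, h, hT⟩
    refine ⟨i, u.2, rfl, _, if_pos (G.edge_vert h), List.mem_map.2 ⟨u, ((hnb _).2 _).2 h, ?_⟩⟩
    rw [hT]

include hsep in
/-- Two half-edges of the same type from the same cell are equal if they have an end in common. -/
theorem halfEdge_unique {x : Fin S.d → Fin s} {i i' : Fin t} {u u' : BlowupVertex S.d s t}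
    (h : G.Adj (x, i) u) (h' : G.Adj (x, i') u') (hT : halfType (x, i) u = halfType (x, i') u')
    (hi : i = i' ∨ u.2 = u'.2) : i = i' ∧ u = u' := by
  have hu : u.1 = u'.1 := by
    have h1 := step_halfType (G.adj_sub h)
    have h2 := step_halfType (G.adj_sub h')
    rw [← hT] at h2
    exact h1.unique h2
  rcases hi with rfl | hi
  · exact ⟨rfl, eq_of_adj_of_cell_eq hsep h h' hu⟩
  · obtain rfl : u = u' := Prod.ext hu hi
    have := eq_of_adj_of_cell_eq hsep h.symm h'.symm rfl
    exact ⟨by simpa using this, rfl⟩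

theorem CellView.orient_inj {T : ℕ} {i r i' r' : Fin t} (h : orient T i r = orient T i' r') :
    i = i' ∧ r = r' := by
  unfold orient at h
  split_ifs at h <;> simp_all

include hsep in
theorem injOn_matching (hnb : IsAdjacencyLists G nb) (x : Fin S.d → Fin s) (T : ℕ) :
    Set.InjOn Prod.fst ((view G nb x).matching T : Set (Fin t × Fin t)) ∧
    Set.InjOn Prod.snd ((view G nb x).matching T : Set (Fin t × Fin t)) := by
  constructor
  all_goals
    intro e he e' he' hee
    rw [Finset.mem_coe, mem_matching hnb] at he he'
    obtain ⟨i, u, rfl, h, hT⟩ := he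
    obtain ⟨i', u', rfl, h', hT'⟩ := he'
    have hor : i = i' ∨ u.2 = u'.2 := by
      unfold CellView.orient at hee
      split_ifs at hee
      · first | exact Or.inl hee | exact Or.inr hee
      · first | exact Or.inl hee | exact Or.inr hee
    obtain ⟨rfl, rfl⟩ := halfEdge_unique hsep h h' (hT.trans hT'.symm) hor
    rfl

theorem orient_symm {T T' : ℕ} (h : T' % 2 = 0 ↔ ¬ T % 2 = 0) (i r : Fin t) :
    CellView.orient T' r i = CellView.orient T i r := by
  unfold CellView.orient
  by_cases hT : T % 2 = 0
  · rw [if_pos hT, if_neg fun hc => h.1 hc hT]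
  · rw [if_neg hT, if_pos (h.2 hT)]

/-- Both ends of an edge see the same matching. -/
theorem matching_symm (hnb : IsAdjacencyLists G nb) {v u : BlowupVertex S.d s t}
    (h : G.Adj v u) : (view G nb v.1).matching (halfType v u) =
      (view G nb u.1).matching (halfType u v) := by
  have key : ∀ {v u : BlowupVertex S.d s t}, G.Adj v u →
      (view G nb v.1).matching (halfType v u) ⊆ (view G nb u.1).matching (halfType u v) := by
    intro v u h e he
    rw [mem_matching hnb] at he ⊢
    obtain ⟨i, w, rfl, hw, hT⟩ := he
    have h1 := step_halfType (G.adj_sub h)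
    have h2 := step_halfType (G.adj_sub hw)
    rw [hT] at h2
    have hwu : w = (u.1, w.2) := Prod.ext (h1.unique h2).symm rfl
    have h3 := halfType_symm (G.adj_sub h)
    have h4 := halfType_symm (G.adj_sub hw)
    rw [hT] at h4
    refine ⟨w.2, (v.1, i), orient_symm h3.2 _ _, ?_, ?_⟩
    · rw [← hwu]
      exact hw.symm
    · rw [← hwu]
      omega
  exact (key h).antisymm (key h.symm)

variable (p nb) in
/-- The intermediate position of an edge, as chosen by one of its ends. -/
theorem dartStrand_m (δ : G.coe.Dart) (l : ℕ) : (dartStrand p nb δ).m l =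
    p.pos ((view G nb δ.fst.1.1).matching (dartType δ))
      (CellView.orient (dartType δ) δ.fst.1.2 δ.snd.1.2) l := rfl

theorem orient_mem_matching (hnb : IsAdjacencyLists G nb) (δ : G.coe.Dart) :
    CellView.orient (dartType δ) δ.fst.1.2 δ.snd.1.2 ∈
      (view G nb δ.fst.1.1).matching (dartType δ) :=
  (mem_matching hnb).2 ⟨_, _, rfl, dart_adj δ, rfl⟩

theorem dart_ext {δ δ' : G.coe.Dart} (h : δ.fst.1 = δ'.fst.1) (h' : δ.snd.1 = δ'.snd.1) : δ = δ' :=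
  SimpleGraph.Dart.ext _ _ (Prod.ext (Subtype.ext h) (Subtype.ext h'))

theorem cell_eq_of_x {A B : Strand} {x y : Fin S.d → Fin s} (hA : ∀ l, A.x l = 1 + extend x l)
    (hB : ∀ l, B.x l = 1 + extend y l) (h : ∀ l < S.d, A.x l = B.x l) : x = y :=
  extend_inj fun l hl => by
    have := h l hl
    rw [hA, hB] at this
    omega

end Graph

/-! ### Which boxes of a graph intersect -/

section Graph

variable {S : Scale} {s t : ℕ} {p : Placement S t} {G : (blownUpCube S.d s t).Subgraph}
  {nb : BlowupVertex S.d s t → List (BlowupVertex S.d s t)}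
  (hnb : IsAdjacencyLists G nb) (hdeg : ∀ v, (G.neighborSet v).ncard ≤ 3)
  (hsep : ∀ v u u', G.Adj v u → G.Adj v u' → u ≠ u' → u.1 ≠ u'.1)

theorem dartStrand_x (δ : G.coe.Dart) (l : ℕ) :
    (dartStrand p nb δ).x l = 1 + extend δ.fst.1.1 l := rfl

theorem hubStrand_x (v : BlowupVertex S.d s t) (l : ℕ) :
    (hubStrand p v).x l = 1 + extend v.1 l := rfl

theorem dig_inj {i i' : Fin t} (h : ∀ l, 1 ≤ l → l < S.d → (p.dig i l : ℤ) = p.dig i' l) :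
    i = i' :=
  p.dig_inj _ _ fun l hl hld => by exact_mod_cast h l hl hld

include hnb hsep in
/-- Edges of the same family have separated intermediate positions. -/
theorem separated_of_matching_eq {δ δ' : G.coe.Dart}
    (hμ : (view G nb δ.fst.1.1).matching (dartType δ) =
      (view G nb δ'.fst.1.1).matching (dartType δ'))
    (he : CellView.orient (dartType δ) δ.fst.1.2 δ.snd.1.2 ≠
      CellView.orient (dartType δ') δ'.fst.1.2 δ'.snd.1.2) :
    Separated S.d p.dig (CellView.orient (dartType δ) δ.fst.1.2 δ.snd.1.2)
      (CellView.orient (dartType δ') δ'.fst.1.2 δ'.snd.1.2)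
      (fun l => p.pos ((view G nb δ.fst.1.1).matching (dartType δ))
        (CellView.orient (dartType δ) δ.fst.1.2 δ.snd.1.2) l)
      (fun l => p.pos ((view G nb δ'.fst.1.1).matching (dartType δ'))
        (CellView.orient (dartType δ') δ'.fst.1.2 δ'.snd.1.2) l) := by
  have h := injOn_matching hsep hnb δ.fst.1.1 (dartType δ)
  rw [← hμ]
  exact p.separated _ h.1 h.2 _ (orient_mem_matching hnb δ) _
    (hμ ▸ orient_mem_matching hnb δ') he

/-- Half-edges of the same cell and the same direction are of the same type. -/
theorem Strand.SameFamily.dart {δ δ' : G.coe.Dart}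
    (h : Strand.SameFamily S.d (dartStrand p nb δ) (dartStrand p nb δ')) :
    δ.fst.1.1 = δ'.fst.1.1 ∧ δ.snd.1.1 = δ'.snd.1.1 ∧ dartType δ = dartType δ' := by
  have h1 := cell_eq_of_x (dartStrand_x δ) (dartStrand_x δ') h.x
  have hT : dartType δ = dartType δ' := by
    have h2 : dartType δ / 2 = dartType δ' / 2 := h.ty
    have h3 : (dartType δ % 2 = 1) = (dartType δ' % 2 = 1) := by
      have : decide (dartType δ % 2 = 1) = decide (dartType δ' % 2 = 1) := h.neg
      simpa using this
    have h4 : dartType δ % 2 = 1 ↔ dartType δ' % 2 = 1 := h3 ▸ Iff.rfl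
    omega
  have h2 : Step (dartType δ) δ.fst.1.1 δ.snd.1.1 := step_halfType (G.adj_sub (dart_adj δ))
  have h3 : Step (dartType δ') δ'.fst.1.1 δ'.snd.1.1 := step_halfType (G.adj_sub (dart_adj δ'))
  rw [← hT, ← h1] at h3
  exact ⟨h1, h2.unique h3, hT⟩

include hnb hsep in
/-- Routes of the same family that agree in all data relevant for some phase are equal. -/
theorem dart_eq_of_sameFamily {δ δ' : G.coe.Dart}
    (h : Strand.SameFamily S.d (dartStrand p nb δ) (dartStrand p nb δ'))
    (h' : (∀ l, 1 ≤ l → l < S.d → (dartStrand p nb δ).m l = (dartStrand p nb δ').m l) ∨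
      ∃ k, 1 ≤ k ∧ k < S.d ∧ (∀ l < k, (dartStrand p nb δ).m l = (dartStrand p nb δ').m l) ∧
        ∀ l, k < l → l < S.d → (dartStrand p nb δ).dig l = (dartStrand p nb δ').dig l) :
    δ = δ' := by
  obtain ⟨h1, h2, hT⟩ := h.dart
  by_contra hne
  have he : CellView.orient (dartType δ) δ.fst.1.2 δ.snd.1.2 ≠
      CellView.orient (dartType δ') δ'.fst.1.2 δ'.snd.1.2 := fun he => by
    rw [← hT] at he
    have h3 := CellView.orient_inj he
    exact hne (dart_ext (Prod.ext h1 h3.1) (Prod.ext h2 h3.2))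
  have hs := separated_of_matching_eq (p := p) hnb hsep (by rw [h1, hT]) he
  rcases h' with h' | ⟨k, hk, hkd, h', h''⟩
  · exact hs.last fun l hl hld => Int.ofNat_inj.1 (h' l hl hld)
  · have hm : ∀ l < k, p.pos ((view G nb δ.fst.1.1).matching (dartType δ))
        (CellView.orient (dartType δ) δ.fst.1.2 δ.snd.1.2) l =
        p.pos ((view G nb δ'.fst.1.1).matching (dartType δ'))
        (CellView.orient (dartType δ') δ'.fst.1.2 δ'.snd.1.2) l := fun l hl =>
      Int.ofNat_inj.1 (h' l hl)
    have hdig : ∀ l, k < l → l < S.d → p.dig δ.fst.1.2 l = p.dig δ'.fst.1.2 l :=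
      fun l hl hld => Int.ofNat_inj.1 (h'' l hl hld)
    by_cases hpar : dartType δ % 2 = 0
    · refine hs.fst k hk hkd ⟨hm, fun l hl hld => ?_⟩
      rw [CellView.orient, CellView.orient, ← hT, if_pos hpar, if_pos hpar]
      exact hdig l hl hld
    · refine hs.snd k hk hkd ⟨hm, fun l hl hld => ?_⟩
      rw [CellView.orient, CellView.orient, ← hT, if_neg hpar, if_neg hpar]
      exact hdig l hl hld

include hnb hsep in
/-- If two half-edges head for the same place from opposite sides, they are the halves of an edge.
-/
theorem dart_eq_symm_of_opposite {δ δ' : G.coe.Dart}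
    (h : Strand.Opposite S.d (dartStrand p nb δ) (dartStrand p nb δ'))
    (hm : ∀ l, 1 ≤ l → l < S.d → (dartStrand p nb δ).m l = (dartStrand p nb δ').m l) :
    δ' = δ.symm := by
  have hd := S.three_le_d
  have hpar : dartType δ % 2 = 0 := by
    have : decide (dartType δ % 2 = 1) = false := h.negA
    simp only [decide_eq_false_iff_not] at this
    omega
  have hpar' : dartType δ' % 2 = 1 := by
    have : decide (dartType δ' % 2 = 1) = true := h.negB
    simpa using this
  have hty : dartType δ / 2 = dartType δ' / 2 := h.ty
  have h2 : Step (dartType δ) δ.fst.1.1 δ.snd.1.1 := step_halfType (G.adj_sub (dart_adj δ))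
  have h3 : Step (dartType δ') δ'.fst.1.1 δ'.snd.1.1 := step_halfType (G.adj_sub (dart_adj δ'))
  have hx : ∀ j : Fin S.d, ((δ'.fst.1.1 j : ℕ) : ℤ) =
      (δ.fst.1.1 j : ℕ) + if dartType δ / 2 = j then 1 else 0 := fun j => by
    have h4 := h.x j j.2
    rw [dartStrand_x, dartStrand_x] at h4
    have h5 : (dartStrand p nb δ').shift j = if dartType δ / 2 = j then 1 else 0 := by
      rw [Strand.shift, h.negB, ← h.ty]
      simp [dartStrand, Strand.translate, CellView.route]
    rw [h5] at h4
    simp only [extend, j.2, dif_pos] at h4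
    linarith
  have hc : δ'.fst.1.1 = δ.snd.1.1 := by
    refine Step.unique (T := dartType δ) (x := δ.fst.1.1) (fun j => ?_) h2
    rw [if_pos hpar]
    exact hx j
  have hc' : δ'.snd.1.1 = δ.fst.1.1 := by
    refine h3.unique fun j => ?_
    rw [if_neg (show ¬ dartType δ' % 2 = 0 by omega), ← hty, hx j]
    split_ifs <;> ring
  -- all edges between these two cells belong to one matching
  have hsymm := halfType_symm (G.adj_sub (dart_adj δ))
  have hTs : halfType δ.snd.1 δ.fst.1 = dartType δ' := by
    have h6 : halfType δ.snd.1 δ.fst.1 % 2 = 0 ↔ ¬ dartType δ % 2 = 0 := hsymm.2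
    have h7 : halfType δ.snd.1 δ.fst.1 / 2 = dartType δ / 2 := hsymm.1
    omega
  have hμ : (view G nb δ.fst.1.1).matching (dartType δ) =
      (view G nb δ'.fst.1.1).matching (dartType δ') := by
    rw [hc, ← hTs]
    exact matching_symm hnb (dart_adj δ)
  have he : CellView.orient (dartType δ) δ.fst.1.2 δ.snd.1.2 =
      CellView.orient (dartType δ') δ'.fst.1.2 δ'.snd.1.2 := by
    by_contra he
    exact (separated_of_matching_eq (p := p) hnb hsep hμ he).last fun l hl hld => 
      Int.ofNat_inj.1 (hm l hl hld)
  rw [CellView.orient, CellView.orient, if_pos hpar, if_neg (by omega)] at he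
  simp only [Prod.mk.injEq] at he
  exact dart_ext (Prod.ext hc he.2.symm) (Prod.ext hc' he.1.symm)

include hnb in
theorem dartStrand_m_symm (δ : G.coe.Dart) (l : ℕ) :
    (dartStrand p nb δ).m l = (dartStrand p nb δ.symm).m l := by
  have hsymm := halfType_symm (G.adj_sub (dart_adj δ))
  rw [dartStrand_m, dartStrand_m]
  have h1 : (view G nb δ.fst.1.1).matching (dartType δ) =
      (view G nb δ.symm.fst.1.1).matching (dartType δ.symm) := matching_symm hnb (dart_adj δ)
  have h2 : CellView.orient (dartType δ.symm) δ.symm.fst.1.2 δ.symm.snd.1.2 =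
      CellView.orient (dartType δ) δ.fst.1.2 δ.snd.1.2 := orient_symm hsymm.2 _ _
  rw [h1, h2]

/-- The halves of an edge head for the same place. -/
theorem opposite_symm (δ : G.coe.Dart) (h : dartType δ % 2 = 0) :
    Strand.Opposite S.d (dartStrand p nb δ) (dartStrand p nb δ.symm) := by
  have hsymm := halfType_symm (G.adj_sub (dart_adj δ))
  have h1 : dartType δ.symm / 2 = dartType δ / 2 := hsymm.1
  have h2 : dartType δ.symm % 2 = 0 ↔ ¬ dartType δ % 2 = 0 := hsymm.2
  have hneg : (dartStrand p nb δ.symm).neg = true := by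
    have : dartType δ.symm % 2 = 1 := by omega
    simp [dartStrand, Strand.translate, CellView.route, this]
  refine ⟨fun l hl => ?_, h1.symm, ?_, hneg⟩
  · have h3 : Step (dartType δ) δ.fst.1.1 δ.snd.1.1 := step_halfType (G.adj_sub (dart_adj δ))
    have h4 := h3 ⟨l, hl⟩
    have h5 : (dartStrand p nb δ.symm).shift l = if dartType δ / 2 = l then 1 else 0 := by
      rw [Strand.shift, hneg, ← h1]
      simp [dartStrand, Strand.translate, CellView.route]
    rw [h5, dartStrand_x, dartStrand_x]
    rw [if_pos h] at h4
    simp only [extend, hl, dif_pos]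
    have h6 : δ.symm.fst = δ.snd := rfl
    rw [h6, h4]
    ring
  · simp [dartStrand, Strand.translate, CellView.route, h]

/-- The number of boxes of the route of a half-edge, without the first one. -/
def Scale.steps (S : Scale) : ℕ := (S.d + 1) * (S.q + 1)

/-- Two boxes of routes of half-edges intersect exactly if they are equal, consecutive in a route,
or the last boxes of the two halves of an edge. -/
theorem meet_dart_iff (hnb : IsAdjacencyLists G nb) (hdeg : ∀ v, (G.neighborSet v).ncard ≤ 3)
    (hsep : ∀ v u u', G.Adj v u → G.Adj v u' → u ≠ u' → u.1 ≠ u'.1)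
    {δ δ' : G.coe.Dart} {n n' : ℕ} (hn : n ≤ S.steps) (hn' : n' ≤ S.steps) :
    (dartStrand p nb δ).Meet S (.chain S.q n) (dartStrand p nb δ') (.chain S.q n') ↔
      (δ = δ' ∧ (n = n' ∨ n + 1 = n' ∨ n' + 1 = n)) ∨
        (δ' = δ.symm ∧ n = S.steps ∧ n' = S.steps) := by
  have hd := S.three_le_d
  by_cases hδ : δ = δ'
  · subst hδ
    rw [Strand.meet_chain_iff (valid_dartStrand hnb hdeg δ) hn hn']
    have := δ.symm_ne.symm
    tauto
  have hA := valid_dartStrand (p := p) hnb hdeg δ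
  have hB := valid_dartStrand (p := p) hnb hdeg δ'
  have key : ∀ {δ δ' : G.coe.Dart} {n n' : ℕ}, n ≤ S.steps → n' ≤ S.steps →
      Strand.Opposite S.d (dartStrand p nb δ) (dartStrand p nb δ') → δ' = δ.symm →
      (RoutePart.chain S.q n).phase = S.d → (RoutePart.chain S.q n').phase = S.d →
      (dartStrand p nb δ).Meet S (.chain S.q n) (dartStrand p nb δ') (.chain S.q n') →
      n = S.steps ∧ n' = S.steps := by
    rintro δ δ' n n' hn hn' hopp rfl hph hph' h
    have hA := valid_dartStrand (p := p) hnb hdeg δ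
    have hB := valid_dartStrand (p := p) hnb hdeg δ.symm
    obtain ⟨r, hr⟩ := Strand.exists_run_of_phase_pos (P := .chain S.q n) (by omega)
    obtain ⟨r', hr'⟩ := Strand.exists_run_of_phase_pos (P := .chain S.q n') (by omega)
    have hv := RoutePart.chain_valid (S := S) hn
    have hv' := RoutePart.chain_valid (S := S) hn'
    rw [hph] at hr
    rw [hph'] at hr'
    rw [hr] at h hv
    rw [hr'] at h hv'
    obtain ⟨rfl, rfl⟩ := (hopp.meet_iff hA hB (fun l _ => dartStrand_m_symm hnb δ l) hv.2 hv'.2).1 h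
    exact ⟨RoutePart.chain_eq_last hr, RoutePart.chain_eq_last hr'⟩
  constructor
  · intro h
    rcases h.routes hA hB (RoutePart.chain_valid hn) (RoutePart.chain_valid hn') with
      ⟨⟨h1, h2⟩, h3, h4⟩ | ⟨h1, h2⟩ | ⟨⟨h1, h2⟩, h3, h4⟩
    · exfalso
      have hv : δ.fst.1 = δ'.fst.1 :=
        Prod.ext (cell_eq_of_x (dartStrand_x δ) (dartStrand_x δ') h3) (dig_inj (p := p) h4)
      refine Strand.not_meet_of_lane_ne hA hB (fun hl => hδ ?_) h1 h2 (RoutePart.chain_ne_hub _ _)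
        (RoutePart.chain_ne_hub _ _) h
      have hl : laneOf nb δ = laneOf nb δ' := hl
      rw [laneOf, laneOf, ← hv] at hl
      refine dart_ext hv ?_
      refine (List.idxOf_inj ?_).1 hl
      exact ((hnb _).2 _).2 (dart_adj δ)
    · exact (hδ (dart_eq_of_sameFamily hnb hsep h1 h2)).elim
    · rcases h3 with h3 | h3
      · have h5 := dart_eq_symm_of_opposite hnb hsep h3 h4
        exact Or.inr ⟨h5, key hn hn' h3 h5 h1 h2 h⟩
      · have h5 := dart_eq_symm_of_opposite hnb hsep h3 fun l hl hld => (h4 l hl hld).symm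
        refine Or.inr ⟨by rw [h5, δ'.symm_symm], (key hn' hn h3 h5 h2 h1 h.symm).symm⟩
  · rintro (⟨h, -⟩ | ⟨rfl, rfl, rfl⟩)
    · exact (hδ h).elim
    · rw [Scale.steps, RoutePart.chain_last]
      by_cases hpar : dartType δ % 2 = 0
      · exact ((opposite_symm δ hpar).meet_iff hA hB (fun l _ => dartStrand_m_symm hnb δ l)
          le_rfl le_rfl).2 ⟨rfl, rfl⟩
      · have hsymm := halfType_symm (G.adj_sub (dart_adj δ))
        have h2 : dartType δ.symm % 2 = 0 := hsymm.2.2 hpar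
        have h3 := opposite_symm (p := p) (nb := nb) δ.symm h2
        rw [δ.symm_symm] at h3
        exact ((h3.meet_iff hB hA (fun l _ => (dartStrand_m_symm hnb δ l).symm)
          le_rfl le_rfl).2 ⟨rfl, rfl⟩).symm

/-- The boxes of a vertex and of a half-edge intersect exactly if the half-edge starts there and the
box is its first one. -/
theorem meet_hub_dart_iff (hnb : IsAdjacencyLists G nb) (hdeg : ∀ v, (G.neighborSet v).ncard ≤ 3)
    {v : BlowupVertex S.d s t} {δ : G.coe.Dart} {n : ℕ} (hn : n ≤ S.steps) :
    (hubStrand p v).Meet S .hub (dartStrand p nb δ) (.chain S.q n) ↔ δ.fst.1 = v ∧ n = 0 := by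
  rw [Strand.meet_hub_chain_iff (valid_hubStrand v) (valid_dartStrand hnb hdeg δ) hn]
  constructor
  · rintro ⟨h, h3, h4⟩
    exact ⟨(Prod.ext (cell_eq_of_x (hubStrand_x v) (dartStrand_x δ) h3)
      (dig_inj (p := p) h4)).symm, h⟩
  · rintro ⟨rfl, rfl⟩
    exact ⟨rfl, fun l _ => rfl, fun l _ _ => rfl⟩

theorem meet_hub_hub_iff {v v' : BlowupVertex S.d s t} :
    (hubStrand p v).Meet S .hub (hubStrand p v') .hub ↔ v = v' := by
  constructor
  · intro h
    obtain ⟨h3, h4⟩ := h.same_vertex (valid_hubStrand v) (valid_hubStrand v')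
      (show RoutePart.Valid S .hub from trivial) (show RoutePart.Valid S .hub from trivial) rfl rfl
    exact Prod.ext (cell_eq_of_x (hubStrand_x v) (hubStrand_x v') h3) (dig_inj (p := p) h4)
  · rintro rfl
    exact Strand.meet_self _

end Graph

/-! ### The representation by boxes -/

theorem canonicalBox_inter_nonempty {d : ℕ} {L : ℝ} (hL : 0 ≤ L) {i j : Fin d}
    {a b : Fin d → ℝ} : (canonicalBox L i a ∩ canonicalBox L j b).Nonempty ↔
      ∀ l, a l ≤ b l + (if l = j then L else 1) ∧ b l ≤ a l + (if l = i then L else 1) := by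
  constructor
  · rintro ⟨x, h1, h2⟩ l
    exact ⟨(h1 l).1.trans (h2 l).2, (h2 l).1.trans (h1 l).2⟩
  · intro h
    refine ⟨fun l => max (a l) (b l), fun l => ⟨le_max_left _ _, max_le ?_ (h l).2⟩,
      fun l => ⟨le_max_right _ _, max_le (h l).1 ?_⟩⟩
    · split_ifs <;> linarith
    · split_ifs <;> linarith

/-- Adjacent vertices of a long subdivision have different neighbours. -/
theorem halfEdgeSubdivision_no_twins {V : Type} {G : SimpleGraph V} {N : ℕ} (hN : 2 ≤ N)
    {w w' : V ⊕ G.Dart × Fin (N + 1)} (h : (halfEdgeSubdivision G N).Adj w w') :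
    ∃ w'', w'' ≠ w ∧ w'' ≠ w' ∧
      ¬ ((halfEdgeSubdivision G N).Adj w w'' ↔ (halfEdgeSubdivision G N).Adj w' w'') := by
  have hub : ∀ {v : V} {δ : G.Dart} {n : Fin (N + 1)},
      (halfEdgeSubdivision G N).Adj (.inl v) (.inr (δ, n)) → ∃ w'', w'' ≠ .inl v ∧
      w'' ≠ .inr (δ, n) ∧ ¬ ((halfEdgeSubdivision G N).Adj (.inl v) w'' ↔
        (halfEdgeSubdivision G N).Adj (.inr (δ, n)) w'') := by
    rintro v δ n ⟨rfl, rfl⟩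
    refine ⟨.inr (δ, ⟨1, by omega⟩), by simp, by simp [Fin.ext_iff], fun hc => ?_⟩
    have h1 : (halfEdgeSubdivision G N).Adj (.inl δ.fst) (.inr (δ, ⟨1, by omega⟩)) :=
      hc.2 (Or.inl ⟨rfl, Or.inl (by simp)⟩)
    have := h1.2
    simp [Fin.ext_iff] at this
  have step : ∀ {δ : G.Dart} {n n' : Fin (N + 1)}, (n : ℕ) + 1 = n' → ∃ w'', w'' ≠ .inr (δ, n) ∧
      w'' ≠ .inr (δ, n') ∧ ¬ ((halfEdgeSubdivision G N).Adj (.inr (δ, n)) w'' ↔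
        (halfEdgeSubdivision G N).Adj (.inr (δ, n')) w'') := by
    intro δ n n' hn
    by_cases h0 : (n : ℕ) = 0
    · refine ⟨.inr (δ, ⟨2, by omega⟩), by simp [Fin.ext_iff, h0], by simp [Fin.ext_iff]; omega,
        fun hc => ?_⟩
      rcases hc.2 (Or.inl ⟨rfl, Or.inl (by simp; omega)⟩) with ⟨-, h1⟩ | ⟨h1, -⟩
      · simp at h1
        omega
      · exact δ.symm_ne h1.symm
    · refine ⟨.inr (δ, ⟨n - 1, by omega⟩), by simp [Fin.ext_iff]; omega,
        by simp [Fin.ext_iff]; omega, fun hc => ?_⟩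
      rcases hc.1 (Or.inl ⟨rfl, Or.inr (by simp; omega)⟩) with ⟨-, h1⟩ | ⟨h1, -⟩
      · simp at h1
        omega
      · exact δ.symm_ne h1.symm
  rcases w with v | ⟨δ, n⟩ <;> rcases w' with v' | ⟨δ', n'⟩
  · exact h.elim
  · exact hub h
  · obtain ⟨w'', h1, h2, h3⟩ := hub h.symm
    exact ⟨w'', h2, h1, fun hc => h3 hc.symm⟩
  · rcases h with ⟨rfl, h | h⟩ | ⟨rfl, rfl, rfl⟩
    · exact step h
    · obtain ⟨w'', h1, h2, h3⟩ := step (δ := δ) h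
      exact ⟨w'', h2, h1, fun hc => h3 hc.symm⟩
    · refine ⟨.inr (δ, ⟨N - 1, by omega⟩), by simp [Fin.ext_iff]; omega,
        by simp [Fin.ext_iff]; omega, fun hc => ?_⟩
      rcases hc.1 (Or.inl ⟨rfl, Or.inr (by simp; omega)⟩) with ⟨h1, -⟩ | ⟨-, -, h1⟩
      · exact δ.symm_ne h1
      · simp [Fin.ext_iff] at h1
        omega

section Graph

variable {S : Scale} {s t : ℕ} (p : Placement S t)

/-- The box with a given name, drawn for the cell with coordinates `1`. -/
noncomputable def CellView.code (σ : CellView t) (a : CellView.Label t) : BoxCode S.d where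
  axis := ⟨(CellView.labelPart S.q a).phase % S.d, Nat.mod_lt _ (Strand.zero_lt_d S)⟩
  num l := ((σ.labelRoute p a).numerator S (CellView.labelPart S.q a) l).toNat

/-- The distance between neighbouring cells, multiplied by the common denominator. -/
def Scale.cellScale (S : Scale) (l : ℕ) : ℕ := 16 * S.spacing l * S.denominator

variable (G : (blownUpCube S.d s t).Subgraph)
  (nb : BlowupVertex S.d s t → List (BlowupVertex S.d s t))

/-- The cell with a given number. -/
def cellOf {d s : ℕ} (z : Fin (s ^ d)) : Fin d → Fin s := finFunctionFinEquiv.symm z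

/-- The box with a given name in a given cell. -/
noncomputable def globalCode (y : (Fin S.d → Fin s) × CellView.Label t) : BoxCode S.d where
  axis := ((view G nb y.1).code p y.2).axis
  num l := y.1 l * S.cellScale l + ((view G nb y.1).code p y.2).num l

/-- The names of all boxes, in the order in which the program prints them. -/
noncomputable def boxNames : List ((Fin S.d → Fin s) × CellView.Label t) :=
  (List.finRange (s ^ S.d)).flatMap fun z =>
    ((view G nb (cellOf z)).labels S.steps).map fun a => (cellOf z, a)

/-- The representation of the subdivision by boxes. -/
noncomputable def allBoxes : List (BoxCode S.d) := (boxNames G nb).map (globalCode p G nb)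

variable {p G nb}

theorem nodup_boxNames : (boxNames G nb).Nodup := by
  rw [boxNames, List.nodup_flatMap]
  refine ⟨fun z _ => (CellView.nodup_labels _ _).map fun a a' h => by simpa using h,
    (List.nodup_finRange _).imp fun {z z'} hne => ?_⟩
  intro y hy hy'
  obtain ⟨a, -, rfl⟩ := List.mem_map.1 hy
  obtain ⟨a', -, h⟩ := List.mem_map.1 hy'
  simp only [Prod.mk.injEq, cellOf] at h
  exact hne (finFunctionFinEquiv.symm.injective h.1).symm

theorem mem_boxNames {y : (Fin S.d → Fin s) × CellView.Label t} :
    y ∈ boxNames G nb ↔ y.2 ∈ (view G nb y.1).labels S.steps := by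
  simp only [boxNames, List.mem_flatMap, List.mem_finRange, true_and, List.mem_map]
  constructor
  · rintro ⟨z, a, h, rfl⟩
    exact h
  · intro h
    refine ⟨finFunctionFinEquiv y.1, y.2, ?_, ?_⟩ <;> simp [cellOf, h]

/-- The cell and the name inside the cell. -/
def BoxName.name (nb : BlowupVertex S.d s t → List (BlowupVertex S.d s t)) {N : ℕ}
    (w : BoxName G N) : (Fin S.d → Fin s) × CellView.Label t := (w.cell, w.label nb)

theorem view_of_mem {v : BlowupVertex S.d s t} (h : v ∈ G.verts) :
    view G nb v.1 v.2 = some ((nb v).map fun u => (halfType v u, u.2)) := if_pos h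

theorem name_mem (hnb : IsAdjacencyLists G nb) (w : BoxName G S.steps) :
    w.name nb ∈ boxNames G nb := by
  rw [mem_boxNames]
  rcases w with v | ⟨δ, n⟩
  · exact (CellView.mem_labels_none _).2 ⟨_, view_of_mem v.2⟩
  · refine (CellView.mem_labels_some _).2 ⟨_, view_of_mem δ.fst.2, ?_, by omega⟩
    rw [List.length_map]
    exact laneOf_lt hnb δ

theorem exists_name (hnb : IsAdjacencyLists G nb) {y : (Fin S.d → Fin s) × CellView.Label t}
    (h : y ∈ boxNames G nb) : ∃ w : BoxName G S.steps, w.name nb = y := by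
  rw [mem_boxNames] at h
  obtain ⟨x, i, _ | ⟨j, n⟩⟩ := y
  · obtain ⟨l, hl⟩ := (CellView.mem_labels_none _).1 h
    have hv : (x, i) ∈ G.verts := by
      by_contra hv
      simp only [view, if_neg hv] at hl
      simp at hl
    exact ⟨.inl ⟨(x, i), hv⟩, rfl⟩
  · obtain ⟨l, hl, hj, hn⟩ := (CellView.mem_labels_some _).1 h
    have hv : (x, i) ∈ G.verts := by
      by_contra hv
      simp only [view, if_neg hv] at hl
      simp at hl
    have hl' := view_of_mem (nb := nb) hv
    rw [show view G nb (x, i).1 (x, i).2 = some l from hl] at hl'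
    obtain rfl := Option.some_injective _ hl'
    rw [List.length_map] at hj
    have hadj : G.Adj (x, i) (nb (x, i))[j] := ((hnb _).2 _).1 (List.getElem_mem hj)
    refine ⟨.inr (⟨(⟨(x, i), hv⟩, ⟨(nb (x, i))[j], G.edge_vert hadj.symm⟩), hadj⟩,
      ⟨n, by omega⟩), ?_⟩
    simp only [BoxName.name, BoxName.cell, BoxName.label, laneOf]
    rw [(hnb (x, i)).1.idxOf_getElem]

theorem name_inj (hnb : IsAdjacencyLists G nb) {w w' : BoxName G S.steps}
    (h : w.name nb = w'.name nb) : w = w' := by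
  rcases w with v | ⟨δ, n⟩ <;> rcases w' with v' | ⟨δ', n'⟩ <;>
    simp only [BoxName.name, BoxName.cell, BoxName.label, Prod.mk.injEq, reduceCtorEq, and_false,
      Option.some.injEq] at h
  · rw [Subtype.ext (Prod.ext h.1 h.2.1)]
  · have hv : δ.fst.1 = δ'.fst.1 := Prod.ext h.1 h.2.1
    have hl := h.2.2.1
    rw [laneOf, laneOf, ← hv] at hl
    have hu := (List.idxOf_inj (((hnb _).2 _).2 (dart_adj δ))).1 hl
    rw [dart_ext hv hu, Fin.ext h.2.2.2]

/-- The part of the route that a box is. -/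
def BoxName.part (S : Scale) {s t : ℕ} {G : (blownUpCube S.d s t).Subgraph} {N : ℕ} :
    BoxName G N → RoutePart
  | .inl _ => .hub
  | .inr (_, n) => .chain S.q n

theorem labelPart_label {N : ℕ} (w : BoxName G N) :
    CellView.labelPart S.q (w.label nb) = w.part S := by
  rcases w with v | ⟨δ, n⟩ <;> rfl

theorem globalCode_num (hnb : IsAdjacencyLists G nb) (hdeg : ∀ v, (G.neighborSet v).ncard ≤ 3)
    (w : BoxName G S.steps) (l : Fin S.d) :
    (((globalCode p G nb (w.name nb)).num l : ℕ) : ℝ) / S.denominator =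
      (w.strand p nb).corner S (w.part S) l := by
  have hval : ((view G nb w.cell).labelRoute p (w.label nb)).Valid S := by
    rcases w with v | ⟨δ, n⟩
    · exact CellView.valid_hubRoute p _
    · have h1 := laneOf_lt hnb δ
      have h2 := length_le_three hnb hdeg δ.fst.1
      have h3 := halfType_lt δ.fst.1 δ.snd.1
      have h4 := labelRoute_dart (p := p) hnb δ n
      simp only [BoxName.cell, BoxName.label]
      rw [h4]
      exact CellView.valid_route p _ _ (Nat.le_of_lt_succ h3) (by omega)
  have hx : ∀ l, ((view G nb w.cell).labelRoute p (w.label nb)).x l = 1 := by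
    intro l
    rcases w with v | ⟨δ, n⟩ <;> rfl
  have hpart : (w.part S).Valid S := by
    rcases w with v | ⟨δ, n⟩
    · trivial
    · exact RoutePart.chain_valid (Nat.le_of_lt_succ n.2)
  rw [Strand.corner_eq, BoxName.strand, labelStrand, Strand.numerator_translate _ hpart]
  congr 1
  have h0 := hval.numerator_nonneg hx hpart l
  have h1 : (((globalCode p G nb (w.name nb)).num l : ℕ) : ℤ) =
      Strand.numerator S ((view G nb w.cell).labelRoute p (w.label nb)) (w.part S) l +
        (16 * S.spacing l * S.denominator : ℕ) * (extend w.cell l : ℕ) := by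
    simp only [globalCode, CellView.code, BoxName.name, labelPart_label, Nat.cast_add,
      Int.toNat_of_nonneg h0]
    rw [extend, dif_pos l.2, Scale.cellScale]
    push_cast
    ring
  exact_mod_cast h1

theorem strand_inl {N : ℕ} (v : G.verts) :
    BoxName.strand p nb (.inl v : BoxName G N) = hubStrand p v.1 := rfl

/-- The boxes with names `w` and `w'` intersect exactly if `w = w'` or `w` and `w'` are adjacent in
the subdivision. -/
theorem meet_boxName_iff (hnb : IsAdjacencyLists G nb) (hdeg : ∀ v, (G.neighborSet v).ncard ≤ 3)
    (hsep : ∀ v u u', G.Adj v u → G.Adj v u' → u ≠ u' → u.1 ≠ u'.1)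
    (w w' : BoxName G S.steps) :
    (w.strand p nb).Meet S (w.part S) (w'.strand p nb) (w'.part S) ↔
      w = w' ∨ (halfEdgeSubdivision G.coe S.steps).Adj w w' := by
  rcases w with v | ⟨δ, n⟩ <;> rcases w' with v' | ⟨δ', n'⟩
  · rw [strand_inl, strand_inl]
    simp only [BoxName.part, meet_hub_hub_iff]
    constructor
    · intro h
      exact Or.inl (by rw [Subtype.ext h])
    · rintro (h | h)
      · simpa [Subtype.ext_iff] using h
      · exact h.elim
  · rw [strand_inl, strand_inr hnb]
    simp only [BoxName.part]
    rw [meet_hub_dart_iff hnb hdeg (Nat.le_of_lt_succ n'.2)]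
    constructor
    · rintro ⟨h, h'⟩
      exact Or.inr ⟨Subtype.ext h, Fin.ext h'⟩
    · rintro (h | ⟨rfl, rfl⟩)
      · simp at h
      · exact ⟨rfl, rfl⟩
  · rw [strand_inl, strand_inr hnb, iff_comm]
    simp only [BoxName.part]
    have key := meet_hub_dart_iff (p := p) hnb hdeg (v := v'.1) (δ := δ) (Nat.le_of_lt_succ n.2)
    constructor
    · rintro (h | ⟨rfl, rfl⟩)
      · simp at h
      · exact (key.2 ⟨rfl, rfl⟩).symm
    · intro h
      obtain ⟨h, h'⟩ := key.1 h.symm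
      exact Or.inr ⟨Subtype.ext h, Fin.ext h'⟩
  · rw [strand_inr hnb, strand_inr hnb]
    simp only [BoxName.part]
    rw [meet_dart_iff hnb hdeg hsep (Nat.le_of_lt_succ n.2) (Nat.le_of_lt_succ n'.2)]
    constructor
    · rintro (⟨rfl, h | h⟩ | ⟨rfl, h, h'⟩)
      · exact Or.inl (by rw [Fin.ext h])
      · exact Or.inr (Or.inl ⟨rfl, h⟩)
      · exact Or.inr (Or.inr ⟨rfl, Fin.ext h, Fin.ext h'⟩)
    · rintro (h | ⟨rfl, h⟩ | ⟨rfl, rfl, rfl⟩)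
      · simp only [Sum.inr.injEq, Prod.mk.injEq] at h
        exact Or.inl ⟨h.1, Or.inl (by rw [h.2])⟩
      · exact Or.inl ⟨rfl, Or.inr h⟩
      · exact Or.inr ⟨rfl, rfl, rfl⟩

/-- The index of a box in the list. -/
noncomputable def boxIndex (p : Placement S t) (hnb : IsAdjacencyLists G nb) :
    BoxName G S.steps ≃ Fin (allBoxes p G nb).length :=
  Equiv.ofBijective (fun w => ⟨(boxNames G nb).idxOf (w.name nb), by
    rw [allBoxes, List.length_map]
    exact List.idxOf_lt_length_of_mem (name_mem hnb w)⟩) <| by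
    constructor
    · intro w w' h
      simp only [Fin.mk.injEq] at h
      exact name_inj hnb ((List.idxOf_inj (name_mem hnb w)).1 h)
    · intro k
      have hk : (k : ℕ) < (boxNames G nb).length := by
        have := k.2
        simpa [allBoxes] using this
      obtain ⟨w, hw⟩ := exists_name hnb (List.getElem_mem hk)
      refine ⟨w, Fin.ext ?_⟩
      simp only [hw]
      exact nodup_boxNames.idxOf_getElem _ _

theorem boxFamily_boxIndex (hnb : IsAdjacencyLists G nb)
    (hdeg : ∀ v, (G.neighborSet v).ncard ≤ 3) (w : BoxName G S.steps) :
    boxFamily S.L S.denominator (allBoxes p G nb) (boxIndex p hnb w) =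
      canonicalBox S.L ⟨(w.part S).phase % S.d, Nat.mod_lt _ (Strand.zero_lt_d S)⟩
        fun l => (w.strand p nb).corner S (w.part S) l := by
  have h : (allBoxes p G nb).get (boxIndex p hnb w) = globalCode p G nb (w.name nb) := by
    simp only [allBoxes, List.get_eq_getElem, List.getElem_map]
    congr 1
    exact List.getElem_idxOf (List.idxOf_lt_length_of_mem (name_mem hnb w))
  unfold boxFamily
  rw [h]
  have h2 : (globalCode p G nb (w.name nb)).axis =
      ⟨(w.part S).phase % S.d, Nat.mod_lt _ (Strand.zero_lt_d S)⟩ := by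
    simp only [globalCode, CellView.code, BoxName.name, labelPart_label]
  rw [h2]
  congr 1
  funext l
  exact globalCode_num hnb hdeg w l

theorem boxes_inter_iff (hnb : IsAdjacencyLists G nb) (hdeg : ∀ v, (G.neighborSet v).ncard ≤ 3)
    (w w' : BoxName G S.steps) :
    (boxFamily S.L S.denominator (allBoxes p G nb) (boxIndex p hnb w) ∩
      boxFamily S.L S.denominator (allBoxes p G nb) (boxIndex p hnb w')).Nonempty ↔
      (w.strand p nb).Meet S (w.part S) (w'.strand p nb) (w'.part S) := by
  have hL := Strand.Λ_bounds S
  rw [boxFamily_boxIndex hnb hdeg, boxFamily_boxIndex hnb hdeg,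
    canonicalBox_inter_nonempty (by linarith)]
  constructor
  · intro h l hl
    simpa [Fin.ext_iff] using h ⟨l, hl⟩
  · intro h l
    simpa [Fin.ext_iff] using h l l.2

/-- The boxes represent the subdivision. -/
noncomputable def boxIso (hnb : IsAdjacencyLists G nb) (hdeg : ∀ v, (G.neighborSet v).ncard ≤ 3)
    (hsep : ∀ v u u', G.Adj v u → G.Adj v u' → u ≠ u' → u.1 ≠ u'.1) :
    halfEdgeSubdivision G.coe S.steps ≃g
      intersectionGraph (boxFamily S.L S.denominator (allBoxes p G nb)) where
  toEquiv := boxIndex p hnb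
  map_rel_iff' {w w'} := by
    change boxIndex p hnb w ≠ boxIndex p hnb w' ∧ _ ↔ _
    rw [boxes_inter_iff hnb hdeg, meet_boxName_iff hnb hdeg hsep, (boxIndex p hnb).injective.ne_iff]
    constructor
    · rintro ⟨h, h' | h'⟩
      · exact (h h').elim
      · exact h'
    · intro h
      exact ⟨h.ne, Or.inr h⟩

theorem Scale.two_le_steps (S : Scale) : 2 ≤ S.steps := by
  have := S.three_le_d
  have h : (S.d + 1) * 1 ≤ S.steps := Nat.mul_le_mul_left _ (by omega)
  omega

theorem injective_boxFamily (hnb : IsAdjacencyLists G nb)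
    (hdeg : ∀ v, (G.neighborSet v).ncard ≤ 3)
    (hsep : ∀ v u u', G.Adj v u → G.Adj v u' → u ≠ u' → u.1 ≠ u'.1) :
    Function.Injective (boxFamily S.L S.denominator (allBoxes p G nb)) := by
  suffices h : ∀ w w' : BoxName G S.steps,
      boxFamily S.L S.denominator (allBoxes p G nb) (boxIndex p hnb w) =
        boxFamily S.L S.denominator (allBoxes p G nb) (boxIndex p hnb w') → w = w' by
    intro k k' hk
    rw [← (boxIndex p hnb).apply_symm_apply k, ← (boxIndex p hnb).apply_symm_apply k'] at hk ⊢
    rw [h _ _ hk]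
  intro w w' hw
  by_contra hne
  -- equal boxes would be adjacent and have the same neighbours
  have key : ∀ w'', (w = w'' ∨ (halfEdgeSubdivision G.coe S.steps).Adj w w'') ↔
      (w' = w'' ∨ (halfEdgeSubdivision G.coe S.steps).Adj w' w'') := fun w'' => by
    rw [← meet_boxName_iff (p := p) hnb hdeg hsep, ← meet_boxName_iff (p := p) hnb hdeg hsep,
      ← boxes_inter_iff hnb hdeg, ← boxes_inter_iff hnb hdeg, hw]
  have hadj := ((key w').2 (Or.inl rfl)).resolve_left hne
  obtain ⟨w'', h1, h2, h3⟩ := halfEdgeSubdivision_no_twins S.two_le_steps hadj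
  have := key w''
  have h1' := h1.symm
  have h2' := h2.symm
  tauto

theorem isEvenSubdivision_boxes (hnb : IsAdjacencyLists G nb)
    (hdeg : ∀ v, (G.neighborSet v).ncard ≤ 3)
    (hsep : ∀ v u u', G.Adj v u → G.Adj v u' → u ≠ u' → u.1 ≠ u'.1) :
    IsEvenSubdivision (intersectionGraph (boxFamily S.L S.denominator (allBoxes p G nb))) G.coe :=
  (isEvenSubdivision_halfEdgeSubdivision G.coe S.steps).congr (boxIso hnb hdeg hsep)

theorem length_allBoxes_le (hnb : IsAdjacencyLists G nb)
    (hdeg : ∀ v, (G.neighborSet v).ncard ≤ 3) :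
    (allBoxes p G nb).length ≤ (3 * (S.steps + 1) + 1) * G.verts.ncard := by
  have h1 : (allBoxes p G nb).length = Nat.card (BoxName G S.steps) := by
    rw [Nat.card_congr (boxIndex p hnb), Nat.card_fin]
  let f : BoxName G S.steps → G.verts × Option (Fin 3 × Fin (S.steps + 1))
    | .inl v => (v, none)
    | .inr (δ, n) => (δ.fst, some (⟨laneOf nb δ, (laneOf_lt hnb δ).trans_le
        (length_le_three hnb hdeg _)⟩, n))
  have hf : Function.Injective f := by
    intro w w' h
    rcases w with v | ⟨δ, n⟩ <;> rcases w' with v' | ⟨δ', n'⟩ <;>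
      simp only [f, Prod.mk.injEq, reduceCtorEq, and_false, and_true, Option.some.injEq,
        Fin.mk.injEq] at h
    · rw [h]
    · refine name_inj hnb ?_
      simp only [BoxName.name, BoxName.cell, BoxName.label]
      rw [h.1, h.2.1, h.2.2]
  have h2 := Nat.card_le_card_of_injective f hf
  rw [h1]
  refine h2.trans (le_of_eq ?_)
  rw [Nat.card_prod, Nat.card_eq_fintype_card (α := Option _), Fintype.card_option,
    Fintype.card_prod, Fintype.card_fin, Fintype.card_fin, mul_comm]
  rfl

end Graph

/-! ### The view of a cell from its input words -/

section Decoding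

variable {d s t : ℕ}

theorem vertexNumber_eq (v : BlowupVertex d s t) :
    (vertexNumber v : ℕ) = v.2 + t * cellNumber v.1 := rfl

theorem cellNumber_cellOf (z : Fin (s ^ d)) : cellNumber (cellOf z) = z := by
  rw [cellNumber, cellOf, Equiv.apply_symm_apply]

variable (G : (blownUpCube d s t).Subgraph)
  (nb : BlowupVertex d s t → List (BlowupVertex d s t))

open Classical in
/-- The four words of a vertex in the input. -/
theorem inputMemory_vertex (v : BlowupVertex d s t) {k : ℕ} (hk : k < 4) :
    inputMemory G nb (4 * vertexNumber v + k + 1) =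
      if k = 0 then (if v ∈ G.verts then (nb v).length + 1 else 0)
      else ((nb v).map fun u => (vertexNumber u : ℕ)).getD (k - 1) 0 := by
  have h1 : (4 * (vertexNumber v : ℕ) + k + 1 - 1) / 4 = vertexNumber v := by omega
  have h2 : (4 * (vertexNumber v : ℕ) + k + 1 - 1) % 4 = k := by omega
  have h3 : (4 * (vertexNumber v : ℕ) + k + 1 - 1) / 4 < s ^ d * t := by
    rw [h1]
    exact (vertexNumber v).2
  have h4 : vertexNumber.symm ⟨(4 * (vertexNumber v : ℕ) + k + 1 - 1) / 4, h3⟩ = v := by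
    rw [Equiv.symm_apply_eq]
    exact Fin.ext h1
  rw [inputMemory, if_neg (by omega), dif_pos h3]
  generalize vertexNumber.symm ⟨(4 * (vertexNumber v : ℕ) + k + 1 - 1) / 4, h3⟩ = v' at h4
  subst h4
  simp only [h2]

theorem inputMemory_cases (a : ℕ) : inputMemory G nb a = (if a = 0 then s else 0) ∨
    ∃ (v : BlowupVertex d s t) (k : ℕ), k < 4 ∧ a = 4 * vertexNumber v + k + 1 := by
  by_cases h0 : a = 0
  · exact Or.inl (by simp [inputMemory, h0])
  by_cases h : (a - 1) / 4 < s ^ d * t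
  · refine Or.inr ⟨vertexNumber.symm ⟨(a - 1) / 4, h⟩, (a - 1) % 4, Nat.mod_lt _ (by omega), ?_⟩
    rw [Equiv.apply_symm_apply]
    simp only
    omega
  · exact Or.inl (by simp [inputMemory, h0, h])

variable {G nb}

theorem inputMemory_le (hdeg : ∀ v, (nb v).length ≤ 3) (hs : s ≤ s ^ d * t)
    (h4 : 4 ≤ s ^ d * t) (a : ℕ) : inputMemory G nb a ≤ s ^ d * t := by
  rcases inputMemory_cases G nb a with h | ⟨v, k, hk, rfl⟩
  · rw [h]
    split_ifs <;> omega
  · rw [inputMemory_vertex G nb v hk]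
    have := hdeg v
    split_ifs
    · omega
    · omega
    · by_cases hl : k - 1 < (nb v).length
      · rw [List.getD_eq_getElem _ _ (by simpa using hl), List.getElem_map]
        exact (vertexNumber _).2.le
      · rw [List.getD_eq_default _ _ (by simpa using hl)]
        omega

theorem inputMemory_lt_five (hdeg : ∀ v, (nb v).length ≤ 3) {a : ℕ} (ha : a % 4 = 1) :
    inputMemory G nb a < 5 := by
  rcases inputMemory_cases G nb a with h | ⟨v, k, hk, rfl⟩
  · rw [h, if_neg (by rintro rfl; omega)]
    omega
  · obtain rfl : k = 0 := by omega
    rw [inputMemory_vertex G nb v hk, if_pos rfl]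
    have := hdeg v
    split_ifs <;> omega

/-- The view of a cell, recovered from the number that the program computes from its words. -/
def decodeView (t B κ : ℕ) : CellView t := fun i =>
  if κ / B ^ (4 * (i : ℕ)) % B = 0 then none
  else some ((List.range (κ / B ^ (4 * (i : ℕ)) % B - 1)).map fun j =>
    (κ / B ^ (4 * (i : ℕ) + 1 + j) % B / t,
      ⟨κ / B ^ (4 * (i : ℕ) + 1 + j) % B % t, Nat.mod_lt _ i.pos⟩))

/-- The digit of a neighbour consists of its type and its position. -/
theorem viewDigit_neighbour (z : Fin (s ^ d)) (i : Fin t) {j : ℕ}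
    (hdeg : (nb (cellOf z, i)).length ≤ 3) (hj : j < (nb (cellOf z, i)).length) :
    viewDigit d s t (inputMemory G nb) z (4 * i + 1 + j) =
      halfType (cellOf z, i) (nb (cellOf z, i))[j] * t + (nb (cellOf z, i))[j].2 := by
  have ht := i.pos
  have hv : (vertexNumber (cellOf z, i) : ℕ) = i + t * z := by
    rw [vertexNumber_eq, cellNumber_cellOf]
  have ha : 4 * t * z + (4 * (i : ℕ) + 1 + j) + 1 =
      4 * vertexNumber (cellOf z, i) + (j + 1) + 1 := by
    rw [hv]
    ring
  have hm : inputMemory G nb (4 * t * z + (4 * (i : ℕ) + 1 + j) + 1) =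
      (nb (cellOf z, i))[j].2 + t * cellNumber (nb (cellOf z, i))[j].1 := by
    rw [ha, inputMemory_vertex G nb _ (by omega), if_neg (by omega), Nat.add_sub_cancel,
      List.getD_eq_getElem _ _ (by simpa using hj), List.getElem_map, vertexNumber_eq]
  rw [viewDigit, if_neg (by omega), hm, Nat.add_mul_div_left _ _ ht, Nat.add_mul_mod_self_left,
    Nat.div_eq_of_lt (Fin.is_lt _), zero_add, Nat.mod_eq_of_lt (Fin.is_lt _), halfType,
    cellNumber_cellOf, show (4 * (i : ℕ) + 1 + j) / 4 = i by omega]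

open Classical in
theorem viewDigit_vertex (z : Fin (s ^ d)) (i : Fin t) :
    viewDigit d s t (inputMemory G nb) z (4 * i) =
      if (cellOf z, i) ∈ G.verts then (nb (cellOf z, i)).length + 1 else 0 := by
  have hv : (vertexNumber (cellOf z, i) : ℕ) = i + t * z := by
    rw [vertexNumber_eq, cellNumber_cellOf]
  have ha : 4 * t * z + 4 * (i : ℕ) + 1 = 4 * vertexNumber (cellOf z, i) + 0 + 1 := by
    rw [hv]
    ring
  rw [viewDigit, if_pos (by omega), ha, inputMemory_vertex G nb _ (k := 0) (by omega), if_pos rfl]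

end Decoding

/-- The program recovers the view of every cell. -/
theorem decodeView_horner {S : Scale} {s t : ℕ} {G : (blownUpCube S.d s t).Subgraph}
    {nb : BlowupVertex S.d s t → List (BlowupVertex S.d s t)} (hdeg : ∀ v, (nb v).length ≤ 3)
    (z : Fin (s ^ S.d)) :
    decodeView t ((2 * S.d + 2) * t + 5) (horner (viewDigit S.d s t (inputMemory G nb) z)
      ((2 * S.d + 2) * t + 5) (4 * t) 0) = view G nb (cellOf z) := by
  funext i
  have ht := i.pos
  have hdig := horner_digit (f := viewDigit S.d s t (inputMemory G nb) z)
    (B := (2 * S.d + 2) * t + 5) (4 * t)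
    (fun k _ => viewDigit_lt ht fun hk => inputMemory_lt_five hdeg (by rw [mul_assoc]; omega)) 0
  have h0 := hdig (4 * i) (by omega)
  rw [viewDigit_vertex] at h0
  rw [decodeView, h0, view]
  by_cases hv : (cellOf z, i) ∈ G.verts
  · rw [if_pos hv, if_pos hv, if_neg (by omega), Nat.add_sub_cancel]
    congr 1
    refine List.ext_getElem (by simp) fun j hj hj' => ?_
    rw [List.length_map] at hj'
    have hj3 := hdeg (cellOf z, i)
    have hk : 4 * (i : ℕ) + 1 + j < 4 * t := by omega
    have h1 := hdig _ hk
    rw [viewDigit_neighbour z i hj3 hj'] at h1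
    simp only [List.getElem_map, List.getElem_range]
    refine Prod.ext ?_ (Fin.ext ?_)
    · simp only
      rw [h1, Nat.add_comm, Nat.add_mul_div_right _ _ ht, Nat.div_eq_of_lt (Fin.is_lt _), zero_add]
    · simp only
      rw [h1, Nat.mul_add_mod', Nat.mod_eq_of_lt (Fin.is_lt _)]
  · rw [if_neg hv, if_neg hv, if_pos rfl]

/-! ### The program -/

section Program

variable {S : Scale} {t : ℕ} (p : Placement S t)

/-- The boxes of the cells whose view has number `κ`. -/
noncomputable def boxTable (κ : ℕ) : List (BoxCode S.d) :=
  ((decodeView t ((2 * S.d + 2) * t + 5) κ).labels S.steps).map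
    ((decodeView t ((2 * S.d + 2) * t + 5) κ).code p)

theorem exists_bound_of_lists {d : ℕ} (tab : ℕ → List (BoxCode d)) (n : ℕ) :
    ∃ C, ∀ κ < n, ∀ b ∈ tab κ, ∀ i, b.num i ≤ C := by
  have h : {c | ∃ κ < n, ∃ b ∈ tab κ, ∃ i, b.num i = c}.Finite := by
    have : {c | ∃ κ < n, ∃ b ∈ tab κ, ∃ i, b.num i = c} =
        ⋃ κ ∈ Set.Iio n, ⋃ b ∈ {b | b ∈ tab κ}, Set.range b.num := by
      ext c
      simp
    rw [this]
    refine (Set.finite_Iio n).biUnion fun κ _ => ?_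
    exact (List.finite_toSet (tab κ)).biUnion fun b _ => Set.finite_range _
  obtain ⟨C, hC⟩ := h.bddAbove
  exact ⟨C, fun κ hκ b hb i => hC ⟨κ, hκ, b, hb, i, rfl⟩⟩

theorem outputWords_allBoxes {s : ℕ} {G : (blownUpCube S.d s t).Subgraph}
    {nb : BlowupVertex S.d s t → List (BlowupVertex S.d s t)} (hdeg : ∀ v, (nb v).length ≤ 3)
    (D : ℕ) : (D :: (List.range (s ^ S.d)).flatMap fun z =>
      CellProgram.boxWords (fun l => z / s ^ l % s * S.cellScale l)
        (boxTable p (horner (viewDigit S.d s t (inputMemory G nb) z)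
          ((2 * S.d + 2) * t + 5) (4 * t) 0))) = outputWords D (allBoxes p G nb) := by
  rw [outputWords, allBoxes, boxNames, List.map_flatMap, List.flatMap_assoc,
    ← List.map_coe_finRange_eq_range, List.flatMap_map]
  congr 2
  funext z
  rw [boxTable, decodeView_horner hdeg z, CellProgram.boxWords, List.flatMap_map, List.flatMap_map,
    List.flatMap_map]
  rfl

theorem mul_lt_two_pow {A X c : ℕ} (hX : 0 < X) (hc : A + 1 ≤ c) :
    A * X < 2 ^ (c * Nat.size X) := by
  have h1 : X < 2 ^ Nat.size X := Nat.lt_size_self X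
  have h2 : 0 < Nat.size X := Nat.size_pos.2 hX
  have h3 : A + Nat.size X ≤ c * Nat.size X := by nlinarith
  calc A * X ≤ 2 ^ A * X := Nat.mul_le_mul_right _ Nat.lt_two_pow_self.le
    _ < 2 ^ A * 2 ^ Nat.size X := Nat.mul_lt_mul_of_pos_left h1 (by positivity)
    _ = 2 ^ (A + Nat.size X) := (pow_add _ _ _).symm
    _ ≤ 2 ^ (c * Nat.size X) := Nat.pow_le_pow_right (by omega) h3

/-- A program and a constant that work for all cubes. -/
theorem exists_program (p : Placement S t) (ht4 : 4 ≤ t) : ∃ (P : RamProgram) (c : ℕ),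
    ∀ (s : ℕ), 1 ≤ s → ∀ (G : (blownUpCube S.d s t).Subgraph)
      (nb : BlowupVertex S.d s t → List (BlowupVertex S.d s t)), (∀ v, (nb v).length ≤ 3) →
      RamComputes (c * Nat.size (Fintype.card (BlowupVertex S.d s t))) P (inputMemory G nb)
        (c * Fintype.card (BlowupVertex S.d s t))
        (outputWords S.denominator (allBoxes p G nb)) := by
  obtain ⟨C, hC⟩ := exists_bound_of_lists (boxTable p) (((2 * S.d + 2) * t + 5) ^ (4 * t))
  set B := (2 * S.d + 2) * t + 5 with hB
  set T₁ := (CellProgram.start S.d S.denominator).time with hT₁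
  set T₂ := (CellProgram.cell S.d t S.cellScale (boxTable p)).time with hT₂
  -- a bound for the constants of the program, and for the factors of `X` in its numbers
  set A := 4 * t + 5 + B + B ^ (4 * t) + (64 * S.U * S.denominator + C) + S.denominator with hA
  refine ⟨CellProgram.main S.d t S.denominator S.cellScale (boxTable p), A + 1 + (T₁ + T₂ + 2),
    fun s hs G nb hdeg => ?_⟩
  have hd := S.three_le_d
  have hcard : Fintype.card (BlowupVertex S.d s t) = s ^ S.d * t := by
    simp [BlowupVertex]
  rw [hcard, ← outputWords_allBoxes p hdeg]
  have hsd : s ≤ s ^ S.d := Nat.le_self_pow (by omega) s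
  have hXs : s ^ S.d ≤ s ^ S.d * t := Nat.le_mul_of_pos_right _ (by omega)
  have hX4 : 4 ≤ s ^ S.d * t := ht4.trans (Nat.le_mul_of_pos_left _ (by omega))
  have hX : 0 < s ^ S.d * t := by omega
  have hw : ∀ a, a ≤ A * (s ^ S.d * t) →
      a < 2 ^ ((A + 1 + (T₁ + T₂ + 2)) * Nat.size (s ^ S.d * t)) := fun a ha =>
    ha.trans_lt (mul_lt_two_pow hX (Nat.le_add_right _ _))
  generalize hXd : s ^ S.d * t = X at *
  have hconst : ∀ a, a ≤ A → a ≤ A * X := fun a ha => ha.trans (Nat.le_mul_of_pos_right _ hX)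
  refine CellProgram.ramComputes_main (X := X) (C := C) ⟨fun l hl => ?_, hXd.le, ?_, ?_, ?_,
    fun l hl => ?_⟩ (by omega) hs ?_ ?_ ?_ ?_ hC ?_
  · exact (Nat.pow_le_pow_right hs hl).trans hXs
  · refine hw _ ?_
    calc 4 * X + 4 * t + 1 ≤ 4 * X + (4 * t + 1) * X := by
          have := Nat.le_mul_of_pos_right (4 * t + 1) hX
          omega
      _ = (4 * t + 5) * X := by ring
      _ ≤ A * X := Nat.mul_le_mul_right _ (by omega)
  · exact hw _ (hconst _ (by omega))
  · exact hw _ (hconst _ (show B ^ (4 * t) ≤ A by omega))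
  · refine hw _ ?_
    have h1 : S.cellScale l ≤ 64 * S.U * S.denominator := by
      unfold Scale.cellScale Scale.spacing
      refine Nat.mul_le_mul_right _ ?_
      split_ifs <;> omega
    calc s * S.cellScale l + C ≤ X * (64 * S.U * S.denominator) + C * X :=
          Nat.add_le_add (Nat.mul_le_mul (hsd.trans hXs) h1) (Nat.le_mul_of_pos_right _ hX)
      _ = (64 * S.U * S.denominator + C) * X := by ring
      _ ≤ A * X := Nat.mul_le_mul_right _ (by omega)
  · simp [inputMemory]
  · intro a
    rw [← hXd]
    exact inputMemory_le hdeg (by omega) (by omega) a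
  · exact fun a ha => inputMemory_lt_five hdeg ha
  · exact hw _ (hconst _ (by omega))
  · calc T₁ + s ^ S.d * (T₂ + 1) + 1 ≤ T₁ * X + X * (T₂ + 1) + X := by
          have := Nat.le_mul_of_pos_right T₁ hX
          have := Nat.mul_le_mul_right (T₂ + 1) hXs
          omega
      _ = (T₁ + T₂ + 2) * X := by ring
      _ ≤ (A + 1 + (T₁ + T₂ + 2)) * X := Nat.mul_le_mul_right _ (by omega)

end Program

/-! ### The dimensions -/

/-- The number of boxes in a straight part of a route, minus one. Such a part has a length of at
most `16 (U + W) = 176 W` units, with `W = 2 d (d + 1) ⌊L⌋`, and consecutive boxes are shifted by at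
most `⌊L⌋` units; two more boxes leave room at the ends. -/
def stepCount (d : ℕ) : ℕ := 176 * (2 * d * (d + 1)) + 2

/-- The dimensions for boxes of length `L`. -/
noncomputable def Scale.ofLength (d : ℕ) (hd : 3 ≤ d) (L : ℝ) (hL : 16 ≤ L) : Scale where
  d := d
  Λ := ⌊L⌋₊
  M := 2 * d * ⌊L⌋₊
  W := (d + 1) * (2 * d * ⌊L⌋₊)
  U := 10 * ((d + 1) * (2 * d * ⌊L⌋₊))
  q := stepCount d
  L := L
  three_le_d := hd
  sixteen_le_Λ := Nat.le_floor (by exact_mod_cast hL)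
  W_eq := rfl
  U_eq := rfl
  Λ_le := by
    calc 24 * ⌊L⌋₊ ≤ ((d + 1) * (2 * d)) * ⌊L⌋₊ := Nat.mul_le_mul_right _ (by nlinarith)
      _ = _ := by ring
  q_pos := by unfold stepCount; omega
  step_le := by
    refine le_of_eq ?_
    unfold stepCount
    ring
  le_step := by
    have h : 24 * ⌊L⌋₊ ≤ (2 * d * (d + 1)) * ⌊L⌋₊ := Nat.mul_le_mul_right _ (by nlinarith)
    unfold stepCount
    generalize hw : 2 * d * (d + 1) = w at *
    rw [show (d + 1) * (2 * d * ⌊L⌋₊) = w * ⌊L⌋₊ by rw [← hw]; ring]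
    nlinarith
  Λ_le_L := Nat.floor_le (by linarith)
  L_lt := Nat.lt_floor_add_one L

theorem mainTheorem7 (d : ℕ) (hd : 3 ≤ d) :
    ∃ K : ℕ, ∀ (L : ℝ) (t : ℕ), 16 ≤ L → (t : ℝ) = (L / 8) ^ (d - 1) →
      ∃ (P : RamProgram) (c : ℕ), ∀ (s : ℕ), 1 ≤ s →
        ∀ G : (blownUpCube d s t).Subgraph,
          (∀ v, (G.neighborSet v).ncard ≤ 3) →
          (∀ v u u', G.Adj v u → G.Adj v u' → u ≠ u' → u.1 ≠ u'.1) →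
          ∀ nb : BlowupVertex d s t → List (BlowupVertex d s t), IsAdjacencyLists G nb →
            ∃ (D : ℕ) (bs : List (BoxCode d)), 0 < D ∧
              Function.Injective (boxFamily L D bs) ∧
              IsEvenSubdivision (intersectionGraph (boxFamily L D bs)) G.coe ∧
              bs.length ≤ K * G.verts.ncard ∧
              RamComputes (c * Nat.size (Fintype.card (BlowupVertex d s t))) P (inputMemory G nb)
                (c * Fintype.card (BlowupVertex d s t)) (outputWords D bs) := by
  refine ⟨3 * ((d + 1) * (stepCount d + 1) + 1) + 1, fun L t hL ht => ?_⟩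
  let S := Scale.ofLength d hd L hL
  have hΛ := Strand.Λ_bounds S
  have htΛ : t ≤ S.Λ ^ (S.d - 1) := by
    have h1 : (t : ℝ) ≤ (S.Λ : ℝ) ^ (d - 1) := by
      rw [ht]
      refine pow_le_pow_left₀ (by linarith) ?_ _
      have h2 : L < S.Λ + 1 := hΛ.2.2
      linarith [hΛ.1]
    exact_mod_cast h1
  have ht4 : 4 ≤ t := by
    have h1 : (4 : ℝ) ≤ t := by
      rw [ht]
      calc (4 : ℝ) = 2 ^ 2 := by norm_num
        _ ≤ 2 ^ (d - 1) := pow_le_pow_right₀ (by norm_num) (by omega)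
        _ ≤ (L / 8) ^ (d - 1) := pow_le_pow_left₀ (by norm_num) (by linarith) _
    exact_mod_cast h1
  obtain ⟨p⟩ : Nonempty (Placement S t) := exists_placement le_rfl htΛ
  obtain ⟨P, c, hP⟩ := exists_program p ht4
  refine ⟨P, c, fun s hs G hdeg hsep nb hnb => ?_⟩
  exact ⟨S.denominator, allBoxes (S := S) p G nb, S.denominator_pos,
    injective_boxFamily (S := S) hnb hdeg hsep, isEvenSubdivision_boxes (S := S) hnb hdeg hsep,
    length_allBoxes_le (S := S) hnb hdeg,
    hP s hs G nb fun v => length_le_three (S := S) hnb hdeg v⟩
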